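/- Let $L$ be a compact connected smooth manifold (without boundary), $\varphi\in\mathrm{Diff}(L)$, and $\alpha\in\Omega^1(L)$ a closed nowhere-vanishing one-form with $\varphi^*\alpha=e^{\lambda}\alpha$ for some real $\lambda\neq 0$. Let $$\mathbb T_\varphi=\frac{L\times\mathbb R}{(x,t)\sim(\varphi(x),t+1)}$$ be the mapping torus. The forms $e^{-\lambda t}\alpha$ and $-\lambda\,dt$ on $L\times\mathbb R$ descend to one-forms $\omega_1,\omega_2$ on $\mathbb T_\varphi$, and $\ker\omega_1\cap\ker\omega_2$ is the tangent distribution of a foliation $\mathcal G=\mathcal G_{\alpha,\lambda}$ of $\mathbb T_\varphi$. For a foliation $\mathcal F$ on a compact manifold $M$, a deformation is a smooth path of foliations $\mathcal F_s$ of $M$, $s\in(-\delta,\delta)$, with $\mathcal F_0=\mathcal F$. It is generated by an isotopy if there is a smooth family of diffeomorphisms $\phi_s$ of $M$ with $\phi_0=\mathrm{id}$ and $T\mathcal F_s=(\phi_s)_*T\mathcal F$ for all small $s$. The foliation $\mathcal F$ is rigid if every deformation of it is generated by an isotopy. Let $N\mathcal F=TM/T\mathcal F$, with the Bott connection $\nabla_X\overline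 Y=\overline{[X,Y]}$ for $X\in\Gamma(T\mathcal F)$, $\overline Y\in\Gamma(N\mathcal F)$, and let $H^1(\mathcal F,N\mathcal F)$ be the first cohomology of the complex $(\Omega^\bullet(\mathcal F;N\mathcal F),d_\nabla)$ of leafwise forms with values in $N\mathcal F$. The infinitesimal deformation of a path $\mathcal F_s$ is $\dot\eta_0\in\Omega^1(\mathcal F;N\mathcal F)$, where $T\mathcal F_s=\mathrm{Graph}(\eta_s)$ for small $s$, after identifying $N\mathcal F$ with a complement of $T\mathcal F$ in $TM$. Then: 1. $\mathcal G_{\alpha,\lambda}$ is not rigid. 2. There is a closed $\beta\in\Omega^1(L)$ such that $[\alpha],[\beta]\in H^1(L)$ (de Rham cohomology) are linearly independent; in particular $\dim H^1(L)\geq 2$. 3. Let $\beta$ be any closed one-form on $L$ such that $[\alpha],[\beta]\in H^1(L)$ are linearly independent, and let $\rho\in C^\infty(\mathbb R)$ be not identically zero with support contained in $(0,1)$. Let $\rho(t)\beta\in\Omega^1(\mathbb T_\varphi)$ be the one-form given by this expression on the fundamental domain $L\times[0,1)$. For every $s\in\mathbb R$ the distribution $$\ker(\omega_1)\cap\ker\big(\omega_2+s\,\rho(t)\beta\big)$$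 is tangent to a foliation $\mathcal G_s$, and $(\mathcal G_s)$ is a deformation of $\mathcal G_{\alpha,\lambda}$. Its infinitesimal deformation is $\lambda^{-1}\,r(\rho(t)\beta)\otimes\overline{\partial_t}$, where $r$ is the restriction of forms to the leaves of $\mathcal G_{\alpha,\lambda}$. This is a one-cocycle whose class in $H^1(\mathcal G_{\alpha,\lambda},N\mathcal G_{\alpha,\lambda})$ is non-zero, and the path $(\mathcal G_s)$ is not generated by an isotopy. -/

import Mathlib

open Set Filter Topology Function Bundle
open scoped Manifold ContDiff

set_option linter.unusedSectionVars false

noncomputable section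

section Foliations

variable {E : Type*} [NormedAddCommGroup E] [NormedSpace ℝ E]
  {H : Type*} [TopologicalSpace H] (I : ModelWithCorners ℝ E H)
  (M : Type*) [TopologicalSpace M] [ChartedSpace H M] [IsManifold I ∞ M]

/-- Smooth vector fields on `M`. -/
abbrev SmoothVectorField : Type _ := Cₛ^∞⟮I; E, (TangentSpace I : M → Type _)⟯

/-- Smooth one-forms on `M`. -/
abbrev OneForm : Type _ := Cₛ^∞⟮I; E →L[ℝ] ℝ, fun x : M ↦ TangentSpace I x →L[ℝ] ℝ⟯

variable {I M}

lemma OneForm.contMDiff_apply (α : OneForm I M) (X : SmoothVectorField I M) :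
    ContMDiff I 𝓘(ℝ, ℝ) ∞ (fun x ↦ α x (X x)) := by
  intro x
  exact (contMDiffAt_section (E := Bundle.Trivial M ℝ) x).1
    (α.contMDiff.clm_bundle_apply X.contMDiff x)

lemma OneForm.mdifferentiableAt_apply (α : OneForm I M) (X : SmoothVectorField I M) (x : M) :
    MDifferentiableAt I 𝓘(ℝ, ℝ) (fun x ↦ α x (X x)) x :=
  (α.contMDiff_apply X x).mdifferentiableAt (by simp)

lemma SmoothVectorField.mdifferentiableAt (X : SmoothVectorField I M) (x : M) :
    MDifferentiableAt I I.tangent (fun y ↦ (⟨y, X y⟩ : TangentBundle I M)) x :=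
  (X.contMDiff x).mdifferentiableAt (by simp)

/-- The exterior derivative of a one-form, evaluated on vector fields:
`dα(X, Y) = X(α(Y)) - Y(α(X)) - α([X, Y])`. -/
def OneForm.extDeriv (α : OneForm I M) (X Y : SmoothVectorField I M) (x : M) : ℝ :=
  mvfderiv I (fun y ↦ α y (Y y)) x (X x) - mvfderiv I (fun y ↦ α y (X y)) x (Y x)
    - α x (VectorField.mlieBracket I X Y x)

/-- The pullback `f^*θ` of a one-form. -/
def covectorPullback {E' H' M' : Type*} [NormedAddCommGroup E'] [NormedSpace ℝ E']
    [TopologicalSpace H'] [TopologicalSpace M'] [ChartedSpace H' M']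
    (I : ModelWithCorners ℝ E H) (I' : ModelWithCorners ℝ E' H') (f : M → M')
    (θ : ∀ y : M', TangentSpace I' y →L[ℝ] ℝ) (x : M) : TangentSpace I x →L[ℝ] ℝ :=
  (θ (f x)).comp (mfderiv I I' f x)

lemma covectorPullback_comp {E' H' M' E'' H'' M'' : Type*}
    [NormedAddCommGroup E'] [NormedSpace ℝ E'] [TopologicalSpace H'] [TopologicalSpace M']
    [ChartedSpace H' M'] [NormedAddCommGroup E''] [NormedSpace ℝ E''] [TopologicalSpace H'']
    [TopologicalSpace M''] [ChartedSpace H'' M'']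
    {I' : ModelWithCorners ℝ E' H'} {I'' : ModelWithCorners ℝ E'' H''} {f : M → M'} {g : M' → M''}
    (hg : ContMDiff I' I'' ∞ g) (hf : ContMDiff I I' ∞ f)
    (θ : ∀ y : M'', TangentSpace I'' y →L[ℝ] ℝ) (x : M) :
    covectorPullback I I' f (covectorPullback I' I'' g θ) x =
      covectorPullback I I'' (g ∘ f) θ x := by
  have h := mfderiv_comp x ((hg (f x)).mdifferentiableAt (by simp))
    ((hf x).mdifferentiableAt (by simp))
  simp only [covectorPullback, h]
  rfl

variable (I M) in
/-- The closed one-forms. -/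
def closedOneForms : Submodule ℝ (OneForm I M) where
  carrier := {α | ∀ (X Y : SmoothVectorField I M) (x : M), α.extDeriv X Y x = 0}
  zero_mem' X Y x := by
    simp [OneForm.extDeriv, mvfderiv_const]
  add_mem' {α β} hα hβ X Y x := by
    have h1 := hα X Y x
    have h2 := hβ X Y x
    have e : ∀ Z : SmoothVectorField I M, (fun y ↦ (α + β) y (Z y)) =
      (fun y ↦ α y (Z y)) + fun y ↦ β y (Z y) := fun Z ↦ rfl
    simp only [OneForm.extDeriv, e] at *
    rw [mvfderiv_add (α.mdifferentiableAt_apply Y x) (β.mdifferentiableAt_apply Y x),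
      mvfderiv_add (α.mdifferentiableAt_apply X x) (β.mdifferentiableAt_apply X x)]
    simp
    linarith
  smul_mem' c α hα X Y x := by
    have h1 := hα X Y x
    have e : ∀ Z : SmoothVectorField I M, (fun y ↦ (c • α) y (Z y)) =
      (fun _ ↦ c) * (fun y ↦ α y (Z y)) := fun Z ↦ rfl
    simp only [OneForm.extDeriv, e] at h1 ⊢
    rw [mvfderiv_mul mdifferentiableAt_const (α.mdifferentiableAt_apply Y x),
      mvfderiv_mul mdifferentiableAt_const (α.mdifferentiableAt_apply X x)]
    simp [mvfderiv_const]
    linear_combination c * h1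

variable (I M) in
/-- The exact one-forms among the closed ones. -/
def exactOneForms : Submodule ℝ (closedOneForms I M) where
  carrier := {α | ∃ f : C^∞⟮I, M; 𝓘(ℝ, ℝ), ℝ⟯, ∀ x, α.1 x = mvfderiv I f x}
  zero_mem' := ⟨0, fun x ↦ by simp⟩
  add_mem' := by
    rintro α β ⟨f, hf⟩ ⟨g, hg⟩
    refine ⟨f + g, fun x ↦ ?_⟩
    have h := mvfderiv_add (I := I) (x := x) (f.contMDiff.contMDiffAt.mdifferentiableAt (by simp))
      (g.contMDiff.contMDiffAt.mdifferentiableAt (by simp))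
    simp only [Submodule.coe_add, ContMDiffSection.coe_add, Pi.add_apply, hf, hg]
    exact h.symm
  smul_mem' := by
    rintro c α ⟨f, hf⟩
    refine ⟨c • f, fun x ↦ ?_⟩
    have h := mvfderiv_mul (I := I) (x := x) (mdifferentiableAt_const (c := c))
      (f.contMDiff.contMDiffAt.mdifferentiableAt (by simp))
    rw [mvfderiv_const, smul_zero, add_zero] at h
    simp only [Submodule.coe_smul, ContMDiffSection.coe_smul, Pi.smul_apply, hf]
    exact h.symm

variable (I M) in
/-- The first de Rham cohomology group. -/
abbrev DeRhamH1 : Type _ := closedOneForms I M ⧸ exactOneForms I M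


/-- A smooth foliation, given by its tangent distribution: a smooth involutive subbundle of the
tangent bundle. -/
structure Foliation (I : ModelWithCorners ℝ E H) (M : Type*) [TopologicalSpace M]
    [ChartedSpace H M] [IsManifold I ∞ M] where
  /-- The dimension of the leaves. -/
  rank : ℕ
  /-- The tangent spaces to the leaves. -/
  tangent : ∀ x : M, Submodule ℝ (TangentSpace I x)
  /-- The tangent distribution has smooth local frames. -/
  exists_frame : ∀ x₀ : M, ∃ U ∈ 𝓝 x₀, ∃ V : Fin rank → ∀ x : M, TangentSpace I x,
    (∀ i, ContMDiffOn I I.tangent ∞ (fun x ↦ (⟨x, V i x⟩ : TangentBundle I M)) U) ∧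
    ∀ x ∈ U, LinearIndependent ℝ (fun i ↦ V i x) ∧
      Submodule.span ℝ (range fun i ↦ V i x) = tangent x
  /-- The Lie bracket of two vector fields tangent to the distribution is tangent to it. -/
  involutive : ∀ X Y : SmoothVectorField I M, (∀ x, X x ∈ tangent x) → (∀ x, Y x ∈ tangent x) →
    ∀ x, VectorField.mlieBracket I X Y x ∈ tangent x

namespace Foliation

variable (F : Foliation I M)

/-- `F_t`, `t ∈ (-δ, δ)`, is a smooth path of foliations starting at `F`: the tangent
distributions have local frames that depend smoothly on `(t, x)`. -/
structure IsDeformation (δ : ℝ) (Ft : ℝ → Foliation I M) : Prop where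
  zero : (Ft 0).tangent = F.tangent
  exists_frame : ∀ t₀ ∈ Ioo (-δ) δ, ∀ x₀ : M, ∃ U ∈ 𝓝 (t₀, x₀),
    ∃ V : Fin F.rank → ℝ → ∀ x : M, TangentSpace I x,
      (∀ i, ContMDiffOn (𝓘(ℝ, ℝ).prod I) I.tangent ∞
        (fun p : ℝ × M ↦ (⟨p.2, V i p.1 p.2⟩ : TangentBundle I M)) U) ∧
      ∀ p ∈ U, LinearIndependent ℝ (fun i ↦ V i p.1 p.2) ∧
        Submodule.span ℝ (range fun i ↦ V i p.1 p.2) = (Ft p.1).tangent p.2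

/-- `F_t` is generated by an isotopy for small `t`: `TF_t = (φ_t)_* TF`. -/
def IsGeneratedByIsotopy (Ft : ℝ → Foliation I M) : Prop :=
  ∃ ε > 0, ∃ Φ : ℝ → (M ≃ₘ⟮I, I⟯ M),
    (∀ x, Φ 0 x = x) ∧
    ContMDiffOn (𝓘(ℝ, ℝ).prod I) I ∞ (fun p : ℝ × M ↦ Φ p.1 p.2) (Ioo (-ε) ε ×ˢ univ) ∧
    ∀ t ∈ Ioo (-ε) ε, ∀ x,
      (Ft t).tangent (Φ t x) = (F.tangent x).map (mfderiv I I (Φ t) x : _ →ₗ[ℝ] _)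

/-- A foliation is rigid if all its deformations are generated by isotopies for small times. -/
def IsRigid : Prop :=
  ∀ δ > 0, ∀ Ft : ℝ → Foliation I M, F.IsDeformation δ Ft → F.IsGeneratedByIsotopy Ft

/-- The fibers of the normal bundle `NF = TM / TF`. -/
def Normal (x : M) : Type _ := TangentSpace I x ⧸ F.tangent x

instance (x : M) : AddCommGroup (F.Normal x) :=
  inferInstanceAs (AddCommGroup (TangentSpace I x ⧸ F.tangent x))

instance (x : M) : Module ℝ (F.Normal x) :=
  inferInstanceAs (Module ℝ (TangentSpace I x ⧸ F.tangent x))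

/-- The projection `T_xM → N_xF`. -/
def normalProj (x : M) : TangentSpace I x →ₗ[ℝ] F.Normal x := (F.tangent x).mkQ

lemma normalProj_eq_zero_iff (x : M) (v : TangentSpace I x) :
    F.normalProj x v = 0 ↔ v ∈ F.tangent x := Submodule.Quotient.mk_eq_zero _

/-- The vector fields tangent to the foliation, `Γ(TF)`. -/
def tangentFields : Submodule ℝ (SmoothVectorField I M) where
  carrier := {X | ∀ x, X x ∈ F.tangent x}
  zero_mem' x := (F.tangent x).zero_mem
  add_mem' hX hY x := (F.tangent x).add_mem (hX x) (hY x)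
  smul_mem' c _ hX x := (F.tangent x).smul_mem c (hX x)

/-- The section `x ↦ Y x mod TF` of the normal bundle defined by a vector field `Y`. -/
def toNormal : SmoothVectorField I M →ₗ[ℝ] ∀ x, F.Normal x where
  toFun Y x := F.normalProj x (Y x)
  map_add' X Y := by ext x; simp
  map_smul' c X := by ext x; simp

/-- The smooth sections of the normal bundle, `Γ(NF)`: those induced by smooth vector fields. -/
def normalSections : Submodule ℝ (∀ x, F.Normal x) := LinearMap.range F.toNormal

lemma mem_tangentFields_iff {X : SmoothVectorField I M} :
    X ∈ F.tangentFields ↔ F.toNormal X = 0 := by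
  simp [funext_iff, toNormal, tangentFields, normalProj_eq_zero_iff]

end Foliation

lemma isManifold_minSmoothness_two : IsManifold I (minSmoothness ℝ 2) M :=
  IsManifold.of_le (n := ∞) (by
    rw [minSmoothness_of_isRCLikeNormedField]
    exact WithTop.coe_le_coe.2 (le_top : (2 : ℕ∞) ≤ ⊤))

variable [CompleteSpace E]

/-- The Lie bracket of smooth vector fields. -/
def SmoothVectorField.bracket (X Y : SmoothVectorField I M) : SmoothVectorField I M where
  toFun := VectorField.mlieBracket I X Y
  contMDiff_toFun := by
    have : IsManifold I (minSmoothness ℝ 2) M := isManifold_minSmoothness_two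
    have : IsManifold I ((⊤ : ℕ∞) + 1) M := by simpa
    exact ContDiff.mlieBracket_vectorField (m := ⊤) (n := ⊤) X.contMDiff Y.contMDiff (by simp)

lemma SmoothVectorField.bracket_add (X Y Z : SmoothVectorField I M) :
    X.bracket (Y + Z) = X.bracket Y + X.bracket Z := by
  have : IsManifold I (minSmoothness ℝ 2) M := isManifold_minSmoothness_two
  ext x
  exact VectorField.mlieBracket_add_right (Y.mdifferentiableAt x) (Z.mdifferentiableAt x)

lemma SmoothVectorField.bracket_smul (X Y : SmoothVectorField I M) (c : ℝ) :
    X.bracket (c • Y) = c • X.bracket Y := by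
  have : IsManifold I (minSmoothness ℝ 2) M := isManifold_minSmoothness_two
  ext x
  exact VectorField.mlieBracket_const_smul_right (Y.mdifferentiableAt x)

namespace Foliation

variable (F : Foliation I M)

lemma bracket_mem (V W : F.tangentFields) : V.1.bracket W.1 ∈ F.tangentFields :=
  F.involutive V W V.2 W.2

lemma toNormal_bracket_eq (V : F.tangentFields) {Y Y' : SmoothVectorField I M}
    (h : F.toNormal Y = F.toNormal Y') :
    F.toNormal (V.1.bracket Y) = F.toNormal (V.1.bracket Y') := by
  have h1 : Y - Y' ∈ F.tangentFields := by
    rw [mem_tangentFields_iff, map_sub, h, sub_self]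
  have h2 := (mem_tangentFields_iff F).1 (F.bracket_mem V ⟨_, h1⟩)
  have h3 : V.1.bracket Y = V.1.bracket (Y - Y') + V.1.bracket Y' := by
    rw [← SmoothVectorField.bracket_add, sub_add_cancel]
  rw [h3, map_add, h2, zero_add]

/-- The Bott connection `∇_V : Γ(NF) → Γ(NF)`, `∇_V (Y mod TF) = [V, Y] mod TF`. -/
def bott (V : F.tangentFields) : F.normalSections →ₗ[ℝ] F.normalSections where
  toFun s := ⟨F.toNormal (V.1.bracket s.2.choose), _, rfl⟩
  map_add' s s' := Subtype.ext <| by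
    change _ = F.toNormal _ + F.toNormal _
    rw [← map_add, ← SmoothVectorField.bracket_add]
    refine F.toNormal_bracket_eq V ?_
    rw [map_add, s.2.choose_spec, s'.2.choose_spec, (s + s').2.choose_spec]
    rfl
  map_smul' c s := Subtype.ext <| by
    change _ = c • F.toNormal _
    rw [← map_smul, ← SmoothVectorField.bracket_smul]
    refine F.toNormal_bracket_eq V ?_
    rw [map_smul, s.2.choose_spec, (c • s).2.choose_spec]
    rfl

lemma bott_toNormal (V : F.tangentFields) (Y : SmoothVectorField I M) :
    F.bott V ⟨F.toNormal Y, Y, rfl⟩ = ⟨F.toNormal (V.1.bracket Y), _, rfl⟩ :=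
  Subtype.ext <| F.toNormal_bracket_eq V <|
    Exists.choose_spec (⟨Y, rfl⟩ : F.toNormal Y ∈ LinearMap.range F.toNormal)

/-- Families of linear maps `T_xF → N_xF`, without smoothness. -/
def NormalCovector : Type _ := ∀ x, F.tangent x →ₗ[ℝ] F.Normal x

instance : AddCommGroup F.NormalCovector :=
  inferInstanceAs (AddCommGroup (∀ x, F.tangent x →ₗ[ℝ] F.Normal x))

instance : Module ℝ F.NormalCovector :=
  inferInstanceAs (Module ℝ (∀ x, F.tangent x →ₗ[ℝ] F.Normal x))

/-- The leafwise one-forms with values in the normal bundle, `Ω¹(F; NF) = Γ(T*F ⊗ NF)`. A family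
of linear maps `T_xF → N_xF` is smooth if it takes smooth sections to smooth sections. -/
def normalOneForms : Submodule ℝ F.NormalCovector where
  carrier := {η | ∀ V : F.tangentFields, (fun x ↦ η x ⟨V.1 x, V.2 x⟩) ∈ F.normalSections}
  zero_mem' _ := F.normalSections.zero_mem
  add_mem' hη hθ V := F.normalSections.add_mem (hη V) (hθ V)
  smul_mem' c _ hη V := F.normalSections.smul_mem c (hη V)

/-- The section `η(V)` of the normal bundle, for `η ∈ Ω¹(F; NF)` and `V ∈ Γ(TF)`. -/
def applyField (η : F.normalOneForms) (V : F.tangentFields) : F.normalSections :=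
  ⟨fun x ↦ η.1 x ⟨V.1 x, V.2 x⟩, η.2 V⟩

/-- The one-cocycles: `(d_∇ η)(V, W) = ∇_V (η(W)) - ∇_W (η(V)) - η([V, W])` vanishes. -/
def normalCocycles : Submodule ℝ F.normalOneForms where
  carrier := {η | ∀ V W : F.tangentFields,
    F.bott V (F.applyField η W) - F.bott W (F.applyField η V)
      - F.applyField η ⟨V.1.bracket W.1, F.bracket_mem V W⟩ = 0}
  zero_mem' V W := by
    have h : ∀ X, F.applyField 0 X = 0 := fun X ↦ rfl
    simp [h]
  add_mem' {η θ} hη hθ V W := by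
    have h : ∀ X, F.applyField (η + θ) X = F.applyField η X + F.applyField θ X := fun X ↦ rfl
    have := congrArg₂ (· + ·) (hη V W) (hθ V W)
    simp only [h, map_add, add_zero] at this ⊢
    rw [← this]
    abel
  smul_mem' c η hη V W := by
    have h : ∀ X, F.applyField (c • η) X = c • F.applyField η X := fun X ↦ rfl
    have := congrArg (c • ·) (hη V W)
    simp only [smul_sub, smul_zero] at this
    simpa only [h, map_smul] using this

/-- The one-coboundaries: `η = d_∇ s` for a section `s` of the normal bundle, i.e.
`η(V) = ∇_V s`. -/
def normalCoboundaries : Submodule ℝ F.normalCocycles where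
  carrier := {η | ∃ s : F.normalSections, ∀ V : F.tangentFields, F.applyField η.1 V = F.bott V s}
  zero_mem' := ⟨0, fun V ↦ by rw [map_zero]; rfl⟩
  add_mem' := by
    rintro η θ ⟨s, hs⟩ ⟨s', hs'⟩
    refine ⟨s + s', fun V ↦ ?_⟩
    rw [map_add, ← hs, ← hs']
    rfl
  smul_mem' := by
    rintro c η ⟨s, hs⟩
    refine ⟨c • s, fun V ↦ ?_⟩
    rw [map_smul, ← hs]
    rfl

/-- The cohomology group `H¹(F, NF)` with respect to the Bott connection. -/
abbrev NormalH1 : Type _ := F.normalCocycles ⧸ F.normalCoboundaries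

/-- `η` is the infinitesimal deformation of the path `F_t`: at every point and for every
complement `C ≃ N_xF` of `T_xF`, for small `t` the space `T_xF_t` is the graph of a linear map
`h_t : T_xF → C`, whose derivative at `t = 0` is `η`. -/
def IsInfinitesimalDeformation (Ft : ℝ → Foliation I M) (η : F.normalOneForms) : Prop :=
  ∀ (x : M) (C : Submodule ℝ (TangentSpace I x)), IsCompl (F.tangent x) C →
    ∃ h : ℝ → (F.tangent x →ₗ[ℝ] TangentSpace I x),
      (∀ t v, h t v ∈ C) ∧
      (∀ᶠ t in 𝓝 (0 : ℝ), (Ft t).tangent x = LinearMap.range ((F.tangent x).subtype + h t)) ∧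
      ∀ v : F.tangent x, ∃ w : TangentSpace I x,
        HasDerivAt (fun t ↦ h t v) w 0 ∧ F.normalProj x w = η.1 x v

end Foliation

end Foliations

section MappingTorus

variable {E : Type*} [NormedAddCommGroup E] [NormedSpace ℝ E]
  {H : Type*} [TopologicalSpace H] {I : ModelWithCorners ℝ E H}
  {L : Type*} [TopologicalSpace L] [ChartedSpace H L]

/-- The action of `ℤ` on `L × ℝ` generated by `(x, t) ↦ (φ x, t + 1)`. -/
@[reducible] def deckAction (φ : L ≃ₘ⟮I, I⟯ L) : AddAction ℤ (L × ℝ) where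
  vadd n z := ((φ.toEquiv ^ n : Equiv.Perm L) z.1, z.2 + n)
  zero_vadd z := by
    change ((φ.toEquiv ^ (0 : ℤ) : Equiv.Perm L) z.1, z.2 + ((0 : ℤ) : ℝ)) = z
    simp
  add_vadd m n z := by
    change ((φ.toEquiv ^ (m + n) : Equiv.Perm L) z.1, z.2 + ((m + n : ℤ) : ℝ)) =
      ((φ.toEquiv ^ m : Equiv.Perm L) ((φ.toEquiv ^ n : Equiv.Perm L) z.1), z.2 + (n : ℝ) + (m : ℝ))
    rw [zpow_add, Equiv.Perm.mul_apply]
    push_cast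
    congr 1
    ring

/-- The deck transformation `(x, t) ↦ (φⁿ x, t + n)`. -/
def deckMap (φ : L ≃ₘ⟮I, I⟯ L) (n : ℤ) (z : L × ℝ) : L × ℝ :=
  ((φ.toEquiv ^ n : Equiv.Perm L) z.1, z.2 + n)

/-- The mapping torus `L × ℝ / ((x, t) ∼ (φ x, t + 1))`. -/
def MappingTorus (φ : L ≃ₘ⟮I, I⟯ L) : Type _ :=
  @AddAction.orbitRel.Quotient ℤ (L × ℝ) _ (deckAction φ)

namespace MappingTorus

/-- The projection `L × ℝ → T_φ`. -/
def proj (φ : L ≃ₘ⟮I, I⟯ L) (z : L × ℝ) : MappingTorus φ :=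
  Quotient.mk (@AddAction.orbitRel ℤ (L × ℝ) _ (deckAction φ)) z

lemma proj_surjective (φ : L ≃ₘ⟮I, I⟯ L) : Surjective (proj φ) := Quotient.mk_surjective

lemma proj_eq_iff (φ : L ≃ₘ⟮I, I⟯ L) {z w : L × ℝ} :
    proj φ z = proj φ w ↔ ∃ n : ℤ, deckMap φ n w = z := by
  let _ := deckAction φ
  exact Quotient.eq.trans (AddAction.orbitRel_apply.trans Iff.rfl)

lemma contMDiff_zpow (φ : L ≃ₘ⟮I, I⟯ L) (n : ℤ) :
    ContMDiff I I ∞ ((φ.toEquiv ^ n : Equiv.Perm L) : L → L) := by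
  induction n with
  | zero => simpa using contMDiff_id
  | succ n ih =>
    rw [zpow_add, zpow_one, Equiv.Perm.coe_mul]
    exact ih.comp φ.contMDiff
  | pred n ih =>
    rw [sub_eq_add_neg, zpow_add, zpow_neg_one, Equiv.Perm.coe_mul]
    exact ih.comp φ.symm.contMDiff

lemma contMDiff_deckMap (φ : L ≃ₘ⟮I, I⟯ L) (n : ℤ) :
    ContMDiff (I.prod 𝓘(ℝ, ℝ)) (I.prod 𝓘(ℝ, ℝ)) ∞ (deckMap φ n) :=
  ((contMDiff_zpow φ n).comp contMDiff_fst).prodMk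
    (contMDiff_snd.add contMDiff_const)

instance (φ : L ≃ₘ⟮I, I⟯ L) : TopologicalSpace (MappingTorus φ) :=
  @instTopologicalSpaceQuotient (L × ℝ) (@AddAction.orbitRel ℤ (L × ℝ) _ (deckAction φ)) _

lemma continuousConstVAdd (φ : L ≃ₘ⟮I, I⟯ L) :
    letI := deckAction φ; ContinuousConstVAdd ℤ (L × ℝ) :=
  letI := deckAction φ
  ⟨fun n ↦ (contMDiff_deckMap φ n).continuous⟩

lemma isCancelVAdd (φ : L ≃ₘ⟮I, I⟯ L) :
    letI := deckAction φ; IsCancelVAdd ℤ (L × ℝ) :=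
  letI := deckAction φ
  { right_cancel' := fun a b c h ↦ by
      have h2 : c.2 + (a : ℝ) = c.2 + (b : ℝ) := congrArg Prod.snd h
      exact_mod_cast add_left_cancel h2 }

lemma properlyDiscontinuousVAdd (φ : L ≃ₘ⟮I, I⟯ L) :
    letI := deckAction φ; ProperlyDiscontinuousVAdd ℤ (L × ℝ) := by
  let _ := deckAction φ
  refine ⟨fun {K K'} hK hK' ↦ ?_⟩
  obtain ⟨a, ha⟩ := (hK.image continuous_snd).isBounded.subset_closedBall (0 : ℝ)
  obtain ⟨b, hb⟩ := (hK'.image continuous_snd).isBounded.subset_closedBall (0 : ℝ)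
  refine (isCompact_iff_finite.1
    (isCompact_iff_finite.2 (Set.finite_Icc (-⌈a + b⌉) ⌈a + b⌉))).subset ?_
  rintro n ⟨w, ⟨z, hz, rfl⟩, hw⟩
  have h1 := ha (mem_image_of_mem _ hz)
  have h2 : z.2 + (n : ℝ) ∈ Metric.closedBall (0 : ℝ) b := hb (mem_image_of_mem _ hw)
  rw [mem_closedBall_zero_iff, Real.norm_eq_abs, abs_le] at h1 h2
  have h3 := Int.le_ceil (a + b)
  constructor
  · have : (-⌈a + b⌉ : ℝ) ≤ n := by linarith [h1.1, h1.2, h2.1, h2.2]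
    exact_mod_cast this
  · have : (n : ℝ) ≤ ⌈a + b⌉ := by linarith [h1.1, h1.2, h2.1, h2.2]
    exact_mod_cast this

variable [T2Space L] [CompactSpace L]

lemma isLocalHomeomorph_proj (φ : L ≃ₘ⟮I, I⟯ L) : IsLocalHomeomorph (proj φ) :=
  letI := deckAction φ
  haveI := continuousConstVAdd φ
  haveI := isCancelVAdd φ
  haveI := properlyDiscontinuousVAdd φ
  (isAddQuotientCoveringMap_quotientMk_of_properlyDiscontinuousVAdd
    (G := ℤ) (E := L × ℝ)).isCoveringMap.isLocalHomeomorph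

/-- Charts of the mapping torus: local inverses of the projection followed by charts of `L × ℝ`. -/
instance (φ : L ≃ₘ⟮I, I⟯ L) : ChartedSpace (ModelProd H ℝ) (MappingTorus φ) :=
  (isLocalHomeomorph_proj φ).chartedSpace (proj_surjective φ)

lemma isOpenMap_proj (φ : L ≃ₘ⟮I, I⟯ L) : IsOpenMap (proj φ) :=
  (isLocalHomeomorph_proj φ).isOpenMap

instance (φ : L ≃ₘ⟮I, I⟯ L) : T2Space (MappingTorus φ) := by
  let _ := deckAction φ
  have := continuousConstVAdd φ
  have := properlyDiscontinuousVAdd φ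
  exact t2Space_of_properlyDiscontinuousVAdd_of_t2Space

/-- Near `y`, a local inverse of the projection composed with the projection is a deck map. -/
lemma localInverseAt_proj_eventuallyEq (φ : L ≃ₘ⟮I, I⟯ L) (z y : L × ℝ)
    (hy : proj φ y ∈ ((isLocalHomeomorph_proj φ).localInverseAt z).source) :
    ∃ n : ℤ, (fun w ↦ (isLocalHomeomorph_proj φ).localInverseAt z (proj φ w)) =ᶠ[𝓝 y]
      deckMap φ n := by
  set S := (isLocalHomeomorph_proj φ).localInverseAt z with hS
  have hSs : ⇑S.symm = proj φ := (isLocalHomeomorph_proj φ).localInverseAt_symm z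
  have h1 : proj φ (S (proj φ y)) = proj φ y :=
    (isLocalHomeomorph_proj φ).apply_localInverseAt_of_mem hy
  obtain ⟨n, hn⟩ := (proj_eq_iff φ).1 h1
  refine ⟨n, ?_⟩
  have hc : ContinuousAt (deckMap φ n) y := (contMDiff_deckMap φ n).continuous.continuousAt
  have hmem : ∀ᶠ w in 𝓝 y, deckMap φ n w ∈ S.target :=
    hc.eventually (by rw [hn]; exact S.open_target.mem_nhds (S.map_source hy))
  filter_upwards [hmem] with w hw
  have h2 : proj φ w = proj φ (deckMap φ n w) := ((proj_eq_iff φ).2 ⟨n, rfl⟩).symm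
  change S (proj φ w) = _
  rw [h2, ← hSs]
  exact S.right_inv hw

lemma contMDiffAt_localInverseAt_proj (φ : L ≃ₘ⟮I, I⟯ L) (z y : L × ℝ)
    (hy : proj φ y ∈ ((isLocalHomeomorph_proj φ).localInverseAt z).source) :
    ContMDiffAt (I.prod 𝓘(ℝ, ℝ)) (I.prod 𝓘(ℝ, ℝ)) ∞
      (fun w ↦ (isLocalHomeomorph_proj φ).localInverseAt z (proj φ w)) y := by
  obtain ⟨n, hn⟩ := localInverseAt_proj_eventuallyEq φ z y hy
  exact (contMDiff_deckMap φ n).contMDiffAt.congr_of_eventuallyEq hn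

lemma contMDiffOn_transition (φ : L ≃ₘ⟮I, I⟯ L) [IsManifold I ∞ L] (z z' a a' : L × ℝ) :
    ContMDiffOn (I.prod 𝓘(ℝ, ℝ)) (I.prod 𝓘(ℝ, ℝ)) ∞
      ((((isLocalHomeomorph_proj φ).localInverseAt z).trans
          (chartAt (ModelProd H ℝ) a)).symm.trans
        (((isLocalHomeomorph_proj φ).localInverseAt z').trans (chartAt (ModelProd H ℝ) a')))
      ((((isLocalHomeomorph_proj φ).localInverseAt z).trans
          (chartAt (ModelProd H ℝ) a)).symm.trans
        (((isLocalHomeomorph_proj φ).localInverseAt z').trans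
          (chartAt (ModelProd H ℝ) a'))).source := by
  intro u hu
  refine ContMDiffAt.contMDiffWithinAt ?_
  have hSs : ⇑((isLocalHomeomorph_proj φ).localInverseAt z).symm = proj φ :=
    (isLocalHomeomorph_proj φ).localInverseAt_symm z
  simp only [OpenPartialHomeomorph.trans_source, OpenPartialHomeomorph.symm_source,
    OpenPartialHomeomorph.trans_symm_eq_symm_trans_symm,
    OpenPartialHomeomorph.coe_trans, mem_inter_iff, mem_preimage, hSs, comp_apply] at hu
  obtain ⟨⟨hu1, hu2⟩, hu3, hu4⟩ := hu
  have h1 : ContMDiffAt (I.prod 𝓘(ℝ, ℝ)) (I.prod 𝓘(ℝ, ℝ)) ∞ (chartAt (ModelProd H ℝ) a).symm u :=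
    contMDiffOn_chart_symm.contMDiffAt ((chartAt (ModelProd H ℝ) a).open_target.mem_nhds hu1)
  have h2 := contMDiffAt_localInverseAt_proj φ z' _ hu3
  have h3 : ContMDiffAt (I.prod 𝓘(ℝ, ℝ)) (I.prod 𝓘(ℝ, ℝ)) ∞ (chartAt (ModelProd H ℝ) a')
      ((isLocalHomeomorph_proj φ).localInverseAt z' (proj φ ((chartAt (ModelProd H ℝ) a).symm u))) :=
    contMDiffOn_chart.contMDiffAt ((chartAt (ModelProd H ℝ) a').open_source.mem_nhds hu4)
  have := h3.comp u (h2.comp u h1)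
  refine this.congr_of_eventuallyEq (Eventually.of_forall fun v ↦ ?_)
  simp [OpenPartialHomeomorph.trans_symm_eq_symm_trans_symm, hSs]

instance (φ : L ≃ₘ⟮I, I⟯ L) [IsManifold I ∞ L] :
    IsManifold (I.prod 𝓘(ℝ, ℝ)) ∞ (MappingTorus φ) := by
  refine isManifold_of_contDiffOn _ _ _ ?_
  rintro _ _ ⟨p, rfl⟩ ⟨p', rfl⟩
  rw [← contMDiffOn_iff_contDiffOn]
  refine (I.prod 𝓘(ℝ, ℝ)).contMDiff.comp_contMDiffOn
    ((contMDiffOn_transition φ _ _ _ _).comp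
      ((I.prod 𝓘(ℝ, ℝ)).contMDiffOn_symm.mono inter_subset_right) fun u hu ↦ hu.1)

lemma exists_chartAt_eq (φ : L ≃ₘ⟮I, I⟯ L) (p : MappingTorus φ) :
    ∃ z : L × ℝ, proj φ z = p ∧ chartAt (ModelProd H ℝ) p =
      ((isLocalHomeomorph_proj φ).localInverseAt z).trans (chartAt (ModelProd H ℝ) z) :=
  ⟨_, (proj_surjective φ).hasRightInverse.choose_spec p, rfl⟩

lemma contMDiff_proj (φ : L ≃ₘ⟮I, I⟯ L) [IsManifold I ∞ L] :
    ContMDiff (I.prod 𝓘(ℝ, ℝ)) (I.prod 𝓘(ℝ, ℝ)) ∞ (proj φ) := by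
  intro y
  obtain ⟨z, hz, he⟩ := exists_chartAt_eq φ (proj φ y)
  have hs : proj φ y ∈ (chartAt (ModelProd H ℝ) (proj φ y)).source := mem_chart_source _ _
  rw [contMDiffAt_iff_target]
  refine ⟨(isLocalHomeomorph_proj φ).continuous.continuousAt, ?_⟩
  rw [he] at hs
  have h2 := contMDiffAt_localInverseAt_proj φ z y hs.1
  have h3 : ContMDiffAt (I.prod 𝓘(ℝ, ℝ)) 𝓘(ℝ, E × ℝ) ∞ (extChartAt (I.prod 𝓘(ℝ, ℝ)) z)
      ((isLocalHomeomorph_proj φ).localInverseAt z (proj φ y)) := contMDiffAt_extChartAt' hs.2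
  refine (h3.comp y h2).congr_of_eventuallyEq (Eventually.of_forall fun v ↦ ?_)
  simp only [comp_apply, extChartAt_coe, he]
  rfl

lemma contMDiffOn_localInverseAt (φ : L ≃ₘ⟮I, I⟯ L) [IsManifold I ∞ L] (z : L × ℝ) :
    ContMDiffOn (I.prod 𝓘(ℝ, ℝ)) (I.prod 𝓘(ℝ, ℝ)) ∞
      ((isLocalHomeomorph_proj φ).localInverseAt z)
      ((isLocalHomeomorph_proj φ).localInverseAt z).source := by
  intro p hp
  refine ContMDiffAt.contMDiffWithinAt ?_
  obtain ⟨z', hz', he⟩ := exists_chartAt_eq φ p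
  have hs : p ∈ (chartAt (ModelProd H ℝ) p).source := mem_chart_source _ _
  have h1 : ContMDiffAt (I.prod 𝓘(ℝ, ℝ)) (I.prod 𝓘(ℝ, ℝ)) ∞ (chartAt (ModelProd H ℝ) p) p :=
    contMDiffOn_chart.contMDiffAt ((chartAt (ModelProd H ℝ) p).open_source.mem_nhds hs)
  have hev : ∀ᶠ x in 𝓝 p, x ∈ (chartAt (ModelProd H ℝ) p).source :=
    (chartAt (ModelProd H ℝ) p).open_source.mem_nhds hs
  rw [he] at hs hev
  have hinv : ∀ x, x ∈ (((isLocalHomeomorph_proj φ).localInverseAt z').trans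
      (chartAt (ModelProd H ℝ) z')).source →
      (chartAt (ModelProd H ℝ) z').symm (chartAt (ModelProd H ℝ) p x) =
        (isLocalHomeomorph_proj φ).localInverseAt z' x := by
    intro x hx
    rw [he]
    exact (chartAt (ModelProd H ℝ) z').left_inv hx.2
  have h2 : ContMDiffAt (I.prod 𝓘(ℝ, ℝ)) (I.prod 𝓘(ℝ, ℝ)) ∞
      (chartAt (ModelProd H ℝ) z').symm (chartAt (ModelProd H ℝ) p p) := by
    refine contMDiffOn_chart_symm.contMDiffAt
      ((chartAt (ModelProd H ℝ) z').open_target.mem_nhds ?_)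
    rw [he]
    exact (chartAt (ModelProd H ℝ) z').map_source hs.2
  have hpz : proj φ ((isLocalHomeomorph_proj φ).localInverseAt z' p) = p :=
    (isLocalHomeomorph_proj φ).apply_localInverseAt_of_mem hs.1
  have h3 := contMDiffAt_localInverseAt_proj φ z
    ((chartAt (ModelProd H ℝ) z').symm (chartAt (ModelProd H ℝ) p p))
    (by rw [hinv p hs, hpz]; exact hp)
  refine (h3.comp p (h2.comp p h1)).congr_of_eventuallyEq ?_
  filter_upwards [hev] with x hx
  simp only [comp_apply]
  rw [hinv x hx, (isLocalHomeomorph_proj φ).apply_localInverseAt_of_mem hx.1]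

lemma isLocalDiffeomorph_proj (φ : L ≃ₘ⟮I, I⟯ L) [IsManifold I ∞ L] :
    IsLocalDiffeomorph (I.prod 𝓘(ℝ, ℝ)) (I.prod 𝓘(ℝ, ℝ)) ∞ (proj φ) := by
  intro z
  have hSs : ⇑((isLocalHomeomorph_proj φ).localInverseAt z).symm = proj φ :=
    (isLocalHomeomorph_proj φ).localInverseAt_symm z
  refine ⟨{ toPartialEquiv := ((isLocalHomeomorph_proj φ).localInverseAt z).symm.toPartialEquiv
            open_source := ((isLocalHomeomorph_proj φ).localInverseAt z).open_target
            open_target := ((isLocalHomeomorph_proj φ).localInverseAt z).open_source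
            contMDiffOn_toFun := ?_
            contMDiffOn_invFun := contMDiffOn_localInverseAt φ z }, ?_, ?_⟩
  · change ContMDiffOn _ _ _ (((isLocalHomeomorph_proj φ).localInverseAt z).symm) _
    rw [hSs]
    exact (contMDiff_proj φ).contMDiffOn
  · exact (isLocalHomeomorph_proj φ).self_mem_localInverseAt_target
  · intro w _
    change _ = ((isLocalHomeomorph_proj φ).localInverseAt z).symm w
    rw [hSs]

/-- Every point of the mapping torus has a unique representative `(x, t)` with `0 ≤ t < 1`. -/
lemma existsUnique_rep (φ : L ≃ₘ⟮I, I⟯ L) (p : MappingTorus φ) :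
    ∃! z : L × ℝ, proj φ z = p ∧ z.2 ∈ Ico (0 : ℝ) 1 := by
  obtain ⟨z, rfl⟩ := proj_surjective φ p
  refine ⟨deckMap φ (-⌊z.2⌋) z, ⟨(proj_eq_iff φ).2 ⟨_, rfl⟩, ?_⟩, ?_⟩
  · change z.2 + ((-⌊z.2⌋ : ℤ) : ℝ) ∈ Ico (0 : ℝ) 1
    rw [Int.cast_neg, ← sub_eq_add_neg]
    exact ⟨Int.fract_nonneg z.2, Int.fract_lt_one z.2⟩
  · rintro w ⟨hw, hw2⟩
    obtain ⟨n, rfl⟩ := (proj_eq_iff φ).1 hw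
    have h : z.2 + (n : ℝ) ∈ Ico (0 : ℝ) 1 := hw2
    have : n = -⌊z.2⌋ := by
      have h3 : ⌊z.2⌋ = -n := by
        rw [Int.floor_eq_iff]
        push_cast
        exact ⟨by linarith [h.1], by linarith [h.2]⟩
      omega
    rw [this]

/-- The representative `(x, t)` with `0 ≤ t < 1` of a point of the mapping torus. -/
def rep (φ : L ≃ₘ⟮I, I⟯ L) (p : MappingTorus φ) : L × ℝ := (existsUnique_rep φ p).choose

lemma proj_rep (φ : L ≃ₘ⟮I, I⟯ L) (p : MappingTorus φ) : proj φ (rep φ p) = p :=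
  (existsUnique_rep φ p).choose_spec.1.1

instance (φ : L ≃ₘ⟮I, I⟯ L) : CompactSpace (MappingTorus φ) := by
  have h : proj φ '' (univ ×ˢ Icc (0 : ℝ) 1) = univ := by
    refine eq_univ_of_forall fun p ↦ ?_
    obtain ⟨z, ⟨hz, hz2⟩, -⟩ := existsUnique_rep φ p
    exact ⟨z, ⟨mem_univ _, Ico_subset_Icc_self hz2⟩, hz⟩
  exact ⟨h ▸ (isCompact_univ.prod isCompact_Icc).image
    (isLocalHomeomorph_proj φ).continuous⟩

variable [IsManifold I ∞ L]

/-- The one-form on the mapping torus induced by a one-form `θ` on `L × ℝ` through the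
fundamental domain `L × [0, 1)`. -/
def descend (φ : L ≃ₘ⟮I, I⟯ L)
    (θ : ∀ z : L × ℝ, TangentSpace (I.prod 𝓘(ℝ, ℝ)) z →L[ℝ] ℝ) (p : MappingTorus φ) :
    TangentSpace (I.prod 𝓘(ℝ, ℝ)) p →L[ℝ] ℝ :=
  (θ (rep φ p)).comp
    (mfderiv (I.prod 𝓘(ℝ, ℝ)) (I.prod 𝓘(ℝ, ℝ)) (proj φ) (rep φ p)).inverse

/-- If `θ` is invariant under the deck transformations, then `descend φ θ` is the one-form whose
pullback to `L × ℝ` is `θ`. -/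
lemma pullback_descend (φ : L ≃ₘ⟮I, I⟯ L)
    (θ : ∀ z : L × ℝ, TangentSpace (I.prod 𝓘(ℝ, ℝ)) z →L[ℝ] ℝ)
    (hθ : ∀ (n : ℤ) (z : L × ℝ), covectorPullback (I.prod 𝓘(ℝ, ℝ)) (I.prod 𝓘(ℝ, ℝ))
      (deckMap φ n) θ z = θ z) (z : L × ℝ) :
    covectorPullback (I.prod 𝓘(ℝ, ℝ)) (I.prod 𝓘(ℝ, ℝ)) (proj φ) (descend φ θ) z = θ z := by
  obtain ⟨n, hn⟩ := (proj_eq_iff φ).1 (proj_rep φ (proj φ z))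
  have hd : ∀ y, MDifferentiableAt (I.prod 𝓘(ℝ, ℝ)) (I.prod 𝓘(ℝ, ℝ)) (proj φ) y := fun y ↦
    (contMDiff_proj φ y).mdifferentiableAt (by simp)
  have hcomp : proj φ ∘ deckMap φ n = proj φ :=
    funext fun w ↦ (proj_eq_iff φ).2 ⟨n, rfl⟩
  have h1 := mfderiv_comp z (hd (deckMap φ n z))
    ((contMDiff_deckMap φ n z).mdifferentiableAt (by simp))
  rw [hcomp] at h1
  have hinv : (mfderiv (I.prod 𝓘(ℝ, ℝ)) (I.prod 𝓘(ℝ, ℝ)) (proj φ)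
      (deckMap φ n z)).IsInvertible :=
    ⟨(isLocalDiffeomorph_proj φ (deckMap φ n z)).mfderivToContinuousLinearEquiv (by simp),
      IsLocalDiffeomorphAt.mfderivToContinuousLinearEquiv_coe _ _⟩
  rw [← hθ n z]
  ext v
  simp only [covectorPullback, descend, ContinuousLinearMap.comp_apply]
  rw [h1, ← hn]
  refine congrArg (θ (deckMap φ n z)) ?_
  exact hinv.inverse_apply_eq.2 rfl

/-- The one-form `ω₁ = e^{-λt} α` on the mapping torus. -/
def modelForm₁ (φ : L ≃ₘ⟮I, I⟯ L) (α : OneForm I L) (lam : ℝ) :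
    ∀ p : MappingTorus φ, TangentSpace (I.prod 𝓘(ℝ, ℝ)) p →L[ℝ] ℝ :=
  descend φ fun z ↦
    Real.exp (-lam * z.2) • covectorPullback (I.prod 𝓘(ℝ, ℝ)) I Prod.fst α z

/-- The one-form `ω₂ = -λ dt` on the mapping torus. -/
def modelForm₂ (φ : L ≃ₘ⟮I, I⟯ L) (lam : ℝ) :
    ∀ p : MappingTorus φ, TangentSpace (I.prod 𝓘(ℝ, ℝ)) p →L[ℝ] ℝ :=
  descend φ fun z ↦ (-lam) • mvfderiv (I.prod 𝓘(ℝ, ℝ)) Prod.snd z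

lemma covectorPullback_zpow (φ : L ≃ₘ⟮I, I⟯ L) (α : OneForm I L) (lam : ℝ)
    (hφ : ∀ x, covectorPullback I I φ α x = Real.exp lam • α x) (n : ℤ) (x : L) :
    covectorPullback I I (φ.toEquiv ^ n : Equiv.Perm L) α x = Real.exp (n * lam) • α x := by
  have hsmul : ∀ (f : L → L) (c : ℝ) (θ θ' : ∀ x : L, TangentSpace I x →L[ℝ] ℝ),
      (∀ x, θ x = c • θ' x) → ∀ x, covectorPullback I I f θ x = c • covectorPullback I I f θ' x := by
    intro f c θ θ' h x
    simp only [covectorPullback, h]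
    rfl
  have hid : ∀ x, covectorPullback I I (id : L → L) α x = α x := fun x ↦ by
    simp only [covectorPullback, mfderiv_id]
    rfl
  have hsymm : ∀ x, covectorPullback I I φ.symm α x = Real.exp (-lam) • α x := by
    intro x
    have h1 := covectorPullback_comp (I := I) φ.contMDiff φ.symm.contMDiff α x
    have h2 : (φ : L → L) ∘ φ.symm = id := funext φ.apply_symm_apply
    rw [h2, hid, hsmul _ _ _ _ hφ] at h1
    rw [← h1, smul_smul, ← Real.exp_add, neg_add_cancel, Real.exp_zero, one_smul]
  induction n generalizing x with
  | zero =>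
    simp only [zpow_zero, Equiv.Perm.coe_one, Int.cast_zero, zero_mul, Real.exp_zero, one_smul]
    exact hid x
  | succ n ih =>
    rw [zpow_add, zpow_one, Equiv.Perm.coe_mul]
    change covectorPullback I I (_ ∘ φ) α x = _
    rw [← covectorPullback_comp (contMDiff_zpow φ n) φ.contMDiff, hsmul _ _ _ _ ih, hφ,
      smul_smul, ← Real.exp_add]
    push_cast
    ring_nf
  | pred n ih =>
    rw [sub_eq_add_neg, zpow_add, zpow_neg_one, Equiv.Perm.coe_mul]
    change covectorPullback I I (_ ∘ φ.symm) α x = _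
    rw [← covectorPullback_comp (contMDiff_zpow φ (-n)) φ.symm.contMDiff, hsmul _ _ _ _ ih, hsymm,
      smul_smul, ← Real.exp_add]
    push_cast
    ring_nf

/-- `ω₁` is the one-form whose pullback to `L × ℝ` is `e^{-λt} α`. -/
lemma pullback_modelForm₁ (φ : L ≃ₘ⟮I, I⟯ L) (α : OneForm I L) (lam : ℝ)
    (hφ : ∀ x, covectorPullback I I φ α x = Real.exp lam • α x) (z : L × ℝ) :
    covectorPullback (I.prod 𝓘(ℝ, ℝ)) (I.prod 𝓘(ℝ, ℝ)) (proj φ) (modelForm₁ φ α lam) z =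
      Real.exp (-lam * z.2) • covectorPullback (I.prod 𝓘(ℝ, ℝ)) I Prod.fst α z := by
  refine pullback_descend φ (fun z ↦ Real.exp (-lam * z.2) •
    covectorPullback (I.prod 𝓘(ℝ, ℝ)) I Prod.fst α z) (fun n z ↦ ?_) z
  have h1 : covectorPullback (I.prod 𝓘(ℝ, ℝ)) (I.prod 𝓘(ℝ, ℝ)) (deckMap φ n)
      (covectorPullback (I.prod 𝓘(ℝ, ℝ)) I Prod.fst α) z =
      Real.exp (n * lam) • covectorPullback (I.prod 𝓘(ℝ, ℝ)) I Prod.fst α z := by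
    rw [covectorPullback_comp contMDiff_fst (contMDiff_deckMap φ n)]
    change covectorPullback _ _ ((φ.toEquiv ^ n : Equiv.Perm L) ∘ Prod.fst) _ _ = _
    rw [← covectorPullback_comp (contMDiff_zpow φ n) contMDiff_fst]
    ext v
    simp only [covectorPullback, ContinuousLinearMap.comp_apply, smul_apply]
    have := covectorPullback_zpow φ α lam hφ n z.1
    exact congrArg (fun f ↦ f (mfderiv (I.prod 𝓘(ℝ, ℝ)) I Prod.fst z v)) this
  have h2 : covectorPullback (I.prod 𝓘(ℝ, ℝ)) (I.prod 𝓘(ℝ, ℝ)) (deckMap φ n)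
      (fun z ↦ Real.exp (-lam * z.2) •
        covectorPullback (I.prod 𝓘(ℝ, ℝ)) I Prod.fst α z) z =
      Real.exp (-lam * (z.2 + n)) • covectorPullback (I.prod 𝓘(ℝ, ℝ)) (I.prod 𝓘(ℝ, ℝ))
        (deckMap φ n) (covectorPullback (I.prod 𝓘(ℝ, ℝ)) I Prod.fst α) z := rfl
  rw [h2, h1, smul_smul, ← Real.exp_add]
  congr 2
  ring

/-- `ω₂` is the one-form whose pullback to `L × ℝ` is `-λ dt`. -/
lemma pullback_modelForm₂ (φ : L ≃ₘ⟮I, I⟯ L) (lam : ℝ) (z : L × ℝ) :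
    covectorPullback (I.prod 𝓘(ℝ, ℝ)) (I.prod 𝓘(ℝ, ℝ)) (proj φ) (modelForm₂ φ lam) z =
      (-lam) • mvfderiv (I.prod 𝓘(ℝ, ℝ)) Prod.snd z := by
  refine pullback_descend φ (fun z ↦ (-lam) • mvfderiv (I.prod 𝓘(ℝ, ℝ)) Prod.snd z)
    (fun n z ↦ ?_) z
  have hs : ∀ y : L × ℝ, MDifferentiableAt (I.prod 𝓘(ℝ, ℝ)) 𝓘(ℝ, ℝ) Prod.snd y :=
    fun y ↦ mdifferentiableAt_snd
  have h := mvfderiv_comp (I := I.prod 𝓘(ℝ, ℝ)) (I' := I.prod 𝓘(ℝ, ℝ)) z (hs (deckMap φ n z))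
    ((contMDiff_deckMap φ n z).mdifferentiableAt (by simp))
  have h2 : Prod.snd ∘ deckMap φ n = Prod.snd + fun _ ↦ (n : ℝ) := rfl
  rw [h2, mvfderiv_add (hs z) mdifferentiableAt_const, mvfderiv_const, add_zero] at h
  rw [h]
  rfl

/-- The one-form `ρ(t) β` on the mapping torus, for a function `ρ` on `[0, 1]` that vanishes near
the end points. -/
def bumpForm (φ : L ≃ₘ⟮I, I⟯ L) (ρ : ℝ → ℝ) (β : OneForm I L) :
    ∀ p : MappingTorus φ, TangentSpace (I.prod 𝓘(ℝ, ℝ)) p →L[ℝ] ℝ :=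
  descend φ fun z ↦ ρ z.2 • covectorPullback (I.prod 𝓘(ℝ, ℝ)) I Prod.fst β z

/-- The vector field `∂_t` on the mapping torus. -/
def ddt (φ : L ≃ₘ⟮I, I⟯ L) (p : MappingTorus φ) : TangentSpace (I.prod 𝓘(ℝ, ℝ)) p :=
  mfderiv 𝓘(ℝ, ℝ) (I.prod 𝓘(ℝ, ℝ)) (fun τ : ℝ ↦ proj φ ((rep φ p).1, τ)) (rep φ p).2 (1 : ℝ)

end MappingTorus
end MappingTorus
end

open Set Filter Topology Function Bundle
open scoped Manifold ContDiff

set_option linter.unusedSectionVars false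

noncomputable section

section ManifoldCalculus

variable {E : Type*} [NormedAddCommGroup E] [NormedSpace ℝ E]
  {H : Type*} [TopologicalSpace H] {I : ModelWithCorners ℝ E H}
  {M : Type*} [TopologicalSpace M] [ChartedSpace H M] [IsManifold I ∞ M]

/-- The derivative of a function, read in the chart at `x₀`. -/
lemma mvfderiv_eq_fderiv_extChartAt [I.Boundaryless] {h : M → ℝ} {x₀ x : M}
    (hx : x ∈ (extChartAt I x₀).source) (hh : MDifferentiableAt I 𝓘(ℝ, ℝ) h x)
    (v : TangentSpace I x) :
    mvfderiv I h x v = fderiv ℝ (h ∘ (extChartAt I x₀).symm) (extChartAt I x₀ x)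
      (mfderiv I 𝓘(ℝ, E) (extChartAt I x₀) x v) := by
  have hx' : x ∈ (chartAt H x₀).source := by rwa [extChartAt_source] at hx
  have h1 : MDifferentiableAt I 𝓘(ℝ, E) (extChartAt I x₀) x := mdifferentiableAt_extChartAt hx'
  have hinv : (extChartAt I x₀).symm (extChartAt I x₀ x) = x := (extChartAt I x₀).left_inv hx
  have h2 : MDifferentiableAt 𝓘(ℝ, E) I (extChartAt I x₀).symm (extChartAt I x₀ x) := by
    have := mdifferentiableWithinAt_extChartAt_symm (I := I) ((extChartAt I x₀).map_source hx)
    rwa [I.range_eq_univ, mdifferentiableWithinAt_univ] at this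
  have h3 : MDifferentiableAt 𝓘(ℝ, E) 𝓘(ℝ, ℝ) (h ∘ (extChartAt I x₀).symm) (extChartAt I x₀ x) :=
    MDifferentiableAt.comp _ (by rwa [hinv]) h2
  have h4 : h =ᶠ[𝓝 x] (h ∘ (extChartAt I x₀).symm) ∘ extChartAt I x₀ := by
    filter_upwards [extChartAt_source_mem_nhds' hx] with y hy
    exact congrArg h ((extChartAt I x₀).left_inv hy).symm
  rw [mvfderiv, h4.mfderiv_eq, mfderiv_comp x h3 h1, mfderiv_eq_fderiv]
  rfl


lemma isManifold_two : IsManifold I 2 M :=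
  IsManifold.of_le (n := ∞) (WithTop.coe_le_coe.2 (le_top : (2 : ℕ∞) ≤ ⊤))

/-- The derivative of a function in the direction of a Lie bracket. -/
lemma mvfderiv_mlieBracket [I.Boundaryless] [CompleteSpace E] {h : M → ℝ} {x : M}
    (hh : ContMDiffAt I 𝓘(ℝ, ℝ) ∞ h x) (X Y : SmoothVectorField I M) :
    mvfderiv I h x (VectorField.mlieBracket I X Y x) =
      mvfderiv I (fun y ↦ mvfderiv I h y (Y y)) x (X x) -
        mvfderiv I (fun y ↦ mvfderiv I h y (X y)) x (Y x) := by
  have : IsManifold I 2 M := isManifold_two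
  set φ := extChartAt I x with hφ
  set h' : E → ℝ := h ∘ φ.symm with hh'
  let c : SmoothVectorField I M → E → E := fun Z ↦
    VectorField.mpullbackWithin 𝓘(ℝ, E) I φ.symm Z (range I)
  have hx : x ∈ φ.source := mem_extChartAt_source x
  have hdh' : ContDiffAt ℝ 2 h' (φ x) := by
    have h1 : ContMDiffAt 𝓘(ℝ, E) I ∞ φ.symm (φ x) :=
      (contMDiffOn_extChartAt_symm x).contMDiffAt (extChartAt_target_mem_nhds x)
    have h2 : ContMDiffAt 𝓘(ℝ, E) 𝓘(ℝ, ℝ) ∞ h' (φ x) :=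
      ContMDiffAt.comp (φ x) (by rwa [hφ, extChartAt_to_inv]) h1
    exact (contMDiffAt_iff_contDiffAt.1 h2).of_le (WithTop.coe_le_coe.2 le_top)
  have hdc : ∀ Z : SmoothVectorField I M, DifferentiableAt ℝ (c Z) (φ x) := by
    intro Z
    have h1 := (mdifferentiableWithinAt_univ.2 (Z.mdifferentiableAt x)
      ).differentiableWithinAt_mpullbackWithin_vectorField
    rw [I.range_eq_univ, preimage_univ, univ_inter] at h1
    simp only [c, I.range_eq_univ]
    exact differentiableWithinAt_univ.1 h1
  have hcz : ∀ Z : SmoothVectorField I M, ∀ y ∈ φ.target,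
      c Z y = mfderiv I 𝓘(ℝ, E) φ (φ.symm y) (Z (φ.symm y)) := by
    intro Z y hy
    have h1 := mfderivWithin_extChartAt_symm_comp_mfderiv_extChartAt (I := I) (x := x) hy
    have h2 := isInvertible_mfderivWithin_extChartAt_symm (I := I) hy
    have aux : ∀ (A B : E →L[ℝ] E) (_ : A.IsInvertible) (_ : A.comp B = ContinuousLinearMap.id ℝ E)
        (v : E), A.inverse v = B v := fun A B hA hAB v ↦ by
      rw [hA.inverse_apply_eq]
      exact (congrArg (fun T ↦ T v) hAB).symm
    exact aux _ _ h2 h1 _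
  have hev : ∀ᶠ y in 𝓝 (φ x), MDifferentiableAt I 𝓘(ℝ, ℝ) h (φ.symm y) := by
    have h1 : ∀ᶠ z in 𝓝 x, MDifferentiableAt I 𝓘(ℝ, ℝ) h z := by
      have h2 : ContMDiffAt I 𝓘(ℝ, ℝ) 1 h x := hh.of_le (WithTop.coe_le_coe.2 le_top)
      have : IsManifold I 1 M := IsManifold.of_le (n := 2) one_le_two
      exact ((contMDiffAt_iff_contMDiffAt_nhds (by simp)).1 h2).mono fun z hz ↦
        hz.mdifferentiableAt (by simp)
    refine (continuousAt_extChartAt_symm x).eventually ?_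
    rwa [extChartAt_to_inv]
  have hder : ∀ Z : SmoothVectorField I M, (fun y ↦ mvfderiv I h y (Z y)) ∘ φ.symm
      =ᶠ[𝓝 (φ x)] fun y ↦ fderiv ℝ h' y (c Z y) := by
    intro Z
    filter_upwards [extChartAt_target_mem_nhds (I := I) x, hev] with y hy hy2
    rw [hcz Z y hy]
    change mvfderiv I h (φ.symm y) (Z (φ.symm y)) = _
    rw [mvfderiv_eq_fderiv_extChartAt (φ.map_target hy) hy2]
    rw [φ.right_inv hy]
  have hXY : ∀ Z W : SmoothVectorField I M,
      mvfderiv I (fun y ↦ mvfderiv I h y (Z y)) x (W x) =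
        fderiv ℝ (fderiv ℝ h') (φ x) (c W (φ x)) (c Z (φ x)) +
          fderiv ℝ h' (φ x) (fderiv ℝ (c Z) (φ x) (c W (φ x))) := by
    intro Z W
    have hG : HasFDerivAt (fun y ↦ fderiv ℝ h' y (c Z y))
        ((fderiv ℝ h' (φ x)).comp (fderiv ℝ (c Z) (φ x)) +
          (fderiv ℝ (fderiv ℝ h') (φ x)).flip (c Z (φ x))) (φ x) := by
      have h1 : DifferentiableAt ℝ (fderiv ℝ h') (φ x) :=
        (hdh'.fderiv_right (m := 1) (by norm_num)).differentiableAt (by simp)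
      exact h1.hasFDerivAt.clm_apply (hdc Z).hasFDerivAt
    have hmd : MDifferentiableAt I 𝓘(ℝ, ℝ) (fun y ↦ mvfderiv I h y (Z y)) x := by
      have h1 : (fun y ↦ mvfderiv I h y (Z y)) =ᶠ[𝓝 x]
          (fun y ↦ fderiv ℝ h' y (c Z y)) ∘ φ := by
        have h2 := (continuousAt_extChartAt (I := I) x).eventually (hder Z)
        filter_upwards [h2, extChartAt_source_mem_nhds (I := I) x] with y hy hy2
        simp only [comp_apply] at hy ⊢
        rw [← hy]
        exact congrArg (fun z ↦ mvfderiv I h z (Z z)) (φ.left_inv hy2).symm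
      refine MDifferentiableAt.congr_of_eventuallyEq ?_ h1
      exact MDifferentiableAt.comp x hG.differentiableAt.mdifferentiableAt
        (mdifferentiableAt_extChartAt (mem_chart_source H x))
    have h2 : mfderiv I 𝓘(ℝ, E) φ x (W x) = c W (φ x) := by
      rw [hcz W _ (φ.map_source hx)]
      exact congrArg (fun z ↦ (mfderiv I 𝓘(ℝ, E) φ z (W z) : E)) (φ.left_inv hx).symm
    rw [mvfderiv_eq_fderiv_extChartAt hx hmd, (hder Z).fderiv_eq, hG.fderiv]
    erw [h2]
    simp only [add_apply, ContinuousLinearMap.comp_apply, ContinuousLinearMap.flip_apply]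
    ring
  have hbr : mvfderiv I h x (VectorField.mlieBracket I X Y x) =
      fderiv ℝ h' (φ x) (VectorField.lieBracket ℝ (c X) (c Y) (φ x)) := by
    rw [mvfderiv_eq_fderiv_extChartAt hx (by
      have := hev.self_of_nhds
      rwa [hφ, extChartAt_to_inv] at this)]
    refine congrArg (fderiv ℝ h' (φ x)) ?_
    have h1 := isInvertible_mfderiv_extChartAt (I := I) hx
    rw [← VectorField.mlieBracketWithin_univ, VectorField.mlieBracketWithin_apply, preimage_univ,
      I.range_eq_univ, univ_inter]
    have aux : ∀ (A : E →L[ℝ] E) (_ : A.IsInvertible) (v : E), A (A.inverse v) = v :=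
      fun A hA v ↦ by
        obtain ⟨e, rfl⟩ := hA
        simp
    refine (aux _ h1 _).trans ?_
    rw [← VectorField.lieBracketWithin_univ]
    simp only [c, I.range_eq_univ]
    rfl
  have hsymm : fderiv ℝ (fderiv ℝ h') (φ x) (c X (φ x)) (c Y (φ x)) =
      fderiv ℝ (fderiv ℝ h') (φ x) (c Y (φ x)) (c X (φ x)) :=
    (hdh'.isSymmSndFDerivAt (by simp)) _ _
  rw [hbr, hXY, hXY, VectorField.lieBracket, map_sub, hsymm]
  ring
end ManifoldCalculus

section LocalForms

variable {E : Type*} [NormedAddCommGroup E] [NormedSpace ℝ E]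
  {H : Type*} [TopologicalSpace H] {I : ModelWithCorners ℝ E H}
  {M : Type*} [TopologicalSpace M] [ChartedSpace H M] [IsManifold I ∞ M]

/-- There is a function that cuts off vector fields defined near a point to global ones. -/
lemma exists_cutoff [FiniteDimensional ℝ E] [T2Space M] {x₀ : M} {U : Set M} (hU : U ∈ 𝓝 x₀) :
    ∃ χ : M → ℝ, χ =ᶠ[𝓝 x₀] 1 ∧ (∀ x ∉ U, χ x = 0) ∧ ∀ V : ∀ x : M, TangentSpace I x,
      ContMDiffOn I I.tangent ∞ (fun x ↦ (⟨x, V x⟩ : TangentBundle I M)) U →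
        ∃ X : SmoothVectorField I M, ∀ x, X x = χ x • V x := by
  obtain ⟨χ, -, hχ⟩ := (SmoothBumpFunction.nhds_basis_tsupport (I := I) x₀).mem_iff.1
    (interior_mem_nhds.2 hU)
  refine ⟨χ, χ.eventuallyEq_one, fun x hx ↦ ?_,
    fun V hV ↦ ⟨⟨fun x ↦ χ x • V x, ?_⟩, fun x ↦ rfl⟩⟩
  · exact image_eq_zero_of_notMem_tsupport fun h ↦ hx (interior_subset (hχ h))
  · exact ContMDiffOn.smul_section_of_tsupport χ.contMDiff.contMDiffOn isOpen_interior hχ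
      (hV.mono interior_subset)

/-- The vector field with constant coordinates `w` in the chart at `x₀`. -/
def coordField (I : ModelWithCorners ℝ E H) (x₀ : M) [IsManifold I ∞ M] (w : E) (x : M) : TangentSpace I x :=
  haveI : IsManifold I 1 M := IsManifold.of_le (n := ∞) (WithTop.coe_le_coe.2 le_top)
  (trivializationAt E (TangentSpace I : M → Type _) x₀).symmL ℝ x w

lemma contMDiffOn_coordField (x₀ : M) (w : E) :
    ContMDiffOn I I.tangent ∞ (fun x ↦ (⟨x, coordField I x₀ w x⟩ : TangentBundle I M))
      (extChartAt I x₀).source := by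
  have : IsManifold I 1 M := IsManifold.of_le (n := ∞) (WithTop.coe_le_coe.2 le_top)
  have : IsManifold I (∞ + 1) M := by simpa
  set e := trivializationAt E (TangentSpace I : M → Type _) x₀ with he
  have hb : (extChartAt I x₀).source = e.baseSet := by simp [he]
  rw [hb]
  refine (e.contMDiffOn_section_baseSet_iff (n := ∞) (IB := I)).2 ?_
  refine (contMDiffOn_const (c := w)).congr fun y hy ↦ ?_
  change (e ⟨y, e.symmL ℝ y w⟩).2 = w
  have := e.continuousLinearMapAt_symmL (R := ℝ) hy w
  rwa [e.continuousLinearMapAt_apply_of_mem ℝ hy] at this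

lemma mfderiv_extChartAt_coordField {x₀ x : M} (hx : x ∈ (extChartAt I x₀).source) (w : E) :
    mfderiv I 𝓘(ℝ, E) (extChartAt I x₀) x (coordField I x₀ w x) = w := by
  have : IsManifold I 1 M := IsManifold.of_le (n := ∞) (WithTop.coe_le_coe.2 le_top)
  rw [extChartAt_source] at hx
  rw [← TangentBundle.continuousLinearMapAt_trivializationAt hx]
  exact (trivializationAt E (TangentSpace I : M → Type _) x₀).continuousLinearMapAt_symmL
    (R := ℝ) (by simpa using hx) w

lemma coordField_mfderiv_extChartAt {x₀ x : M} (hx : x ∈ (extChartAt I x₀).source)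
    (v : TangentSpace I x) :
    coordField I x₀ (mfderiv I 𝓘(ℝ, E) (extChartAt I x₀) x v) x = v := by
  have : IsManifold I 1 M := IsManifold.of_le (n := ∞) (WithTop.coe_le_coe.2 le_top)
  rw [extChartAt_source] at hx
  rw [← TangentBundle.continuousLinearMapAt_trivializationAt hx]
  exact (trivializationAt E (TangentSpace I : M → Type _) x₀).symmL_continuousLinearMapAt
    (R := ℝ) (by simpa using hx) v

lemma mvfderiv_coordField [I.Boundaryless] {h : M → ℝ} {x₀ x : M}
    (hx : x ∈ (extChartAt I x₀).source) (hh : MDifferentiableAt I 𝓘(ℝ, ℝ) h x) (w : E) :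
    mvfderiv I h x (coordField I x₀ w x) =
      fderiv ℝ (h ∘ (extChartAt I x₀).symm) (extChartAt I x₀ x) w := by
  rw [mvfderiv_eq_fderiv_extChartAt hx hh, mfderiv_extChartAt_coordField hx]

/-- A function that is smooth near `x`. -/
def SmoothNear (I : ModelWithCorners ℝ E H) (h : M → ℝ) (x : M) : Prop :=
  ∀ᶠ y in 𝓝 x, ContMDiffAt I 𝓘(ℝ, ℝ) ∞ h y

lemma ContMDiff.smoothNear {h : M → ℝ} (hh : ContMDiff I 𝓘(ℝ, ℝ) ∞ h) (x : M) :
    SmoothNear I h x := Eventually.of_forall hh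

lemma ContMDiffOn.smoothNear {h : M → ℝ} {U : Set M} {x : M} (hh : ContMDiffOn I 𝓘(ℝ, ℝ) ∞ h U)
    (hU : U ∈ 𝓝 x) : SmoothNear I h x := by
  filter_upwards [eventually_mem_nhds_iff.2 hU] with y hy
  exact hh.contMDiffAt hy

lemma SmoothNear.mdifferentiableAt {h : M → ℝ} {x : M} (hh : SmoothNear I h x) :
    MDifferentiableAt I 𝓘(ℝ, ℝ) h x :=
  (Eventually.self_of_nhds hh).mdifferentiableAt (by simp)

lemma SmoothNear.eventually {h : M → ℝ} {x : M} (hh : SmoothNear I h x) :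
    ∀ᶠ y in 𝓝 x, SmoothNear I h y :=
  eventually_eventually_nhds.2 hh

lemma SmoothNear.contDiffAt [I.Boundaryless] {h : M → ℝ} {x₀ x : M} (hh : SmoothNear I h x)
    (hx : x ∈ (extChartAt I x₀).source) :
    ContDiffAt ℝ ∞ (h ∘ (extChartAt I x₀).symm) (extChartAt I x₀ x) := by
  have h1 : ContMDiffAt 𝓘(ℝ, E) I ∞ (extChartAt I x₀).symm (extChartAt I x₀ x) :=
    (contMDiffOn_extChartAt_symm x₀).contMDiffAt (extChartAt_target_mem_nhds'
      ((extChartAt I x₀).map_source hx))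
  have h2 : ContMDiffAt 𝓘(ℝ, E) 𝓘(ℝ, ℝ) ∞ (h ∘ (extChartAt I x₀).symm) (extChartAt I x₀ x) :=
    ContMDiffAt.comp _ (by
      rw [(extChartAt I x₀).left_inv hx]
      exact Eventually.self_of_nhds hh) h1
  exact contMDiffAt_iff_contDiffAt.1 h2

lemma SmoothNear.contMDiffAt_mvfderiv [I.Boundaryless] {h : M → ℝ} {x : M}
    (hh : SmoothNear I h x) :
    ContMDiffAt I (I.prod 𝓘(ℝ, E →L[ℝ] ℝ)) ∞
      (fun y ↦ (TotalSpace.mk' (E →L[ℝ] ℝ) y (mvfderiv I h y) :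
      TotalSpace (E →L[ℝ] ℝ) (fun x : M ↦ TangentSpace I x →L[ℝ] ℝ))) x := by
  have : IsManifold I 1 M := IsManifold.of_le (n := ∞) (WithTop.coe_le_coe.2 le_top)
  refine (contMDiffAt_hom_bundle (F₂ := ℝ) (E₂ := Bundle.Trivial M ℝ) _).2
    ⟨contMDiffAt_id, ?_⟩
  have h1 : ContDiffAt ℝ ∞ (fderiv ℝ (h ∘ (extChartAt I x).symm)) (extChartAt I x x) :=
    (hh.contDiffAt (mem_extChartAt_source x)).fderiv_right (by simp)
  have h2 := h1.contMDiffAt.comp x (contMDiffAt_extChartAt (I := I) (n := ∞) (x := x))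
  refine h2.congr_of_eventuallyEq ?_
  filter_upwards [hh.eventually, extChartAt_source_mem_nhds (I := I) x] with y hy hyx
  ext w
  change (Bundle.Trivial.trivialization M ℝ).continuousLinearMapAt ℝ y
    (mvfderiv I h y (coordField I x w y)) = _
  rw [Bundle.Trivial.continuousLinearMapAt_trivialization]
  exact mvfderiv_coordField hyx hy.mdifferentiableAt w

lemma SmoothNear.apply [I.Boundaryless] {h : M → ℝ} {x : M} (hh : SmoothNear I h x)
    (X : SmoothVectorField I M) :
    SmoothNear I (fun y ↦ mvfderiv I h y (X y)) x := by
  filter_upwards [hh.eventually] with y hy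
  exact (contMDiffAt_section (E := Bundle.Trivial M ℝ) y).1
    (hy.contMDiffAt_mvfderiv.clm_bundle_apply (X.contMDiff y))

lemma SmoothNear.add {f g : M → ℝ} {x : M} (hf : SmoothNear I f x) (hg : SmoothNear I g x) :
    SmoothNear I (fun y ↦ f y + g y) x := by
  filter_upwards [hf, hg] with y h1 h2 using h1.add h2

lemma SmoothNear.sub {f g : M → ℝ} {x : M} (hf : SmoothNear I f x) (hg : SmoothNear I g x) :
    SmoothNear I (fun y ↦ f y - g y) x := by
  filter_upwards [hf, hg] with y h1 h2 using h1.sub h2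

lemma SmoothNear.mul {f g : M → ℝ} {x : M} (hf : SmoothNear I f x) (hg : SmoothNear I g x) :
    SmoothNear I (fun y ↦ f y * g y) x := by
  filter_upwards [hf, hg] with y h1 h2 using h1.mul h2

lemma SmoothNear.comp {f : M → ℝ} {x : M} {r : ℝ → ℝ} (hr : ContDiff ℝ ∞ r)
    (hf : SmoothNear I f x) : SmoothNear I (fun y ↦ r (f y)) x := by
  filter_upwards [hf] with y h1 using hr.contMDiff.contMDiffAt.comp y h1

lemma SmoothNear.congr {f g : M → ℝ} {x : M} (hf : SmoothNear I f x) (h : g =ᶠ[𝓝 x] f) :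
    SmoothNear I g x := by
  filter_upwards [hf, h.eventuallyEq_nhds] with y h1 h2 using h1.congr_of_eventuallyEq h2

lemma smoothNear_const (c : ℝ) (x : M) : SmoothNear I (fun _ ↦ c) x :=
  Eventually.of_forall fun _ ↦ contMDiffAt_const

lemma mvfderiv_congr {f g : M → ℝ} {x : M} (h : f =ᶠ[𝓝 x] g) : mvfderiv I f x = mvfderiv I g x := by
  rw [mvfderiv, mvfderiv, h.mfderiv_eq]
  rfl

/-- Any tangent vector extends to a smooth vector field. -/
lemma exists_smoothVectorField_apply_eq [FiniteDimensional ℝ E] [T2Space M] {x : M}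
    (v : TangentSpace I x) : ∃ X : SmoothVectorField I M, X x = v := by
  obtain ⟨χ, h1, -, h2⟩ := exists_cutoff (I := I) (extChartAt_source_mem_nhds (I := I) x)
  obtain ⟨X, h2⟩ := h2 _
    (contMDiffOn_coordField (I := I) x (mfderiv I 𝓘(ℝ, E) (extChartAt I x) x v))
  refine ⟨X, ?_⟩
  rw [h2, h1.self_of_nhds, coordField_mfderiv_extChartAt (mem_extChartAt_source x)]
  simp

/-- A one-form that is locally exact is smooth and closed. -/
lemma exists_closedOneForm_of_locally_exact [I.Boundaryless] [CompleteSpace E]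
    (β : ∀ x : M, TangentSpace I x →L[ℝ] ℝ)
    (hβ : ∀ x, ∃ g : M → ℝ, SmoothNear I g x ∧ ∀ᶠ y in 𝓝 x, β y = mvfderiv I g y) :
    ∃ β' : closedOneForms I M, ∀ x, β'.1 x = β x := by
  refine ⟨⟨⟨β, fun x ↦ ?_⟩, fun X Y x ↦ ?_⟩, fun x ↦ rfl⟩
  · obtain ⟨g, hg, h⟩ := hβ x
    refine hg.contMDiffAt_mvfderiv.congr_of_eventuallyEq ?_
    filter_upwards [h] with y hy
    rw [hy]
  · obtain ⟨g, hg, h⟩ := hβ x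
    change mvfderiv I (fun y ↦ β y (Y y)) x (X x) - mvfderiv I (fun y ↦ β y (X y)) x (Y x)
      - β x (VectorField.mlieBracket I X Y x) = 0
    have h1 : ∀ Z : SmoothVectorField I M, mvfderiv I (fun y ↦ β y (Z y)) x =
        mvfderiv I (fun y ↦ mvfderiv I g y (Z y)) x := fun Z ↦
      mvfderiv_congr (by filter_upwards [h] with y hy; rw [hy])
    rw [h1, h1, h.self_of_nhds, mvfderiv_mlieBracket (Eventually.self_of_nhds hg)]
    ring

/-- If `du = k df` and `df ≠ 0` then `k` is smooth. -/
lemma SmoothNear.of_mvfderiv_eq_smul [I.Boundaryless] [FiniteDimensional ℝ E] [T2Space M]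
    {u f k : M → ℝ} {x : M} (hu : SmoothNear I u x) (hf : SmoothNear I f x)
    (hne : mvfderiv I f x ≠ 0) (h : ∀ᶠ y in 𝓝 x, mvfderiv I u y = k y • mvfderiv I f y) :
    SmoothNear I k x := by
  obtain ⟨v, hv⟩ : ∃ v, mvfderiv I f x v ≠ 0 := by
    by_contra! hc
    exact hne (ContinuousLinearMap.ext hc)
  obtain ⟨X, rfl⟩ := exists_smoothVectorField_apply_eq v
  have h1 := hf.apply X
  have h2 := hu.apply X
  have h3 : ∀ᶠ y in 𝓝 x, mvfderiv I f y (X y) ≠ 0 :=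
    (Eventually.self_of_nhds h1).continuousAt.eventually_ne hv
  filter_upwards [h1, h2, h3.eventually_nhds, h.eventually_nhds] with y h1 h2 h3 h4
  refine (h2.div₀ h1 h3.self_of_nhds).congr_of_eventuallyEq ?_
  filter_upwards [h3, h4] with z h3 h4
  rw [Pi.div_apply, h4]
  exact (mul_div_cancel_right₀ (k z) h3).symm

/-- If `du = k df` then `dk ∧ df = 0`. -/
lemma mvfderiv_mul_comm_of_mvfderiv_eq_smul [I.Boundaryless] [FiniteDimensional ℝ E] [T2Space M]
    {u f k : M → ℝ} {x : M} (hu : SmoothNear I u x) (hf : SmoothNear I f x) (hk : SmoothNear I k x)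
    (h : ∀ᶠ y in 𝓝 x, mvfderiv I u y = k y • mvfderiv I f y) (v w : TangentSpace I x) :
    mvfderiv I k x v * mvfderiv I f x w = mvfderiv I k x w * mvfderiv I f x v := by
  have : CompleteSpace E := FiniteDimensional.complete ℝ E
  obtain ⟨X, rfl⟩ := exists_smoothVectorField_apply_eq v
  obtain ⟨Y, rfl⟩ := exists_smoothVectorField_apply_eq w
  have h1 := mvfderiv_mlieBracket (Eventually.self_of_nhds hu) X Y
  have h2 := mvfderiv_mlieBracket (Eventually.self_of_nhds hf) X Y
  have h3 : ∀ Z : SmoothVectorField I M, mvfderiv I (fun y ↦ mvfderiv I u y (Z y)) x =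
      k x • mvfderiv I (fun y ↦ mvfderiv I f y (Z y)) x + mvfderiv I f x (Z x) • mvfderiv I k x := by
    intro Z
    rw [← mvfderiv_mul hk.mdifferentiableAt (hf.apply Z).mdifferentiableAt]
    refine mvfderiv_congr ?_
    filter_upwards [h] with y hy
    rw [hy]
    rfl
  rw [h3, h3, h.self_of_nhds] at h1
  simp only [add_apply, smul_apply, smul_eq_mul] at h1
  rw [h2] at h1
  linarith

end LocalForms

section LocalPrimitive

variable {E : Type*} [NormedAddCommGroup E] [NormedSpace ℝ E]
  {H : Type*} [TopologicalSpace H] {I : ModelWithCorners ℝ E H}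
  {M : Type*} [TopologicalSpace M] [ChartedSpace H M] [IsManifold I ∞ M]

/-- Near a point there are global vector fields with constant coordinates; they commute. -/
lemma exists_commuting_fields [I.Boundaryless] [FiniteDimensional ℝ E] [T2Space M] (x₀ : M) :
    ∃ X : E → SmoothVectorField I M, ∀ᶠ x in 𝓝 x₀, (∀ w, X w x = coordField I x₀ w x) ∧
      ∀ v w, VectorField.mlieBracket I (X v) (X w) x = 0 := by
  have : CompleteSpace E := FiniteDimensional.complete ℝ E
  obtain ⟨χ, hχ, -, h⟩ := exists_cutoff (I := I) (extChartAt_source_mem_nhds (I := I) x₀)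
  choose X hX using fun w ↦ h _ (contMDiffOn_coordField (I := I) x₀ w)
  have hev : ∀ᶠ x in 𝓝 x₀, x ∈ (extChartAt I x₀).source ∧ ∀ w, X w x = coordField I x₀ w x := by
    filter_upwards [hχ, extChartAt_source_mem_nhds (I := I) x₀] with x h1 h2
    exact ⟨h2, fun w ↦ by rw [hX, h1]; exact one_smul ℝ _⟩
  refine ⟨X, ?_⟩
  filter_upwards [hev, hev.eventually_nhds] with x hx hx2
  refine ⟨hx.2, fun v w ↦ ?_⟩
  rw [← coordField_mfderiv_extChartAt hx.1 (VectorField.mlieBracket I (X v) (X w) x)]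
  have key : mfderiv I 𝓘(ℝ, E) (extChartAt I x₀) x (VectorField.mlieBracket I (X v) (X w) x)
      = (0 : E) := by
    refine SeparatingDual.eq_zero_of_forall_dual_eq_zero (R := ℝ) (V := E) fun ℓ ↦ ?_
    have hs : ∀ y ∈ (extChartAt I x₀).source, SmoothNear I (fun z ↦ ℓ (extChartAt I x₀ z)) y := by
      intro y hy
      refine ContMDiffOn.smoothNear (U := (extChartAt I x₀).source) ?_
        (extChartAt_source_mem_nhds' hy)
      rw [extChartAt_source]
      exact ℓ.contDiff.contMDiff.comp_contMDiffOn contMDiffOn_extChartAt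
    have hd : ∀ y ∈ (extChartAt I x₀).source, ∀ u : TangentSpace I y,
        mvfderiv I (fun z ↦ ℓ (extChartAt I x₀ z)) y u =
          ℓ (mfderiv I 𝓘(ℝ, E) (extChartAt I x₀) y u) := by
      intro y hy u
      rw [mvfderiv_eq_fderiv_extChartAt hy (hs y hy).mdifferentiableAt]
      have h1 : (fun z ↦ ℓ (extChartAt I x₀ z)) ∘ (extChartAt I x₀).symm
          =ᶠ[𝓝 (extChartAt I x₀ y)] ℓ := by
        filter_upwards [extChartAt_target_mem_nhds' (I := I) ((extChartAt I x₀).map_source hy)]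
          with z hz
        simp only [comp_apply, (extChartAt I x₀).right_inv hz]
      rw [h1.fderiv_eq, ContinuousLinearMap.fderiv]
    have hc : ∀ u, mvfderiv I (fun y ↦ mvfderiv I (fun z ↦ ℓ (extChartAt I x₀ z)) y (X u y)) x
        = 0 := by
      intro u
      rw [mvfderiv_congr (g := fun _ ↦ ℓ u), mvfderiv_const]
      filter_upwards [hx2] with y hy
      rw [hy.2, hd y hy.1, mfderiv_extChartAt_coordField hy.1]
    have := mvfderiv_mlieBracket (Eventually.self_of_nhds (hs x hx.1)) (X v) (X w)
    rw [hc, hc, hd x hx.1] at this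
    simpa using this
  rw [key]
  exact map_zero _

/-- A closed one-form has a primitive near every point. Moreover, on a suitable neighborhood the
variation of a function with derivative bounded by `α` is bounded. -/
lemma exists_local_primitive [I.Boundaryless] [FiniteDimensional ℝ E] [T2Space M]
    (α : closedOneForms I M) (x₀ : M) :
    ∃ (U : Set M) (f : M → ℝ) (A : ℝ), IsOpen U ∧ x₀ ∈ U ∧ IsPreconnected U ∧ 0 ≤ A ∧
      ContMDiffOn I 𝓘(ℝ, ℝ) ∞ f U ∧ (∀ x ∈ U, α.1 x = mvfderiv I f x) ∧
      ∀ (k : M → ℝ) (m : ℝ), 0 ≤ m → (∀ x ∈ U, MDifferentiableAt I 𝓘(ℝ, ℝ) k x ∧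
        ∃ μ : ℝ, |μ| ≤ m ∧ mvfderiv I k x = μ • α.1 x) →
        ∀ x ∈ U, ∀ y ∈ U, |k x - k y| ≤ m * A := by
  have : IsManifold I 1 M := IsManifold.of_le (n := ∞) (WithTop.coe_le_coe.2 le_top)
  obtain ⟨X, hX⟩ := exists_commuting_fields (I := I) x₀
  set φ := extChartAt I x₀ with hφ
  let a : E → (E →L[ℝ] ℝ) := fun y ↦ (α.1 (φ.symm y)).comp
    ((trivializationAt E (TangentSpace I : M → Type _) x₀).symmL ℝ (φ.symm y))
  have ha : ∀ x ∈ φ.source, ∀ w, a (φ x) w = α.1 x (coordField I x₀ w x) := fun x hx w ↦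
    congrArg (fun z ↦ α.1 z (coordField I x₀ w z)) (φ.left_inv hx)
  obtain ⟨r₁, hr₁, hball⟩ : ∃ r > 0, ∀ y ∈ Metric.ball (φ x₀) r, y ∈ φ.target ∧
      ∀ᶠ x in 𝓝 (φ.symm y), (∀ w, X w x = coordField I x₀ w x) ∧
        ∀ v w, VectorField.mlieBracket I (X v) (X w) x = 0 := by
    have h1 : ∀ᶠ y in 𝓝 (φ x₀), y ∈ φ.target ∧
      ∀ᶠ x in 𝓝 (φ.symm y), (∀ w, X w x = coordField I x₀ w x) ∧
        ∀ v w, VectorField.mlieBracket I (X v) (X w) x = 0 := by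
      refine Eventually.and (extChartAt_target_mem_nhds (I := I) x₀) ?_
      have ht : Tendsto φ.symm (𝓝 (φ x₀)) (𝓝 x₀) := by
        have := (continuousAt_extChartAt_symm (I := I) x₀).tendsto
        rwa [extChartAt_to_inv] at this
      exact ht.eventually hX.eventually_nhds
    exact Metric.eventually_nhds_iff_ball.1 h1
  have hae : ∀ y ∈ Metric.ball (φ x₀) r₁, ∀ w,
      (fun z ↦ a z w) =ᶠ[𝓝 y] (fun x ↦ α.1 x (X w x)) ∘ φ.symm := by
    intro y hy w
    filter_upwards [Metric.isOpen_ball.mem_nhds hy] with z hz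
    rw [comp_apply, (hball z hz).2.self_of_nhds.1]
    rfl
  have hsX : ∀ w x, SmoothNear I (fun x ↦ α.1 x (X w x)) x := fun w x ↦
    ContMDiff.smoothNear (I := I) (α.1.contMDiff_apply (X w)) x
  have hsmooth : ∀ y ∈ Metric.ball (φ x₀) r₁, ContDiffAt ℝ ∞ a y := by
    suffices h : ContDiffOn ℝ ∞ a (Metric.ball (φ x₀) r₁) from fun y hy ↦
      h.contDiffAt (Metric.isOpen_ball.mem_nhds hy)
    rw [contDiffOn_clm_apply]
    intro w y hy
    refine ContDiffAt.contDiffWithinAt ?_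
    refine ContDiffAt.congr_of_eventuallyEq ?_ (hae y hy w)
    have h1 := (hsX w (φ.symm y)).contDiffAt (φ.map_target (hball y hy).1)
    rwa [φ.right_inv (hball y hy).1] at h1
  have hsym : ∀ y ∈ Metric.ball (φ x₀) r₁, ∀ v w, fderiv ℝ a y v w = fderiv ℝ a y w v := by
    intro y hy
    have hd : DifferentiableAt ℝ a y := (hsmooth y hy).differentiableAt (by simp)
    have h1 : ∀ v w, fderiv ℝ a y v w =
        mvfderiv I (fun x ↦ α.1 x (X w x)) (φ.symm y) (X v (φ.symm y)) := by
      intro v w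
      rw [(hball y hy).2.self_of_nhds.1, mvfderiv_coordField (φ.map_target (hball y hy).1)
        (hsX w _).mdifferentiableAt, φ.right_inv (hball y hy).1, ← (hae y hy w).fderiv_eq,
        fderiv_clm_apply hd (differentiableAt_const w)]
      simp
    intro v w
    have h2 := α.2 (X v) (X w) (φ.symm y)
    rw [OneForm.extDeriv, (hball y hy).2.self_of_nhds.2, map_zero, sub_zero] at h2
    rw [h1, h1]
    linarith
  obtain ⟨r, hr, hrr, hbd⟩ : ∃ r > 0, r ≤ r₁ ∧ ∀ y ∈ Metric.ball (φ x₀) r,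
      ‖a y‖ ≤ ‖a (φ x₀)‖ + 1 := by
    have h1 : ∀ᶠ y in 𝓝 (φ x₀), ‖a y‖ ≤ ‖a (φ x₀)‖ + 1 := by
      have := ((hsmooth (φ x₀) (Metric.mem_ball_self hr₁)).continuousAt.norm).eventually_lt
        continuousAt_const (lt_add_one _)
      exact this.mono fun _ h ↦ h.le
    obtain ⟨r, hr, h⟩ := Metric.eventually_nhds_iff_ball.1 h1
    exact ⟨min r r₁, lt_min hr hr₁, min_le_right _ _, fun y hy ↦
      h y (Metric.ball_subset_ball (min_le_left _ _) hy)⟩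
  have hsub := Metric.ball_subset_ball hrr (x := φ x₀)
  obtain ⟨F, hF⟩ := (convex_ball (φ x₀) r).exists_forall_hasFDerivAt_of_fderiv_symmetric
    Metric.isOpen_ball
    (fun y hy ↦ ((hsmooth y (hsub hy)).differentiableAt (by simp)).differentiableWithinAt)
    (fun y hy v w ↦ hsym y (hsub hy) v w)
  have hFs : ContDiffOn ℝ ∞ F (Metric.ball (φ x₀) r) := by
    rw [contDiffOn_infty_iff_fderiv_of_isOpen Metric.isOpen_ball]
    refine ⟨fun y hy ↦ (hF y hy).differentiableAt.differentiableWithinAt, ?_⟩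
    exact ContDiffOn.congr (fun y hy ↦ (hsmooth y (hsub hy)).contDiffWithinAt)
      fun y hy ↦ (hF y hy).fderiv
  have himg : φ.source ∩ φ ⁻¹' Metric.ball (φ x₀) r = φ.symm '' Metric.ball (φ x₀) r := by
    ext x
    constructor
    · rintro ⟨h1, h2⟩
      exact ⟨φ x, h2, φ.left_inv h1⟩
    · rintro ⟨y, hy, rfl⟩
      have := (hball y (hsub hy)).1
      exact ⟨φ.map_target this, by rwa [mem_preimage, φ.right_inv this]⟩
  have hFφ : ContMDiffOn I 𝓘(ℝ, ℝ) ∞ (F ∘ φ) (φ.source ∩ φ ⁻¹' Metric.ball (φ x₀) r) := by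
    refine hFs.contMDiffOn.comp (t := Metric.ball (φ x₀) r) ?_ inter_subset_right
    refine contMDiffOn_extChartAt.mono fun x hx ↦ ?_
    rw [← extChartAt_source I]
    exact hx.1
  have hopen : IsOpen (φ.source ∩ φ ⁻¹' Metric.ball (φ x₀) r) :=
    isOpen_extChartAt_preimage' x₀ Metric.isOpen_ball
  refine ⟨φ.source ∩ φ ⁻¹' Metric.ball (φ x₀) r, F ∘ φ, (‖a (φ x₀)‖ + 1) * (r + r), hopen,
    ⟨mem_extChartAt_source x₀, Metric.mem_ball_self hr⟩, ?_, by positivity, hFφ,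
    fun x hx ↦ ?_, ?_⟩
  · rw [himg]
    exact (convex_ball _ _).isPreconnected.image _ ((continuousOn_extChartAt_symm x₀).mono
      fun y hy ↦ (hball y (hsub hy)).1)
  · ext v
    rw [mvfderiv_eq_fderiv_extChartAt hx.1
      ((hFφ.contMDiffAt (hopen.mem_nhds hx)).mdifferentiableAt (by simp))]
    have h1 : (F ∘ φ) ∘ φ.symm =ᶠ[𝓝 (φ x)] F := by
      filter_upwards [Metric.isOpen_ball.mem_nhds hx.2] with y hy
      simp only [comp_apply, φ.right_inv (hball y (hsub hy)).1]
    rw [h1.fderiv_eq, (hF _ hx.2).fderiv]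
    refine Eq.trans ?_ (ha x hx.1 _).symm
    rw [coordField_mfderiv_extChartAt hx.1]
  · intro k m hm hk x hx y hy
    have h1 : ∀ z ∈ Metric.ball (φ x₀) r, DifferentiableAt ℝ (k ∘ φ.symm) z := by
      intro z hz
      have hzs : φ.symm z ∈ φ.source ∩ φ ⁻¹' Metric.ball (φ x₀) r := by
        rw [himg]
        exact mem_image_of_mem _ hz
      refine mdifferentiableAt_iff_differentiableAt.1 ?_
      have h2 : ContMDiffAt 𝓘(ℝ, E) I ∞ φ.symm z :=
        (contMDiffOn_extChartAt_symm x₀).contMDiffAt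
          (extChartAt_target_mem_nhds' (hball z (hsub hz)).1)
      exact MDifferentiableAt.comp z (hk _ hzs).1 (h2.mdifferentiableAt (by simp))
    have h2 : ∀ z ∈ Metric.ball (φ x₀) r,
        ‖fderiv ℝ (k ∘ φ.symm) z‖ ≤ m * (‖a (φ x₀)‖ + 1) := by
      intro z hz
      have hz' := (hball z (hsub hz)).1
      have hzs : φ.symm z ∈ φ.source ∩ φ ⁻¹' Metric.ball (φ x₀) r := by
        rw [himg]
        exact mem_image_of_mem _ hz
      obtain ⟨hk1, μ, hμ, hk2⟩ := hk _ hzs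
      have h3 : fderiv ℝ (k ∘ φ.symm) z = μ • a z := by
        ext w
        have := mvfderiv_coordField hzs.1 hk1 w
        rw [← hφ, φ.right_inv hz'] at this
        rw [← this, hk2]
        rfl
      rw [h3, norm_smul, Real.norm_eq_abs]
      exact mul_le_mul hμ (hbd z hz) (norm_nonneg _) hm
    have h3 := (convex_ball (φ x₀) r).norm_image_sub_le_of_norm_fderiv_le h1 h2 hy.2 hx.2
    simp only [comp_apply, φ.left_inv hx.1, φ.left_inv hy.1, Real.norm_eq_abs] at h3
    refine h3.trans ?_
    rw [mul_assoc]
    refine mul_le_mul_of_nonneg_left (mul_le_mul_of_nonneg_left ?_ (by positivity)) hm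
    rw [← dist_eq_norm]
    exact (dist_triangle_right _ _ (φ x₀)).trans (add_le_add (Metric.mem_ball.1 hx.2).le
      (Metric.mem_ball.1 hy.2).le)

end LocalPrimitive

section CompactForms

variable {E : Type*} [NormedAddCommGroup E] [NormedSpace ℝ E] [FiniteDimensional ℝ E]
  {H : Type*} [TopologicalSpace H] {I : ModelWithCorners ℝ E H} [I.Boundaryless]
  {L : Type*} [TopologicalSpace L] [ChartedSpace H L] [IsManifold I ∞ L] [T2Space L]

/-- A function with vanishing derivative is locally constant. -/
lemma eventually_eq_of_mvfderiv_eq_zero {h : L → ℝ} {x : L}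
    (hh : ∀ᶠ y in 𝓝 x, MDifferentiableAt I 𝓘(ℝ, ℝ) h y ∧ mvfderiv I h y = 0) :
    ∀ᶠ y in 𝓝 x, h y = h x := by
  set φ := extChartAt I x with hφ
  have ht : Tendsto φ.symm (𝓝 (φ x)) (𝓝 x) := by
    have := (continuousAt_extChartAt_symm (I := I) x).tendsto
    rwa [extChartAt_to_inv] at this
  obtain ⟨r, hr, hb⟩ := Metric.eventually_nhds_iff_ball.1
    (Eventually.and (extChartAt_target_mem_nhds (I := I) x) (ht.eventually hh))
  have h1 : ∀ z ∈ Metric.ball (φ x) r, DifferentiableAt ℝ (h ∘ φ.symm) z := by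
    intro z hz
    refine mdifferentiableAt_iff_differentiableAt.1 ?_
    have h2 : ContMDiffAt 𝓘(ℝ, E) I ∞ φ.symm z :=
      (contMDiffOn_extChartAt_symm x).contMDiffAt (extChartAt_target_mem_nhds' (hb z hz).1)
    exact MDifferentiableAt.comp z (hb z hz).2.1 (h2.mdifferentiableAt (by simp))
  have h2 : ∀ z ∈ Metric.ball (φ x) r, ‖fderiv ℝ (h ∘ φ.symm) z‖ ≤ 0 := by
    intro z hz
    have h3 : fderiv ℝ (h ∘ φ.symm) z = 0 := by
      ext w
      have := mvfderiv_coordField (φ.map_target (hb z hz).1) (hb z hz).2.1 w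
      rw [← hφ, φ.right_inv (hb z hz).1] at this
      rw [← this, (hb z hz).2.2]
      rfl
    rw [h3, norm_zero]
  have h3 : ∀ᶠ y in 𝓝 x, φ y ∈ Metric.ball (φ x) r :=
    (continuousAt_extChartAt (I := I) x).eventually (Metric.ball_mem_nhds _ hr)
  filter_upwards [h3, extChartAt_source_mem_nhds (I := I) x] with y hy hy2
  have h4 := (convex_ball (φ x) r).norm_image_sub_le_of_norm_fderiv_le h1 h2
    (Metric.mem_ball_self hr) hy
  simp only [comp_apply, zero_mul, norm_le_zero_iff] at h4
  rw [φ.left_inv hy2, φ.left_inv (mem_extChartAt_source x)] at h4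
  exact sub_eq_zero.1 h4

/-- The derivative of a function vanishes at a maximum. -/
lemma mvfderiv_eq_zero_of_forall_le {h : L → ℝ} {x : L} (hh : MDifferentiableAt I 𝓘(ℝ, ℝ) h x)
    (hx : ∀ y, h y ≤ h x) : mvfderiv I h x = 0 := by
  ext v
  rw [mvfderiv_eq_fderiv_extChartAt (mem_extChartAt_source x) hh, IsLocalMax.fderiv_eq_zero]
  · rfl
  · refine Eventually.of_forall fun y ↦ ?_
    simp only [comp_apply, extChartAt_to_inv]
    exact hx _

variable [CompactSpace L]

/-- A nowhere vanishing one-form on a compact manifold is not exact. -/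
lemma not_exact_of_ne_zero [Nonempty L] {α : ∀ x : L, TangentSpace I x →L[ℝ] ℝ}
    (hα : ∀ x, α x ≠ 0) {r : ℝ} (hr : r ≠ 0) {q : L → ℝ}
    (hq : ∀ x, MDifferentiableAt I 𝓘(ℝ, ℝ) q x ∧ mvfderiv I q x = r • α x) : False := by
  have hc : Continuous q := continuous_iff_continuousAt.2 fun x ↦ (hq x).1.continuousAt
  obtain ⟨x, -, hx⟩ := isCompact_univ.exists_isMaxOn univ_nonempty hc.continuousOn
  have h1 := mvfderiv_eq_zero_of_forall_le (hq x).1 fun y ↦ hx (mem_univ y)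
  rw [(hq x).2] at h1
  exact (smul_ne_zero hr (hα x)) h1

/-- The oscillation of a function `k` with `dk = μ α` is bounded in terms of `μ`. -/
lemma exists_oscillation_bound [PreconnectedSpace L] (α : closedOneForms I L) :
    ∃ C : ℝ, ∀ (k : L → ℝ) (m : ℝ), 0 ≤ m → (∀ x, MDifferentiableAt I 𝓘(ℝ, ℝ) k x ∧
        ∃ μ : ℝ, |μ| ≤ m ∧ mvfderiv I k x = μ • α.1 x) → ∀ x y, |k x - k y| ≤ m * C := by
  choose U f A hU hxU hcon hA hf hfα hk using exists_local_primitive α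
  obtain ⟨t, ht⟩ := isCompact_univ.elim_finite_subcover U hU
    fun x _ ↦ mem_iUnion.2 ⟨x, hxU x⟩
  refine ⟨∑ i ∈ t, A i, fun k m hm hkm x y ↦ ?_⟩
  have hc : Continuous k := continuous_iff_continuousAt.2 fun x ↦ (hkm x).1.continuousAt
  have h1 : uIcc (k x) (k y) ⊆ ⋃ i ∈ t, k '' U i := by
    have h2 := (isPreconnected_range hc).ordConnected.uIcc_subset (mem_range_self x)
      (mem_range_self y)
    refine h2.trans ?_
    rintro _ ⟨z, rfl⟩
    obtain ⟨i, hi, hz⟩ := mem_iUnion₂.1 (ht (mem_univ z))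
    exact mem_iUnion₂.2 ⟨i, hi, mem_image_of_mem _ hz⟩
  have h2 : MeasureTheory.volume (uIcc (k x) (k y)) ≤ ENNReal.ofReal (m * ∑ i ∈ t, A i) := by
    refine (MeasureTheory.measure_mono h1).trans
      ((MeasureTheory.measure_biUnion_finset_le t _).trans ?_)
    rw [Finset.mul_sum, ENNReal.ofReal_sum_of_nonneg fun i _ ↦ mul_nonneg hm (hA i)]
    refine Finset.sum_le_sum fun i _ ↦ (Real.volume_le_diam _).trans ?_
    refine Metric.ediam_le ?_
    rintro _ ⟨a, ha, rfl⟩ _ ⟨b, hb, rfl⟩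
    rw [edist_dist, Real.dist_eq]
    exact ENNReal.ofReal_le_ofReal (hk i k m hm (fun z _ ↦ hkm z) a ha b hb)
  rw [Real.volume_interval] at h2
  have h3 := (ENNReal.ofReal_le_ofReal_iff
    (mul_nonneg hm (Finset.sum_nonneg fun i _ ↦ hA i))).1 h2
  rwa [abs_sub_comm]

/-- A map to the circle whose derivative is a small multiple of `α` lifts to a real function. -/
lemma exists_lift_of_small [PreconnectedSpace L] (α : closedOneForms I L) :
    ∃ ε > 0, ∀ r : ℝ, |r| < ε → ∀ u : L → UnitAddCircle,
      (∀ x, ∃ p : L → ℝ, SmoothNear I p x ∧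
        ∀ᶠ y in 𝓝 x, u y = (p y : UnitAddCircle) ∧ mvfderiv I p y = r • α.1 y) →
      ∃ q : L → ℝ, ∀ x, SmoothNear I q x ∧ mvfderiv I q x = r • α.1 x := by
  choose U f A hU hxU hcon hA hf hfα hk using exists_local_primitive α
  obtain ⟨t, ht⟩ := isCompact_univ.elim_finite_subcover U hU
    fun x _ ↦ mem_iUnion.2 ⟨x, hxU x⟩
  have hS : 0 ≤ ∑ i ∈ t, A i := Finset.sum_nonneg fun i _ ↦ hA i
  refine ⟨(2 * ∑ i ∈ t, A i + 1)⁻¹, by positivity, fun r hr u hu ↦ ?_⟩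
  have hfs : ∀ i, ∀ x ∈ U i, SmoothNear I (f i) x := fun i x hx ↦
    (hf i).smoothNear ((hU i).mem_nhds hx)
  have hball : ∀ i, u '' U i ⊆ Metric.closedBall (u i) (|r| * A i) := by
    intro i
    have hconst : ∀ y ∈ U i, u y - ((r * f i y : ℝ) : UnitAddCircle) =
        u i - ((r * f i i : ℝ) : UnitAddCircle) := by
      have h1 : IsLocallyConstant fun y : U i ↦ u y - ((r * f i y : ℝ) : UnitAddCircle) := by
        rw [IsLocallyConstant.iff_eventually_eq]
        intro x
        obtain ⟨p, hp, hup⟩ := hu x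
        have h2 : ∀ᶠ y in 𝓝 (x : L), p y - r * f i y = p x - r * f i x := by
          refine eventually_eq_of_mvfderiv_eq_zero (I := I) (h := fun y ↦ p y - r * f i y) ?_
          filter_upwards [hp.eventually, hup, (hU i).mem_nhds x.2] with y h1 h2 h3
          have h4 : SmoothNear I (fun z ↦ r * f i z) y := (smoothNear_const r y).mul (hfs i y h3)
          refine ⟨(h1.sub h4).mdifferentiableAt, ?_⟩
          have h5 := mvfderiv_sub h1.mdifferentiableAt h4.mdifferentiableAt
          have h6 := mvfderiv_mul (mdifferentiableAt_const (c := r)) (hfs i y h3).mdifferentiableAt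
          rw [mvfderiv_const, smul_zero, add_zero] at h6
          refine h5.trans ?_
          rw [h2.2, hfα i y h3]
          exact sub_eq_zero.2 h6.symm
        have h3 := continuous_subtype_val.continuousAt.eventually (h2.and hup)
        filter_upwards [h3] with y hy
        rw [hy.2.1, hup.self_of_nhds.1, ← AddCircle.coe_sub, ← AddCircle.coe_sub, hy.1]
      have : PreconnectedSpace (U i) := isPreconnected_iff_preconnectedSpace.1 (hcon i)
      exact fun y hy ↦ h1.apply_eq_of_preconnectedSpace ⟨y, hy⟩ ⟨i, hxU i⟩
    rintro _ ⟨y, hy, rfl⟩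
    rw [mem_closedBall_iff_norm]
    have h1 : u y - u i = ((r * (f i y - f i i) : ℝ) : UnitAddCircle) := by
      have := hconst y hy
      rw [sub_eq_sub_iff_add_eq_add] at this
      rw [mul_sub, AddCircle.coe_sub, sub_eq_sub_iff_add_eq_add, this, add_comm]
    rw [h1]
    refine (QuotientAddGroup.norm_mk_le_norm).trans ?_
    rw [Real.norm_eq_abs, abs_mul]
    refine mul_le_mul_of_nonneg_left ?_ (abs_nonneg r)
    have := hk i (f i) 1 zero_le_one (fun z hz ↦ ⟨(hfs i z hz).mdifferentiableAt, 1, by simp,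
      by rw [one_smul, hfα i z hz]⟩) y hy i (hxU i)
    rwa [one_mul] at this
  obtain ⟨θ, hθ⟩ : ∃ θ, θ ∉ range u := by
    by_contra! hc
    have h1 : (univ : Set UnitAddCircle) ⊆ ⋃ i ∈ t, Metric.closedBall (u i) (|r| * A i) := by
      intro θ _
      obtain ⟨z, rfl⟩ := hc θ
      obtain ⟨i, hi, hz⟩ := mem_iUnion₂.1 (ht (mem_univ z))
      exact mem_iUnion₂.2 ⟨i, hi, hball i (mem_image_of_mem _ hz)⟩
    have h2 := (MeasureTheory.measure_mono (μ := MeasureTheory.volume) h1).trans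
      (MeasureTheory.measure_biUnion_finset_le t _)
    rw [UnitAddCircle.measure_univ] at h2
    have h3 : ∑ i ∈ t, MeasureTheory.volume (Metric.closedBall (u i) (|r| * A i)) ≤
        ENNReal.ofReal (∑ i ∈ t, 2 * (|r| * A i)) := by
      rw [ENNReal.ofReal_sum_of_nonneg fun i _ ↦
        mul_nonneg zero_le_two (mul_nonneg (abs_nonneg r) (hA i))]
      refine Finset.sum_le_sum fun i _ ↦ ?_
      rw [AddCircle.volume_closedBall]
      exact ENNReal.ofReal_le_ofReal (min_le_right _ _)
    have h4 := h2.trans h3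
    rw [ENNReal.one_le_ofReal, ← Finset.mul_sum, ← Finset.mul_sum] at h4
    rw [← one_div, lt_div_iff₀ (by positivity)] at hr
    nlinarith [abs_nonneg r]
  obtain ⟨a, rfl⟩ := QuotientAddGroup.mk_surjective θ
  set e := AddCircle.openPartialHomeomorphCoe (1 : ℝ) a with he
  have hmem : ∀ x, u x ∈ e.target := fun x h ↦ hθ ⟨x, h⟩
  have hq : ∀ x, ((e.symm (u x) : ℝ) : UnitAddCircle) = u x := fun x ↦ e.right_inv (hmem x)
  refine ⟨fun x ↦ e.symm (u x), fun x ↦ ?_⟩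
  obtain ⟨p, hp, hup⟩ := hu x
  have hpc : ContinuousAt p x := (Eventually.self_of_nhds hp).continuousAt
  have huc : ContinuousAt u x := by
    have h1 : ContinuousAt (fun y ↦ (p y : UnitAddCircle)) x :=
      (AddCircle.continuous_mk' (1 : ℝ)).continuousAt.comp hpc
    exact h1.congr (by filter_upwards [hup] with y hy using hy.1.symm)
  have hqc : ContinuousAt (fun y ↦ e.symm (u y)) x :=
    ContinuousAt.comp (g := e.symm) (e.continuousAt_symm (hmem x)) huc
  have hint : ∀ᶠ y in 𝓝 x, ∃ n : ℤ, e.symm (u y) - p y = n := by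
    filter_upwards [hup] with y hy
    have h1 : ((e.symm (u y) - p y : ℝ) : UnitAddCircle) = 0 := by
      rw [AddCircle.coe_sub, hq, hy.1, sub_self]
    obtain ⟨n, hn⟩ := AddCircle.coe_eq_zero_iff (1 : ℝ) |>.1 h1
    exact ⟨n, by simpa using hn.symm⟩
  have hloc : (fun y ↦ e.symm (u y)) =ᶠ[𝓝 x] fun y ↦ p y + (e.symm (u x) - p x) := by
    have h1 := (hqc.sub hpc).eventually (Metric.ball_mem_nhds _ one_pos)
    filter_upwards [h1, hint] with y hy hn
    obtain ⟨n, hn⟩ := hn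
    obtain ⟨m, hm⟩ := hint.self_of_nhds
    change dist (e.symm (u y) - p y) (e.symm (u x) - p x) < 1 at hy
    rw [hn, hm, Int.dist_cast_real, Int.dist_eq] at hy
    have h2 : n = m := by
      have : |n - m| < 1 := by exact_mod_cast hy
      rw [Int.abs_lt_one_iff] at this
      omega
    rw [hm, ← h2, ← hn]
    ring
  refine ⟨(hp.add (smoothNear_const _ x)).congr hloc, ?_⟩
  rw [mvfderiv_congr hloc]
  refine (mvfderiv_add hp.mdifferentiableAt mdifferentiableAt_const).trans ?_
  rw [mvfderiv_const, add_zero]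
  exact hup.self_of_nhds.2

/-- If `dk ∧ α = 0` for a nowhere vanishing closed one-form `α` that is scaled by a
diffeomorphism, then `k` is constant. -/
lemma eq_of_mvfderiv_eq_smul [PreconnectedSpace L] (φ : L ≃ₘ⟮I, I⟯ L) (α : closedOneForms I L)
    {lam : ℝ} (hlam : lam ≠ 0)
    (hφ : ∀ x, covectorPullback I I φ α.1 x = Real.exp lam • α.1 x) {k μ : L → ℝ}
    (hk : ∀ x, SmoothNear I k x) (hμ : Continuous μ) (hkμ : ∀ x, mvfderiv I k x = μ x • α.1 x)
    (x y : L) : k x = k y := by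
  obtain ⟨C, hC⟩ := exists_oscillation_bound α
  obtain ⟨m, hm⟩ : ∃ m, ∀ x, |μ x| ≤ m := by
    obtain ⟨m, hm⟩ := isCompact_univ.exists_bound_of_continuousOn hμ.continuousOn
    exact ⟨m, fun x ↦ hm x (mem_univ x)⟩
  have hm0 : 0 ≤ m := (abs_nonneg _).trans (hm x)
  have key : ∀ n : ℤ, |k x - k y| ≤ m * Real.exp (n * lam) * C := by
    intro n
    set ψ : L → L := ⇑(φ.toEquiv ^ n : Equiv.Perm L) with hψ
    have hψs : ContMDiff I I ∞ ψ := MappingTorus.contMDiff_zpow φ n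
    have h1 := hC (k ∘ ψ) (m * Real.exp (n * lam)) (by positivity) (fun z ↦ ?_)
      ((φ.toEquiv ^ n : Equiv.Perm L).symm x) ((φ.toEquiv ^ n : Equiv.Perm L).symm y)
    · simpa only [hψ, comp_apply, Equiv.apply_symm_apply] using h1
    · refine ⟨(hk (ψ z)).mdifferentiableAt.comp z ((hψs z).mdifferentiableAt (by simp)),
        μ (ψ z) * Real.exp (n * lam), ?_, ?_⟩
      · rw [abs_mul, abs_of_pos (Real.exp_pos _)]
        exact mul_le_mul_of_nonneg_right (hm _) (Real.exp_pos _).le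
      · rw [mvfderiv_comp z (hk (ψ z)).mdifferentiableAt ((hψs z).mdifferentiableAt (by simp)),
          hkμ, mul_smul, ← MappingTorus.covectorPullback_zpow φ α.1 lam hφ n z]
        rfl
  by_contra hne
  have hpos : 0 < |k x - k y| := abs_pos.2 (sub_ne_zero.2 hne)
  have h0 := key 0
  simp only [Int.cast_zero, zero_mul, Real.exp_zero, mul_one] at h0
  have hmC : 0 < m * C := hpos.trans_le h0
  obtain ⟨n, hn⟩ : ∃ n : ℤ, n * lam < Real.log (|k x - k y| / (m * C)) := by
    rcases lt_or_gt_of_ne hlam with h | h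
    · obtain ⟨n, hn⟩ := exists_int_gt (Real.log (|k x - k y| / (m * C)) / lam)
      exact ⟨n, (div_lt_iff_of_neg h).1 hn⟩
    · obtain ⟨n, hn⟩ := exists_int_lt (Real.log (|k x - k y| / (m * C)) / lam)
      exact ⟨n, (lt_div_iff₀ h).1 hn⟩
  have h1 := key n
  rw [Real.lt_log_iff_exp_lt (by positivity), lt_div_iff₀ hmC] at hn
  nlinarith

/-- If `β = db` on the kernel of `α`, then `β - db` is a multiple of `α`. -/
lemma exists_eq_smul_add_mvfderiv [ConnectedSpace L] (φ : L ≃ₘ⟮I, I⟯ L)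
    (α β : closedOneForms I L) (hα : ∀ x, α.1 x ≠ 0) {lam : ℝ} (hlam : lam ≠ 0)
    (hφ : ∀ x, covectorPullback I I φ α.1 x = Real.exp lam • α.1 x) {b : L → ℝ}
    (hb : ∀ x, SmoothNear I b x)
    (h : ∀ x v, α.1 x v = 0 → β.1 x v = mvfderiv I b x v) :
    ∃ c : ℝ, ∀ x, β.1 x = c • α.1 x + mvfderiv I b x := by
  have hlin : ∀ x (θ : TangentSpace I x →L[ℝ] ℝ), (∀ v, α.1 x v = 0 → θ v = 0) →
      ∃ c : ℝ, θ = c • α.1 x := by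
    intro x θ hθ
    obtain ⟨w, hw⟩ : ∃ w, α.1 x w ≠ 0 := by
      by_contra! hc
      exact hα x (ContinuousLinearMap.ext hc)
    refine ⟨θ w / α.1 x w, ?_⟩
    ext v
    have h1 := hθ (v - (α.1 x v / α.1 x w) • w) (by
      rw [map_sub, map_smul, smul_eq_mul, div_mul_cancel₀ _ hw, sub_self])
    rw [map_sub, map_smul, smul_eq_mul, sub_eq_zero] at h1
    rw [h1]
    change _ = θ w / α.1 x w * α.1 x v
    ring
  choose k hk using fun x ↦ hlin x (β.1 x - mvfderiv I b x)
    fun v hv ↦ by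
      change β.1 x v - mvfderiv I b x v = 0
      rw [h x v hv, sub_self]
  have hloc : ∀ x, ∃ f u : L → ℝ, SmoothNear I f x ∧ SmoothNear I u x ∧
      ∀ᶠ y in 𝓝 x, α.1 y = mvfderiv I f y ∧ mvfderiv I u y = k y • mvfderiv I f y := by
    intro x
    obtain ⟨U, f, -, hU, hxU, -, -, hf, hfα, -⟩ := exists_local_primitive α x
    obtain ⟨W, g, -, hW, hxW, -, -, hg, hgβ, -⟩ := exists_local_primitive β x
    have hg' := hg.smoothNear (hW.mem_nhds hxW)
    refine ⟨f, fun y ↦ g y - b y, hf.smoothNear (hU.mem_nhds hxU), hg'.sub (hb x), ?_⟩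
    filter_upwards [hU.mem_nhds hxU, hW.mem_nhds hxW, hg'.eventually] with y h1 h2 h3
    refine ⟨hfα y h1, ?_⟩
    refine (mvfderiv_sub h3.mdifferentiableAt (hb y).mdifferentiableAt).trans ?_
    rw [← hgβ y h2, ← hfα y h1, hk]
  have hks : ∀ x, SmoothNear I k x := by
    intro x
    obtain ⟨f, u, hf, hu, hev⟩ := hloc x
    refine SmoothNear.of_mvfderiv_eq_smul hu hf ?_ (hev.mono fun y hy ↦ hy.2)
    rw [← hev.self_of_nhds.1]
    exact hα x
  choose μ hμ using fun x ↦ hlin x (mvfderiv I k x) (by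
    intro v hv
    obtain ⟨f, u, hf, hu, hev⟩ := hloc x
    obtain ⟨w, hw⟩ : ∃ w, α.1 x w ≠ 0 := by
      by_contra! hc
      exact hα x (ContinuousLinearMap.ext hc)
    have h1 := mvfderiv_mul_comm_of_mvfderiv_eq_smul hu hf (hks x) (hev.mono fun y hy ↦ hy.2) v w
    rw [← hev.self_of_nhds.1, hv, mul_zero] at h1
    exact (mul_eq_zero.1 h1).resolve_right hw)
  have hμc : Continuous μ := by
    refine continuous_iff_continuousAt.2 fun x ↦ ?_
    obtain ⟨f, u, hf, hu, hev⟩ := hloc x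
    have h1 : SmoothNear I μ x := by
      refine SmoothNear.of_mvfderiv_eq_smul (hks x) hf ?_
        (hev.mono fun y hy ↦ by rw [hμ, hy.1])
      rw [← hev.self_of_nhds.1]
      exact hα x
    exact (Eventually.self_of_nhds h1).continuousAt
  obtain ⟨x₀⟩ : Nonempty L := inferInstance
  refine ⟨k x₀, fun x ↦ ?_⟩
  rw [eq_of_mvfderiv_eq_smul φ α hlam hφ hks hμc hμ x₀ x, ← hk, sub_add_cancel]

end CompactForms

section IntegralForms

variable {E : Type*} [NormedAddCommGroup E] [NormedSpace ℝ E] [FiniteDimensional ℝ E]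
  {H : Type*} [TopologicalSpace H] {I : ModelWithCorners ℝ E H} [I.Boundaryless]
  {L : Type*} [TopologicalSpace L] [ChartedSpace H L] [IsManifold I ∞ L] [T2Space L]

/-- Two functions with the same derivative differ by a locally constant function. -/
lemma eventually_sub_eq_of_mvfderiv_eq {f g : L → ℝ} {x : L} (hf : SmoothNear I f x)
    (hg : SmoothNear I g x) (h : ∀ᶠ y in 𝓝 x, mvfderiv I f y = mvfderiv I g y) :
    ∀ᶠ y in 𝓝 x, f y - g y = f x - g x := by
  refine eventually_eq_of_mvfderiv_eq_zero (I := I) (h := fun y ↦ f y - g y) ?_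
  filter_upwards [hf.eventually, hg.eventually, h] with y h1 h2 h3
  refine ⟨(h1.sub h2).mdifferentiableAt, ?_⟩
  refine (mvfderiv_sub h1.mdifferentiableAt h2.mdifferentiableAt).trans ?_
  rw [h3, sub_self]

/-- Two functions whose difference is locally constant have the same derivative. -/
lemma mvfderiv_eq_of_eventually_sub_eq {f g : L → ℝ} {x : L} (hg : SmoothNear I g x) {c : ℝ}
    (h : ∀ᶠ y in 𝓝 x, f y - g y = c) : mvfderiv I f x = mvfderiv I g x := by
  have h1 : f =ᶠ[𝓝 x] g + fun _ ↦ c := by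
    filter_upwards [h] with y hy
    simp [← hy]
  rw [mvfderiv_congr h1, mvfderiv_add hg.mdifferentiableAt mdifferentiableAt_const,
    mvfderiv_const, add_zero]

lemma SmoothNear.sum {ι : Type*} {s : Finset ι} {f : ι → L → ℝ} {x : L}
    (h : ∀ i ∈ s, SmoothNear I (f i) x) : SmoothNear I (fun y ↦ ∑ i ∈ s, f i y) x := by
  have h1 : ∀ᶠ y in 𝓝 x, ∀ i ∈ s, ContMDiffAt I 𝓘(ℝ, ℝ) ∞ (f i) y :=
    (Finset.eventually_all s).2 h
  filter_upwards [h1] with y hy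
  exact contMDiffAt_finsetSum hy

lemma mvfderiv_sum_smul {ι : Type*} {s : Finset ι} (a : ι → ℝ) {f : ι → L → ℝ} {x : L}
    (h : ∀ i ∈ s, SmoothNear I (f i) x) :
    mvfderiv I (fun y ↦ ∑ i ∈ s, a i * f i y) x = ∑ i ∈ s, a i • mvfderiv I (f i) x := by
  classical
  induction s using Finset.induction_on with
  | empty => simpa using mvfderiv_const (I := I) (0 : ℝ) (x := x)
  | insert i s hi ih =>
    simp only [Finset.sum_insert hi]
    have h1 := h i (Finset.mem_insert_self i s)
    have h2 : SmoothNear I (fun y ↦ ∑ i ∈ s, a i * f i y) x :=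
      SmoothNear.sum fun j hj ↦ (smoothNear_const (a j) x).mul (h j (Finset.mem_insert_of_mem hj))
    refine (mvfderiv_add ((smoothNear_const (a i) x).mul h1).mdifferentiableAt
      h2.mdifferentiableAt).trans ?_
    rw [ih fun j hj ↦ h j (Finset.mem_insert_of_mem hj)]
    congr 1
    refine (mvfderiv_mul mdifferentiableAt_const h1.mdifferentiableAt).trans ?_
    rw [mvfderiv_const, smul_zero, add_zero]

lemma mvfderiv_const_mul (c : ℝ) {f : L → ℝ} {x : L} (h : MDifferentiableAt I 𝓘(ℝ, ℝ) f x) :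
    mvfderiv I (fun y ↦ c * f y) x = c • mvfderiv I f x := by
  refine (mvfderiv_mul mdifferentiableAt_const h).trans ?_
  rw [mvfderiv_const, smul_zero, add_zero]

variable [CompactSpace L]

/-- Local primitives of a closed one-form whose differences have values in a finitely generated
group. -/
lemma exists_primitives_sub_mem (α : closedOneForms I L) :
    ∃ (t : Finset L) (V : t → Set L) (f : t → L → ℝ) (A : AddSubgroup ℝ), A.FG ∧
      (∀ i, IsOpen (V i)) ∧ (∀ x, ∃ i, x ∈ V i) ∧
      (∀ i, ∀ x ∈ V i, SmoothNear I (f i) x ∧ α.1 x = mvfderiv I (f i) x) ∧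
      ∀ i j, ∀ x ∈ V i, x ∈ V j → f i x - f j x ∈ A := by
  choose U f A hU hxU hcon hA hf hfα hk using exists_local_primitive α
  have hV : ∀ x, ∃ V, IsOpen V ∧ x ∈ V ∧ closure V ⊆ U x := by
    intro x
    obtain ⟨C, hC, hCc, hCU⟩ := exists_mem_nhds_isClosed_subset ((hU x).mem_nhds (hxU x))
    exact ⟨interior C, isOpen_interior, mem_interior_iff_mem_nhds.2 hC,
      (closure_minimal interior_subset hCc).trans hCU⟩
  choose V hVo hxV hVU using hV
  obtain ⟨t, ht⟩ := isCompact_univ.elim_finite_subcover V hVo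
    fun x _ ↦ mem_iUnion.2 ⟨x, hxV x⟩
  have hfs : ∀ i, ∀ x ∈ U i, SmoothNear I (f i) x := fun i x hx ↦
    (hf i).smoothNear ((hU i).mem_nhds hx)
  have hfin : ∀ i j, ((fun x ↦ f i x - f j x) '' (closure (V i) ∩ closure (V j))).Finite := by
    intro i j
    have h1 : IsLocallyConstant
        fun x : (closure (V i) ∩ closure (V j) : Set L) ↦ f i x - f j x := by
      rw [IsLocallyConstant.iff_eventually_eq]
      intro x
      have h2 := eventually_sub_eq_of_mvfderiv_eq (hfs i x (hVU i x.2.1)) (hfs j x (hVU j x.2.2))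
        (by filter_upwards [(hU i).mem_nhds (hVU i x.2.1), (hU j).mem_nhds (hVU j x.2.2)]
              with y h1 h2
            rw [← hfα i y h1, ← hfα j y h2])
      exact continuous_subtype_val.continuousAt.eventually h2
    have : CompactSpace (closure (V i) ∩ closure (V j) : Set L) :=
      isCompact_iff_compactSpace.1 (isClosed_closure.inter isClosed_closure).isCompact
    refine h1.range_finite.subset ?_
    rintro _ ⟨x, hx, rfl⟩
    exact ⟨⟨x, hx⟩, rfl⟩
  set S : Set ℝ := ⋃ i : t, ⋃ j : t,
    (fun x ↦ f i x - f j x) '' (closure (V i) ∩ closure (V j)) with hS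
  have hSfin : S.Finite := finite_iUnion fun i ↦ finite_iUnion fun j ↦ hfin i j
  refine ⟨t, fun i ↦ V i, fun i ↦ f i, AddSubgroup.closure S,
    (AddSubgroup.fg_iff _).2 ⟨S, rfl, hSfin⟩, fun i ↦ hVo i, fun x ↦ ?_, fun i x hx ↦ ?_,
    fun i j x hi hj ↦ AddSubgroup.subset_closure ?_⟩
  · obtain ⟨i, hi, hx⟩ := mem_iUnion₂.1 (ht (mem_univ x))
    exact ⟨⟨i, hi⟩, hx⟩
  · have := hVU i (subset_closure hx)
    exact ⟨hfs i x this, hfα i x this⟩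
  · exact mem_iUnion₂.2 ⟨i, j, mem_image_of_mem _ ⟨subset_closure hi, subset_closure hj⟩⟩

/-- Functions whose differences are prescribed integers, obtained from the differences of local
primitives of a closed one-form. -/
lemma exists_functions_sub_eq {α : closedOneForms I L} {ι : Type*} [Fintype ι] {V : ι → Set L}
    {f : ι → L → ℝ} {A : AddSubgroup ℝ} (hV : ∀ i, IsOpen (V i)) (hcov : ∀ x, ∃ i, x ∈ V i)
    (hf : ∀ i, ∀ x ∈ V i, SmoothNear I (f i) x ∧ α.1 x = mvfderiv I (f i) x)
    (hA : ∀ i j, ∀ x ∈ V i, x ∈ V j → f i x - f j x ∈ A) (h : A →+ ℤ) :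
    ∃ g : ι → L → ℝ, (∀ i, ∀ x ∈ V i, SmoothNear I (g i) x) ∧
      ∀ i j x (hi : x ∈ V i) (hj : x ∈ V j), g i x - g j x = h ⟨_, hA i j x hi hj⟩ := by
  classical
  obtain ⟨ρ, hρ⟩ := SmoothPartitionOfUnity.exists_isSubordinate I isClosed_univ V hV
    fun x _ ↦ mem_iUnion.2 (hcov x)
  let h' : ℝ → ℝ := fun r ↦ if hr : r ∈ A then h ⟨r, hr⟩ else 0
  have hconst : ∀ i k x, x ∈ V i → x ∈ V k →
      ∀ᶠ y in 𝓝 x, f i y - f k y = f i x - f k x := by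
    intro i k x hi hk
    refine eventually_sub_eq_of_mvfderiv_eq (hf i x hi).1 (hf k x hk).1 ?_
    filter_upwards [(hV i).mem_nhds hi, (hV k).mem_nhds hk] with y h1 h2
    rw [← (hf i y h1).2, ← (hf k y h2).2]
  refine ⟨fun i x ↦ ∑ k, ρ k x * h' (f i x - f k x), fun i x hx ↦ SmoothNear.sum fun k _ ↦ ?_,
    fun i j x hi hj ↦ ?_⟩
  · by_cases hk : x ∈ tsupport (ρ k)
    · refine ((ContMDiff.smoothNear (ρ k).contMDiff x).mul
        (smoothNear_const (h' (f i x - f k x)) x)).congr ?_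
      filter_upwards [hconst i k x hx (hρ k hk)] with y hy
      rw [hy]
    · refine (smoothNear_const 0 x).congr ?_
      filter_upwards [(isClosed_tsupport (ρ k)).isOpen_compl.mem_nhds hk] with y hy
      rw [image_eq_zero_of_notMem_tsupport hy, zero_mul]
  · have h1 : ∀ k, ρ k x * h' (f i x - f k x) - ρ k x * h' (f j x - f k x) =
        ρ k x * h ⟨_, hA i j x hi hj⟩ := by
      intro k
      by_cases hk : ρ k x = 0
      · simp [hk]
      · have hkV : x ∈ V k := hρ k (subset_tsupport _ hk)
        simp only [h', dif_pos (hA i k x hi hkV), dif_pos (hA j k x hj hkV)]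
        have he : (⟨_, hA i k x hi hkV⟩ : A) - ⟨_, hA j k x hj hkV⟩ = ⟨_, hA i j x hi hj⟩ :=
          Subtype.ext (sub_sub_sub_cancel_right _ _ _)
        rw [← mul_sub, ← Int.cast_sub, ← map_sub, he]
    change ∑ k, ρ k x * h' (f i x - f k x) - ∑ k, ρ k x * h' (f j x - f k x) = _
    rw [← Finset.sum_sub_distrib, Finset.sum_congr rfl fun k _ ↦ h1 k, ← Finset.sum_mul]
    have h2 := ρ.sum_eq_one (mem_univ x)
    rw [finsum_eq_sum_of_fintype] at h2
    rw [h2, one_mul]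

end IntegralForms

section SecondClass

variable {E : Type*} [NormedAddCommGroup E] [NormedSpace ℝ E] [FiniteDimensional ℝ E]
  {H : Type*} [TopologicalSpace H] {I : ModelWithCorners ℝ E H} [I.Boundaryless]
  {L : Type*} [TopologicalSpace L] [ChartedSpace H L] [IsManifold I ∞ L] [T2Space L]
  [CompactSpace L]

/-- Classes of one-forms `α`, `β` are linearly dependent, with `α` nowhere zero, only if `β` is
cohomologous to a multiple of `α`. -/
lemma exists_eq_smul_add_of_not_linearIndependent [Nonempty L] (α β : closedOneForms I L)
    (hα : ∀ x, α.1 x ≠ 0)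
    (h : ¬ LinearIndependent ℝ
      ![(Submodule.Quotient.mk α : DeRhamH1 I L), Submodule.Quotient.mk β]) :
    ∃ (c : ℝ) (F : L → ℝ), (∀ x, SmoothNear I F x) ∧
      ∀ x, β.1 x = c • α.1 x + mvfderiv I F x := by
  rw [LinearIndependent.pair_iff] at h
  push Not at h
  obtain ⟨s, t, hst, hne⟩ := h
  rw [← Submodule.Quotient.mk_smul, ← Submodule.Quotient.mk_smul, ← Submodule.Quotient.mk_add,
    Submodule.Quotient.mk_eq_zero] at hst
  obtain ⟨f, hf⟩ := hst
  have hfs : ∀ x, SmoothNear I f x := fun x ↦ f.contMDiff.smoothNear x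
  have hf' : ∀ x, s • α.1 x + t • β.1 x = mvfderiv I f x := hf
  by_cases ht : t = 0
  · subst ht
    by_cases hs : s = 0
    · exact absurd rfl (hne hs)
    · refine (not_exact_of_ne_zero (I := I) hα hs (q := f)
        fun x ↦ ⟨(hfs x).mdifferentiableAt, ?_⟩).elim
      rw [← hf', zero_smul, add_zero]
  · refine ⟨-(t⁻¹ * s), fun x ↦ t⁻¹ * f x, fun x ↦ (smoothNear_const _ x).mul (hfs x),
      fun x ↦ ?_⟩
    rw [mvfderiv_const_mul _ (hfs x).mdifferentiableAt, ← hf', smul_add, smul_smul, smul_smul,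
      inv_mul_cancel₀ ht, one_smul, ← add_assoc, ← add_smul, neg_add_cancel, zero_smul, zero_add]

lemma not_linearIndependent_of_eq_smul_add (α β : closedOneForms I L) {c : ℝ} {F : L → ℝ}
    (hF : ∀ x, SmoothNear I F x) (h : ∀ x, β.1 x = c • α.1 x + mvfderiv I F x) :
    ¬ LinearIndependent ℝ
      ![(Submodule.Quotient.mk α : DeRhamH1 I L), Submodule.Quotient.mk β] := by
  intro hli
  rw [LinearIndependent.pair_iff] at hli
  refine one_ne_zero (hli (-c) 1 ?_).2
  rw [← Submodule.Quotient.mk_smul, ← Submodule.Quotient.mk_smul, ← Submodule.Quotient.mk_add,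
    Submodule.Quotient.mk_eq_zero]
  refine ⟨⟨F, fun x ↦ (hF x).self_of_nhds⟩, fun x ↦ ?_⟩
  change (-c) • α.1 x + (1 : ℝ) • β.1 x = mvfderiv I F x
  rw [h, one_smul, ← add_assoc, ← add_smul, neg_add_cancel, zero_smul, zero_add]

/-- No nonzero multiple of `α` has integral periods up to an exact form. -/
lemma false_of_integral_smul [ConnectedSpace L] (φ : L ≃ₘ⟮I, I⟯ L) (α : closedOneForms I L)
    (hα : ∀ x, α.1 x ≠ 0) {lam : ℝ} (hlam : lam ≠ 0)
    (hφ : ∀ x, covectorPullback I I φ α.1 x = Real.exp lam • α.1 x) {c : ℝ} (hc : c ≠ 0)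
    {u : L → UnitAddCircle}
    (hu : ∀ x, ∃ p : L → ℝ, SmoothNear I p x ∧ ∀ᶠ y in 𝓝 x, u y = ↑(p y) ∧
      mvfderiv I p y = c • α.1 y) : False := by
  obtain ⟨ε, hε, hlift⟩ := exists_lift_of_small α
  obtain ⟨n, hn⟩ : ∃ n : ℤ, n * lam < Real.log (ε / |c|) := by
    rcases lt_or_gt_of_ne hlam with h | h
    · obtain ⟨n, hn⟩ := exists_int_gt (Real.log (ε / |c|) / lam)
      exact ⟨n, (div_lt_iff_of_neg h).1 hn⟩
    · obtain ⟨n, hn⟩ := exists_int_lt (Real.log (ε / |c|) / lam)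
      exact ⟨n, (lt_div_iff₀ h).1 hn⟩
  have hc' := abs_pos.2 hc
  rw [Real.lt_log_iff_exp_lt (by positivity), lt_div_iff₀ hc'] at hn
  set ψ : L → L := ⇑(φ.toEquiv ^ n : Equiv.Perm L) with hψ
  have hψs : ContMDiff I I ∞ ψ := MappingTorus.contMDiff_zpow φ n
  obtain ⟨q, hq⟩ := hlift (c * Real.exp (n * lam))
    (by rw [abs_mul, abs_of_pos (Real.exp_pos _), mul_comm]; exact hn) (u ∘ ψ) fun x ↦ by
      obtain ⟨p, hp, hup⟩ := hu (ψ x)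
      have ht : Tendsto ψ (𝓝 x) (𝓝 (ψ x)) := hψs.continuous.continuousAt
      refine ⟨p ∘ ψ, ?_, ?_⟩
      · filter_upwards [ht.eventually hp] with y hy
        exact hy.comp y (hψs y)
      · filter_upwards [ht.eventually hup, ht.eventually hp] with y hy hy2
        refine ⟨hy.1, ?_⟩
        rw [mvfderiv_comp y (hy2.mdifferentiableAt (by simp))
          ((hψs y).mdifferentiableAt (by simp)), hy.2, mul_smul,
          ← MappingTorus.covectorPullback_zpow φ α.1 lam hφ n y]
        rfl
  exact not_exact_of_ne_zero (I := I) hα (mul_ne_zero hc (Real.exp_pos _).ne')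
    fun x ↦ ⟨(hq x).1.mdifferentiableAt, (hq x).2⟩

lemma exists_integral_basis (A : AddSubgroup ℝ) (hA : A.FG) :
    ∃ (d : ℕ) (h : Fin d → A →+ ℤ) (a : Fin d → ℝ), ∀ r : A, (r : ℝ) = ∑ l, a l * h l r := by
  have h1 : Module.Finite ℤ A :=
    Module.Finite.iff_addGroup_fg.2 ((AddGroup.fg_iff_addSubgroup_fg A).2 hA)
  have h2 : Module.Free ℤ A := inferInstance
  let b := Module.finBasis ℤ A
  refine ⟨_, fun l ↦ (b.coord l).toAddMonoidHom, fun l ↦ b l, fun r ↦ ?_⟩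
  have h3 := congrArg (Subtype.val : A → ℝ) (b.sum_repr r)
  rw [← h3]
  rw [AddSubgroup.val_finsetSum]
  refine Finset.sum_congr rfl fun l _ ↦ ?_
  rw [AddSubgroup.coe_zsmul, zsmul_eq_mul, mul_comm]
  rfl

/-- A closed one-form is, up to an exact form, a combination of closed forms with integral
periods. -/
lemma exists_integral_forms (α : closedOneForms I L) :
    ∃ (d : ℕ) (a : Fin d → ℝ) (β : Fin d → closedOneForms I L) (u : Fin d → L → UnitAddCircle)
      (e : L → ℝ), (∀ x, SmoothNear I e x) ∧
      (∀ x, α.1 x = ∑ l, a l • (β l).1 x + mvfderiv I e x) ∧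
      ∀ l x, ∃ p : L → ℝ, SmoothNear I p x ∧ ∀ᶠ y in 𝓝 x, u l y = ↑(p y) ∧
        mvfderiv I p y = (β l).1 y := by
  obtain ⟨t, V, f, A, hAfg, hV, hcov, hf, hA⟩ := exists_primitives_sub_mem α
  obtain ⟨d, h, a, ha⟩ := exists_integral_basis A hAfg
  choose g hg hgg using fun l ↦ exists_functions_sub_eq hV hcov hf hA (h l)
  choose i hi using hcov
  have hd : ∀ l j k x, x ∈ V j → x ∈ V k → mvfderiv I (g l j) x = mvfderiv I (g l k) x := by
    intro l j k x hj hk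
    refine mvfderiv_eq_of_eventually_sub_eq (hg l k x hk) (c := h l ⟨_, hA j k x hj hk⟩) ?_
    have h1 := eventually_sub_eq_of_mvfderiv_eq (hf j x hj).1 (hf k x hk).1
      (by filter_upwards [(hV j).mem_nhds hj, (hV k).mem_nhds hk] with y h1 h2
          rw [← (hf j y h1).2, ← (hf k y h2).2])
    filter_upwards [h1, (hV j).mem_nhds hj, (hV k).mem_nhds hk] with y h1 h2 h3
    rw [hgg l j k y h2 h3]
    exact congrArg (fun r ↦ ((h l r : ℤ) : ℝ)) (Subtype.ext h1)
  choose β hβ using fun l ↦ exists_closedOneForm_of_locally_exact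
    (fun x ↦ mvfderiv I (g l (i x)) x) fun x ↦ ⟨g l (i x), hg l _ x (hi x), by
      filter_upwards [(hV (i x)).mem_nhds (hi x)] with y hy
      exact hd l _ _ y (hi y) hy⟩
  have he : ∀ j, ∀ x ∈ V j, f (i x) x - ∑ l, a l * g l (i x) x = f j x - ∑ l, a l * g l j x := by
    intro j x hj
    have h1 := ha ⟨_, hA (i x) j x (hi x) hj⟩
    simp only [← hgg _ (i x) j x (hi x) hj, mul_sub, Finset.sum_sub_distrib] at h1
    linarith
  have hs : ∀ j, ∀ x ∈ V j, SmoothNear I (fun y ↦ ∑ l, a l * g l j y) x := fun j x hx ↦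
    SmoothNear.sum fun l _ ↦ (smoothNear_const (a l) x).mul (hg l j x hx)
  have hev : ∀ x, (fun y ↦ f (i y) y - ∑ l, a l * g l (i y) y) =ᶠ[𝓝 x]
      fun y ↦ f (i x) y - ∑ l, a l * g l (i x) y := fun x ↦ by
    filter_upwards [(hV (i x)).mem_nhds (hi x)] with y hy using he _ y hy
  refine ⟨d, a, β, fun l x ↦ ((g l (i x) x : ℝ) : UnitAddCircle),
    fun y ↦ f (i y) y - ∑ l, a l * g l (i y) y, fun x ↦ ?_, fun x ↦ ?_, fun l x ↦ ?_⟩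
  · exact ((hf _ x (hi x)).1.sub (hs _ x (hi x))).congr (hev x)
  · rw [mvfderiv_congr (hev x)]
    have h1 : mvfderiv I (fun y ↦ f (i x) y - ∑ l, a l * g l (i x) y) x = _ :=
      mvfderiv_sub (hf _ x (hi x)).1.mdifferentiableAt (hs _ x (hi x)).mdifferentiableAt
    rw [h1, mvfderiv_sum_smul a fun l _ ↦ hg l _ x (hi x), ← (hf _ x (hi x)).2]
    simp only [hβ]
    abel
  · refine ⟨g l (i x), hg l _ x (hi x), ?_⟩
    filter_upwards [(hV (i x)).mem_nhds (hi x)] with y hy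
    refine ⟨?_, by rw [hβ]; exact hd l _ _ y hy (hi y)⟩
    have h1 := hgg l (i y) (i x) y (hi y) hy
    rw [sub_eq_iff_eq_add] at h1
    rw [h1, AddCircle.coe_add]
    simp

/-- There is a second independent class in `H¹(L)`. -/
lemma exists_linearIndependent_mk [ConnectedSpace L] (φ : L ≃ₘ⟮I, I⟯ L) (α : closedOneForms I L)
    (hα : ∀ x, α.1 x ≠ 0) {lam : ℝ} (hlam : lam ≠ 0)
    (hφ : ∀ x, covectorPullback I I φ α.1 x = Real.exp lam • α.1 x) :
    ∃ β : closedOneForms I L, LinearIndependent ℝ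
      ![(Submodule.Quotient.mk α : DeRhamH1 I L), Submodule.Quotient.mk β] := by
  by_contra! hcon
  obtain ⟨d, a, β, u, e, he, hαe, hu⟩ := exists_integral_forms α
  choose c F hF hβF using fun l ↦ exists_eq_smul_add_of_not_linearIndependent α (β l) hα
    (hcon (β l))
  by_cases hc : ∀ l, c l = 0
  · refine not_exact_of_ne_zero (I := I) hα one_ne_zero
      (q := fun x ↦ ∑ l, a l * F l x + e x) fun x ↦ ?_
    have h1 : SmoothNear I (fun x ↦ ∑ l, a l * F l x) x :=
      SmoothNear.sum fun l _ ↦ (smoothNear_const (a l) x).mul (hF l x)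
    refine ⟨(h1.add (he x)).mdifferentiableAt, ?_⟩
    refine (mvfderiv_add h1.mdifferentiableAt (he x).mdifferentiableAt).trans ?_
    rw [mvfderiv_sum_smul a fun l _ ↦ hF l x, one_smul, hαe]
    simp only [hβF, hc, zero_smul, zero_add]
  · push Not at hc
    obtain ⟨l, hl⟩ := hc
    refine false_of_integral_smul φ α hα hlam hφ hl
      (u := fun x ↦ u l x - ((F l x : ℝ) : UnitAddCircle)) fun x ↦ ?_
    obtain ⟨p, hp, hup⟩ := hu l x
    refine ⟨fun y ↦ p y - F l y, hp.sub (hF l x), ?_⟩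
    filter_upwards [hup, hp.eventually] with y hy hy2
    refine ⟨by rw [hy.1, AddCircle.coe_sub], ?_⟩
    refine (mvfderiv_sub hy2.mdifferentiableAt (hF l y).mdifferentiableAt).trans ?_
    rw [hy.2, hβF, add_sub_cancel_right]

end SecondClass

section Frames

variable {E : Type*} [NormedAddCommGroup E] [NormedSpace ℝ E] [FiniteDimensional ℝ E]
  {H : Type*} [TopologicalSpace H] {I : ModelWithCorners ℝ E H} [I.Boundaryless]
  {M : Type*} [TopologicalSpace M] [ChartedSpace H M] [IsManifold I ∞ M] [T2Space M]
  {E' : Type*} [NormedAddCommGroup E'] [NormedSpace ℝ E']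
  {H' : Type*} [TopologicalSpace H'] {J : ModelWithCorners ℝ E' H'}
  {N : Type*} [TopologicalSpace N] [ChartedSpace H' N]

lemma contMDiffAt_add_along {u : N → M} {V W : ∀ q, TangentSpace I (u q)} {q₀ : N}
    (hV : ContMDiffAt J I.tangent ∞ (fun q ↦ (⟨u q, V q⟩ : TangentBundle I M)) q₀)
    (hW : ContMDiffAt J I.tangent ∞ (fun q ↦ (⟨u q, W q⟩ : TangentBundle I M)) q₀) :
    ContMDiffAt J I.tangent ∞ (fun q ↦ (⟨u q, V q + W q⟩ : TangentBundle I M)) q₀ := by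
  have : IsManifold I 1 M := IsManifold.of_le (n := ∞) (WithTop.coe_le_coe.2 le_top)
  obtain ⟨hu, hV⟩ := contMDiffAt_totalSpace.1 hV
  obtain ⟨-, hW⟩ := contMDiffAt_totalSpace.1 hW
  refine contMDiffAt_totalSpace.2 ⟨hu, (hV.add hW).congr_of_eventuallyEq ?_⟩
  have hu' : ContinuousAt u q₀ := hu.continuousAt
  filter_upwards [hu'.eventually ((trivializationAt E (TangentSpace I : M → Type _)
    (u q₀)).open_baseSet.mem_nhds (mem_baseSet_trivializationAt E _ (u q₀)))] with q hq
  exact ((trivializationAt E (TangentSpace I : M → Type _) (u q₀)).linear ℝ hq).map_add _ _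

lemma contMDiffAt_smul_along {u : N → M} {a : N → ℝ} {V : ∀ q, TangentSpace I (u q)} {q₀ : N}
    (ha : ContMDiffAt J 𝓘(ℝ, ℝ) ∞ a q₀)
    (hV : ContMDiffAt J I.tangent ∞ (fun q ↦ (⟨u q, V q⟩ : TangentBundle I M)) q₀) :
    ContMDiffAt J I.tangent ∞ (fun q ↦ (⟨u q, a q • V q⟩ : TangentBundle I M)) q₀ := by
  have : IsManifold I 1 M := IsManifold.of_le (n := ∞) (WithTop.coe_le_coe.2 le_top)
  obtain ⟨hu, hV⟩ := contMDiffAt_totalSpace.1 hV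
  refine contMDiffAt_totalSpace.2 ⟨hu, (ha.smul hV).congr_of_eventuallyEq ?_⟩
  have hu' : ContinuousAt u q₀ := hu.continuousAt
  filter_upwards [hu'.eventually ((trivializationAt E (TangentSpace I : M → Type _)
    (u q₀)).open_baseSet.mem_nhds (mem_baseSet_trivializationAt E _ (u q₀)))] with q hq
  exact ((trivializationAt E (TangentSpace I : M → Type _) (u q₀)).linear ℝ hq).map_smul _ _

lemma eventually_linearIndependent {ι : Type*} [Finite ι] {u : N → M}
    {V : ι → ∀ q, TangentSpace I (u q)} {q₀ : N}
    (hV : ∀ i, ContMDiffAt J I.tangent ∞ (fun q ↦ (⟨u q, V i q⟩ : TangentBundle I M)) q₀)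
    (hu : ContinuousAt u q₀) (h : LinearIndependent ℝ fun i ↦ V i q₀) :
    ∀ᶠ q in 𝓝 q₀, LinearIndependent ℝ fun i ↦ V i q := by
  have : IsManifold I 1 M := IsManifold.of_le (n := ∞) (WithTop.coe_le_coe.2 le_top)
  cases nonempty_fintype ι
  set e := trivializationAt E (TangentSpace I : M → Type _) (u q₀) with he
  have hc : ContinuousAt (fun q i ↦ (e ⟨u q, V i q⟩).2) q₀ :=
    continuousAt_pi.2 fun i ↦ (contMDiffAt_totalSpace.1 (hV i)).2.continuousAt
  have hb : u q₀ ∈ e.baseSet := mem_baseSet_trivializationAt E _ (u q₀)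
  have h0 : LinearIndependent ℝ fun i ↦ (e ⟨u q₀, V i q₀⟩).2 := by
    have h1 := h.map' ((e.continuousLinearEquivAt ℝ (u q₀) hb).toLinearEquiv : _ →ₗ[ℝ] E)
      (LinearEquiv.ker _)
    exact h1
  filter_upwards [hc.eventually (isOpen_setOfPred_linearIndependent.mem_nhds h0),
    hu.eventually (e.open_baseSet.mem_nhds hb)] with q h1 hq
  have h2 : LinearIndependent ℝ fun i ↦ (e ⟨u q, V i q⟩).2 := h1
  refine LinearIndependent.of_comp ((e.continuousLinearEquivAt ℝ (u q) hq).toLinearEquiv :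
    _ →ₗ[ℝ] E) ?_
  exact h2

end Frames

section DefiningForms

variable {E : Type*} [NormedAddCommGroup E] [NormedSpace ℝ E] [FiniteDimensional ℝ E]
  {H : Type*} [TopologicalSpace H] {I : ModelWithCorners ℝ E H} [I.Boundaryless]
  {M : Type*} [TopologicalSpace M] [ChartedSpace H M] [IsManifold I ∞ M] [T2Space M]

lemma mvfderiv_comp_real {r : ℝ → ℝ} (hr : ContDiff ℝ ∞ r) {τ : M → ℝ} {x : M}
    (hτ : MDifferentiableAt I 𝓘(ℝ, ℝ) τ x) :
    mvfderiv I (fun y ↦ r (τ y)) x = deriv r (τ x) • mvfderiv I τ x := by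
  have hd := (hr.differentiable (by simp)).differentiableAt (x := τ x)
  ext v
  have := mfderiv_comp x hd.mdifferentiableAt hτ
  have e : mvfderiv I (fun y ↦ r (τ y)) x v =
    mfderiv 𝓘(ℝ, ℝ) 𝓘(ℝ, ℝ) r (τ x) (mvfderiv I τ x v) := congrArg (fun L ↦ L v) this
  rw [e, mfderiv_eq_fderiv]
  change fderiv ℝ r (τ x) (mvfderiv I τ x v) = deriv r (τ x) * mvfderiv I τ x v
  rw [← toSpanSingleton_deriv]
  simp [mul_comm]

/-- The local structure of the one-forms defining the foliations `ker θ₁ ∩ ker (θ₂ + s B)`: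
up to a factor `θ₁` is locally `df`, `θ₂ = κ dτ` and `B = r(τ) dg`, and `T` is a vector field with
`θ₁(T) = 0`, `θ₂(T) = κ` and `B(T) = 0`. -/
structure DefiningForms (θ₁ θ₂ B : ∀ p : M, TangentSpace I p →L[ℝ] ℝ) (κ : ℝ)
    (T : SmoothVectorField I M) : Prop where
  ne_zero : κ ≠ 0
  form_ne_zero : ∀ p, θ₁ p ≠ 0
  form₁_field : ∀ p, θ₁ p (T p) = 0
  form₂_field : ∀ p, θ₂ p (T p) = κ
  bump_field : ∀ p, B p (T p) = 0
  exists_local : ∀ p₀, ∃ (f τ g c : M → ℝ) (r : ℝ → ℝ), ContDiff ℝ ∞ r ∧ SmoothNear I f p₀ ∧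
    SmoothNear I τ p₀ ∧ SmoothNear I g p₀ ∧ ∀ᶠ p in 𝓝 p₀, c p ≠ 0 ∧
      θ₁ p = c p • mvfderiv I f p ∧ θ₂ p = κ • mvfderiv I τ p ∧ B p = r (τ p) • mvfderiv I g p

namespace DefiningForms

variable {θ₁ θ₂ B : ∀ p : M, TangentSpace I p →L[ℝ] ℝ} {κ : ℝ} {T : SmoothVectorField I M}

/-- The distribution `ker θ₁ ∩ ker (θ₂ + s B)`. -/
def distribution (θ₁ θ₂ B : ∀ p : M, TangentSpace I p →L[ℝ] ℝ) (s : ℝ) (p : M) :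
    Submodule ℝ (TangentSpace I p) where
  carrier := {v | θ₁ p v = 0 ∧ θ₂ p v + s * B p v = 0}
  zero_mem' := by simp
  add_mem' := by
    rintro v w ⟨h1, h2⟩ ⟨h3, h4⟩
    refine ⟨by rw [map_add, h1, h3, add_zero], ?_⟩
    rw [map_add, map_add]
    linear_combination h2 + h4
  smul_mem' := by
    rintro a v ⟨h1, h2⟩
    refine ⟨by rw [map_smul, h1, smul_zero], ?_⟩
    rw [map_smul, map_smul, smul_eq_mul, smul_eq_mul]
    linear_combination a * h2

lemma mem_distribution {s : ℝ} {p : M} {v : TangentSpace I p} :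
    v ∈ distribution θ₁ θ₂ B s p ↔ θ₁ p v = 0 ∧ θ₂ p v + s * B p v = 0 := Iff.rfl

lemma finrank_distribution (h : DefiningForms θ₁ θ₂ B κ T) (s : ℝ) (p : M) :
    Module.finrank ℝ (distribution θ₁ θ₂ B s p) = Module.finrank ℝ E - 2 := by
  have : FiniteDimensional ℝ (TangentSpace I p) := inferInstanceAs (FiniteDimensional ℝ E)
  let Θ : TangentSpace I p →ₗ[ℝ] ℝ × ℝ :=
    (θ₁ p : TangentSpace I p →ₗ[ℝ] ℝ).prod (θ₂ p + s • B p : TangentSpace I p →L[ℝ] ℝ)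
  have hk : LinearMap.ker Θ = distribution θ₁ θ₂ B s p := by
    ext v
    rw [LinearMap.mem_ker, mem_distribution]
    exact Prod.ext_iff
  have hr : LinearMap.range Θ = ⊤ := by
    obtain ⟨w, hw⟩ : ∃ w, θ₁ p w ≠ 0 := by
      by_contra! hc
      exact h.form_ne_zero p (ContinuousLinearMap.ext hc)
    rw [LinearMap.range_eq_top]
    rintro ⟨a, b⟩
    refine ⟨(a / θ₁ p w) • w +
      ((b - a / θ₁ p w * (θ₂ p w + s * B p w)) / κ) • T p, Prod.ext ?_ ?_⟩
    · change θ₁ p _ = a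
      rw [map_add, map_smul, map_smul, h.form₁_field, smul_zero, add_zero, smul_eq_mul,
        div_mul_cancel₀ _ hw]
    · change θ₂ p _ + s * B p _ = b
      simp only [map_add, map_smul, h.form₂_field, h.bump_field, smul_eq_mul]
      have := h.ne_zero
      field_simp
      ring
  have h1 := Θ.finrank_range_add_finrank_ker
  rw [hr, hk, finrank_top, Module.finrank_prod, Module.finrank_self] at h1
  have h2 : Module.finrank ℝ (TangentSpace I p) = Module.finrank ℝ E := rfl
  omega

/-- The distributions have local frames that depend smoothly on the parameter. -/
lemma exists_frame (h : DefiningForms θ₁ θ₂ B κ T) (s₀ : ℝ) (p₀ : M) :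
    ∃ U ∈ 𝓝 (s₀, p₀), ∃ V : Fin (Module.finrank ℝ E - 2) → ℝ → ∀ x : M, TangentSpace I x,
      (∀ i, ContMDiffOn (𝓘(ℝ, ℝ).prod I) I.tangent ∞
        (fun p : ℝ × M ↦ (⟨p.2, V i p.1 p.2⟩ : TangentBundle I M)) U) ∧
      ∀ p ∈ U, LinearIndependent ℝ (fun i ↦ V i p.1 p.2) ∧
        Submodule.span ℝ (range fun i ↦ V i p.1 p.2) = distribution θ₁ θ₂ B p.1 p.2 := by
  have hfd : ∀ p : M, FiniteDimensional ℝ (TangentSpace I p) := fun p ↦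
    inferInstanceAs (FiniteDimensional ℝ E)
  obtain ⟨f, τ, g, c, r, hr, hf, hτ, hg, hloc⟩ := h.exists_local p₀
  have hcθ : c p₀ ≠ 0 ∧ _ := hloc.self_of_nhds
  obtain ⟨hc, h1, h2, h3⟩ := hcθ
  obtain ⟨w, hw⟩ : ∃ w, θ₁ p₀ w ≠ 0 := by
    by_contra! hc
    exact h.form_ne_zero p₀ (ContinuousLinearMap.ext hc)
  obtain ⟨W, rfl⟩ := exists_smoothVectorField_apply_eq w
  have b := Module.finBasisOfFinrankEq ℝ _ (h.finrank_distribution s₀ p₀)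
  choose X hX using fun i ↦ exists_smoothVectorField_apply_eq (b i : TangentSpace I p₀)
  let A : SmoothVectorField I M → ℝ → M → ℝ := fun Z s x ↦
    κ * mvfderiv I τ x (Z x) + s * (r (τ x) * mvfderiv I g x (Z x))
  let a : Fin (Module.finrank ℝ E - 2) → M → ℝ := fun i x ↦
    -(mvfderiv I f x (X i x) / mvfderiv I f x (W x))
  let a' : Fin (Module.finrank ℝ E - 2) → ℝ → M → ℝ := fun i s x ↦
    -κ⁻¹ * (A (X i) s x + a i x * A W s x)
  let V : Fin (Module.finrank ℝ E - 2) → ℝ → ∀ x : M, TangentSpace I x := fun i s x ↦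
    X i x + (a i x • W x + a' i s x • T x)
  have hfW : mvfderiv I f p₀ (W p₀) ≠ 0 := by
    intro h0
    rw [h1] at hw
    exact hw (mul_eq_zero.2 (Or.inr h0))
  have hfWe : ∀ᶠ x in 𝓝 p₀, mvfderiv I f x (W x) ≠ 0 :=
    (hf.apply W).self_of_nhds.continuousAt.eventually_ne hfW
  have hA : ∀ Z s x, SmoothNear I τ x → SmoothNear I g x →
      ContMDiffAt (𝓘(ℝ, ℝ).prod I) 𝓘(ℝ, ℝ) ∞ (fun p : ℝ × M ↦ A Z p.1 p.2) (s, x) := by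
    intro Z s x hτ hg
    have e1 : ContMDiffAt (𝓘(ℝ, ℝ).prod I) 𝓘(ℝ, ℝ) ∞
        (fun p : ℝ × M ↦ mvfderiv I τ p.2 (Z p.2)) (s, x) :=
      ContMDiffAt.comp (s, x) (hτ.apply Z).self_of_nhds contMDiffAt_snd
    have e2 : ContMDiffAt (𝓘(ℝ, ℝ).prod I) 𝓘(ℝ, ℝ) ∞
        (fun p : ℝ × M ↦ r (τ p.2) * mvfderiv I g p.2 (Z p.2)) (s, x) :=
      ContMDiffAt.comp (s, x) ((hτ.comp hr).mul (hg.apply Z)).self_of_nhds contMDiffAt_snd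
    exact (contMDiffAt_const.mul e1).add (contMDiffAt_fst.mul e2)
  have hVs : ∀ i s x, SmoothNear I f x → SmoothNear I τ x → SmoothNear I g x →
      mvfderiv I f x (W x) ≠ 0 → ContMDiffAt (𝓘(ℝ, ℝ).prod I) I.tangent ∞
        (fun p : ℝ × M ↦ (⟨p.2, V i p.1 p.2⟩ : TangentBundle I M)) (s, x) := by
    intro i s x hf hτ hg hne
    have e1 : ContMDiffAt (𝓘(ℝ, ℝ).prod I) 𝓘(ℝ, ℝ) ∞ (fun p : ℝ × M ↦ a i p.2) (s, x) := by
      have e0 : ContMDiffAt I 𝓘(ℝ, ℝ) ∞ (a i) x :=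
        ((hf.apply (X i)).self_of_nhds.div₀ (hf.apply W).self_of_nhds hne).neg
      exact ContMDiffAt.comp (I' := I) (g := a i) (f := Prod.snd) (s, x) e0 contMDiffAt_snd
    have e2 : ContMDiffAt (𝓘(ℝ, ℝ).prod I) 𝓘(ℝ, ℝ) ∞ (fun p : ℝ × M ↦ a' i p.1 p.2) (s, x) :=
      contMDiffAt_const.mul ((hA (X i) s x hτ hg).add (e1.mul (hA W s x hτ hg)))
    have e3 : ∀ Z : SmoothVectorField I M, ContMDiffAt (𝓘(ℝ, ℝ).prod I) I.tangent ∞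
        (fun p : ℝ × M ↦ (⟨p.2, Z p.2⟩ : TangentBundle I M)) (s, x) := fun Z ↦
      ContMDiffAt.comp (s, x) (Z.contMDiff x) contMDiffAt_snd
    exact contMDiffAt_add_along (e3 _)
      (contMDiffAt_add_along (contMDiffAt_smul_along e1 (e3 W)) (contMDiffAt_smul_along e2 (e3 T)))
  have hmem : ∀ i s x, c x ≠ 0 ∧ θ₁ x = c x • mvfderiv I f x ∧ θ₂ x = κ • mvfderiv I τ x ∧
      B x = r (τ x) • mvfderiv I g x → mvfderiv I f x (W x) ≠ 0 →
      V i s x ∈ distribution θ₁ θ₂ B s x := by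
    rintro i s x ⟨hc, h1, h2, h3⟩ hne
    have e1 : mvfderiv I f x (T x) = 0 := by
      have := h.form₁_field x
      rw [h1] at this
      exact (mul_eq_zero.1 this).resolve_left hc
    have e2 : ∀ Z : SmoothVectorField I M, θ₂ x (Z x) + s * B x (Z x) = A Z s x := by
      intro Z
      rw [h2, h3]
      rfl
    rw [mem_distribution]
    constructor
    · rw [h1]
      change c x * mvfderiv I f x (X i x + (a i x • W x + a' i s x • T x)) = 0
      rw [map_add, map_add, map_smul, map_smul, e1, smul_zero, add_zero, smul_eq_mul]
      simp only [a]
      field_simp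
      ring
    · have e3 : θ₂ x (V i s x) + s * B x (V i s x) = (θ₂ x (X i x) + s * B x (X i x)) +
          a i x * (θ₂ x (W x) + s * B x (W x)) + a' i s x * (θ₂ x (T x) + s * B x (T x)) := by
        simp only [V, map_add, map_smul, smul_eq_mul]
        ring
      rw [e3, e2, e2, h.form₂_field, h.bump_field]
      simp only [a']
      have := h.ne_zero
      field_simp
      ring
  have hV0 : ∀ i, V i s₀ p₀ = b i := by
    intro i
    have hb := mem_distribution.1 (b i).2
    have e1 : mvfderiv I f p₀ (X i p₀) = 0 := by
      have := hb.1
      rw [h1, ← hX] at this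
      exact (mul_eq_zero.1 this).resolve_left hc
    have e2 : a i p₀ = 0 := by simp only [a, e1, zero_div, neg_zero]
    have e3 : a' i s₀ p₀ = 0 := by
      have e4 := hb.2
      rw [← hX, h2, h3] at e4
      have e5 : A (X i) s₀ p₀ = 0 := e4
      simp only [a', e2, e5, zero_mul, add_zero, mul_zero]
    simp only [V, e2, e3, zero_smul, add_zero, hX]
  have hli : LinearIndependent ℝ fun i ↦ V i s₀ p₀ := by
    simp only [hV0]
    exact b.linearIndependent.map' (Submodule.subtype _) (Submodule.ker_subtype _)
  have hli' := eventually_linearIndependent (J := 𝓘(ℝ, ℝ).prod I) (N := ℝ × M) (u := Prod.snd)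
    (V := fun i p ↦ V i p.1 p.2) (q₀ := (s₀, p₀))
    (fun i ↦ hVs i s₀ p₀ hf hτ hg hfW) continuous_snd.continuousAt hli
  have hsnd : Tendsto (Prod.snd : ℝ × M → M) (𝓝 (s₀, p₀)) (𝓝 p₀) :=
    continuous_snd.tendsto _
  refine ⟨_, (hli'.and (hsnd.eventually (hloc.and (hfWe.and (hf.eventually.and
    (hτ.eventually.and hg.eventually)))))), V, fun i p hp ↦ ?_, fun p hp ↦ ?_⟩
  · obtain ⟨-, -, e1, e2, e3, e4⟩ := hp
    exact (hVs i p.1 p.2 e2 e3 e4 e1).contMDiffWithinAt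
  · obtain ⟨e0, e5, e1, e2, e3, e4⟩ := hp
    refine ⟨e0, Submodule.eq_of_le_of_finrank_eq ?_ ?_⟩
    · rw [Submodule.span_le]
      rintro _ ⟨i, rfl⟩
      exact hmem i p.1 p.2 e5 e1
    · rw [finrank_span_eq_card e0, Fintype.card_fin, h.finrank_distribution]

lemma involutive (h : DefiningForms θ₁ θ₂ B κ T) (s : ℝ) (X Y : SmoothVectorField I M)
    (hX : ∀ x, X x ∈ distribution θ₁ θ₂ B s x) (hY : ∀ x, Y x ∈ distribution θ₁ θ₂ B s x) (x : M) :
    VectorField.mlieBracket I X Y x ∈ distribution θ₁ θ₂ B s x := by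
  have : CompleteSpace E := FiniteDimensional.complete ℝ E
  obtain ⟨f, τ, g, c, r, hr, hf, hτ, hg, hloc⟩ := h.exists_local x
  have h0 : c x ≠ 0 ∧ _ := hloc.self_of_nhds
  obtain ⟨hc, h1, h2, h3⟩ := h0
  have hfX : ∀ Z : SmoothVectorField I M, (∀ x, Z x ∈ distribution θ₁ θ₂ B s x) →
      mvfderiv I (fun y ↦ mvfderiv I f y (Z y)) x = 0 := by
    intro Z hZ
    rw [mvfderiv_congr (g := fun _ ↦ (0 : ℝ)), mvfderiv_const]
    filter_upwards [hloc] with y ⟨hc, h1, h2, h3⟩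
    have := (hZ y).1
    rw [h1] at this
    exact (mul_eq_zero.1 this).resolve_left hc
  have hτX : ∀ Z : SmoothVectorField I M, (∀ x, Z x ∈ distribution θ₁ θ₂ B s x) →
      ∀ᶠ y in 𝓝 x, mvfderiv I τ y (Z y) = -(s / κ) * (r (τ y) * mvfderiv I g y (Z y)) := by
    intro Z hZ
    filter_upwards [hloc] with y ⟨hc, h1, h2, h3⟩
    have e := (hZ y).2
    rw [h2, h3] at e
    change κ * mvfderiv I τ y (Z y) + s * (r (τ y) * mvfderiv I g y (Z y)) = 0 at e
    have := h.ne_zero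
    field_simp
    linarith
  have hd : ∀ Z : SmoothVectorField I M, (∀ x, Z x ∈ distribution θ₁ θ₂ B s x) →
      ∀ v, mvfderiv I (fun y ↦ mvfderiv I τ y (Z y)) x v = -(s / κ) *
        (r (τ x) * mvfderiv I (fun y ↦ mvfderiv I g y (Z y)) x v +
          mvfderiv I g x (Z x) * (deriv r (τ x) * mvfderiv I τ x v)) := by
    intro Z hZ v
    rw [mvfderiv_congr (hτX Z hZ), mvfderiv_const_mul _
      ((hτ.comp hr).mul (hg.apply Z)).mdifferentiableAt]
    have e : mvfderiv I (fun y ↦ r (τ y) * mvfderiv I g y (Z y)) x = _ :=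
      mvfderiv_mul (hτ.comp hr).mdifferentiableAt (hg.apply Z).mdifferentiableAt
    rw [e, mvfderiv_comp_real hr hτ.mdifferentiableAt]
    rfl
  rw [mem_distribution]
  constructor
  · rw [h1]
    change c x * mvfderiv I f x _ = 0
    rw [mvfderiv_mlieBracket hf.self_of_nhds, hfX X hX, hfX Y hY]
    simp
  · rw [h2, h3]
    change κ * mvfderiv I τ x _ + s * (r (τ x) * mvfderiv I g x _) = 0
    rw [mvfderiv_mlieBracket hτ.self_of_nhds, mvfderiv_mlieBracket hg.self_of_nhds, hd X hX,
      hd Y hY, (hτX X hX).self_of_nhds, (hτX Y hY).self_of_nhds]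
    have := h.ne_zero
    field_simp
    ring

/-- The foliation tangent to `ker θ₁ ∩ ker (θ₂ + s B)`. -/
def foliation (h : DefiningForms θ₁ θ₂ B κ T) (s : ℝ) : Foliation I M where
  rank := Module.finrank ℝ E - 2
  tangent := distribution θ₁ θ₂ B s
  exists_frame p₀ := by
    obtain ⟨U, hU, V, hV, hVU⟩ := h.exists_frame s p₀
    have hc : Continuous fun x : M ↦ (s, x) := by fun_prop
    refine ⟨(fun x ↦ (s, x)) ⁻¹' U, hc.continuousAt.preimage_mem_nhds hU, fun i x ↦ V i s x,
      fun i ↦ ?_, fun x hx ↦ hVU (s, x) hx⟩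
    exact (hV i).comp (t := U) (contMDiff_const.prodMk contMDiff_id).contMDiffOn fun x hx ↦ hx
  involutive := h.involutive s

lemma isDeformation (h : DefiningForms θ₁ θ₂ B κ T) (δ : ℝ) :
    (h.foliation 0).IsDeformation δ h.foliation :=
  ⟨rfl, fun s _ p ↦ h.exists_frame s p⟩

end DefiningForms
end DefiningForms

section InfinitesimalDeformation

variable {E : Type*} [NormedAddCommGroup E] [NormedSpace ℝ E] [FiniteDimensional ℝ E]
  {H : Type*} [TopologicalSpace H] {I : ModelWithCorners ℝ E H}
  {M : Type*} [TopologicalSpace M] [ChartedSpace H M] [IsManifold I ∞ M] [T2Space M]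

/-- Every tangent vector of a foliation extends to a vector field tangent to the foliation. -/
lemma Foliation.exists_tangentField_apply_eq (F : Foliation I M) {p : M} {v : TangentSpace I p}
    (hv : v ∈ F.tangent p) : ∃ V : F.tangentFields, V.1 p = v := by
  obtain ⟨U, hU, V, hV, hVU⟩ := F.exists_frame p
  rw [← (hVU p (mem_of_mem_nhds hU)).2] at hv
  obtain ⟨c, hc⟩ := (Submodule.mem_span_range_iff_exists_fun ℝ).1 hv
  obtain ⟨χ, h1, h2, h3⟩ := exists_cutoff (I := I) hU
  obtain ⟨X, hX⟩ := h3 (fun x ↦ ∑ i, c i • V i x)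
    (ContMDiffOn.sum_section fun i _ ↦ ContMDiffOn.const_smul_section (hV i))
  refine ⟨⟨X, fun x ↦ ?_⟩, ?_⟩
  · rw [hX]
    by_cases hx : x ∈ U
    · rw [← (hVU x hx).2]
      exact Submodule.smul_mem _ _ (Submodule.sum_mem _ fun i _ ↦ Submodule.smul_mem _ _
        (Submodule.subset_span (mem_range_self i)))
    · rw [h2 x hx, zero_smul]
      exact zero_mem _
  · change X p = v
    rw [hX, h1.self_of_nhds, hc]
    exact one_smul _ _

namespace DefiningForms

variable [I.Boundaryless] {θ₁ θ₂ B : ∀ p : M, TangentSpace I p →L[ℝ] ℝ} {κ : ℝ}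
  {T : SmoothVectorField I M}

lemma contMDiff_bump (h : DefiningForms θ₁ θ₂ B κ T) (X : SmoothVectorField I M) :
    ContMDiff I 𝓘(ℝ, ℝ) ∞ fun x ↦ B x (X x) := by
  intro x
  obtain ⟨f, τ, g, c, r, hr, hf, hτ, hg, hloc⟩ := h.exists_local x
  refine ((hτ.comp hr).mul (hg.apply X)).self_of_nhds.congr_of_eventuallyEq ?_
  filter_upwards [hloc] with y ⟨_, _, _, h3⟩
  rw [h3]
  rfl

/-- The vector field `-κ⁻¹ B(X) T`. -/
def bumpField (h : DefiningForms θ₁ θ₂ B κ T) (X : SmoothVectorField I M) :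
    SmoothVectorField I M where
  toFun x := (-κ⁻¹ * B x (X x)) • T x
  contMDiff_toFun := ContMDiff.smul_section (contMDiff_const.mul (h.contMDiff_bump X)) T.contMDiff

/-- The leafwise one-form `-κ⁻¹ B ⊗ T` with values in the normal bundle. -/
def normalForm (h : DefiningForms θ₁ θ₂ B κ T) : (h.foliation 0).normalOneForms where
  val p := (-κ⁻¹ • ((B p : TangentSpace I p →ₗ[ℝ] ℝ) ∘ₗ
    ((h.foliation 0).tangent p).subtype)).smulRight ((h.foliation 0).normalProj p (T p))
  property V := ⟨h.bumpField V.1, funext fun p ↦ ((h.foliation 0).normalProj p).map_smul _ _⟩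

lemma normalForm_apply (h : DefiningForms θ₁ θ₂ B κ T) (p : M) (v : (h.foliation 0).tangent p) :
    h.normalForm.1 p v = (-κ⁻¹ * B p v) • (h.foliation 0).normalProj p (T p) := rfl

lemma applyField_normalForm (h : DefiningForms θ₁ θ₂ B κ T) (V : (h.foliation 0).tangentFields) :
    (h.foliation 0).applyField h.normalForm V =
      ⟨(h.foliation 0).toNormal (h.bumpField V.1), _, rfl⟩ :=
  Subtype.ext <| funext fun p ↦ (((h.foliation 0).normalProj p).map_smul _ _).symm

lemma isInfinitesimalDeformation (h : DefiningForms θ₁ θ₂ B κ T) :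
    (h.foliation 0).IsInfinitesimalDeformation h.foliation h.normalForm := by
  intro p C hC
  obtain ⟨u, hu, d, hd, hud⟩ := Submodule.mem_sup.1
    (hC.sup_eq_top ▸ Submodule.mem_top (x := T p) : T p ∈ (h.foliation 0).tangent p ⊔ C)
  have hT : ∀ w, w ∈ (h.foliation 0).tangent p ↔ θ₁ p w = 0 ∧ θ₂ p w = 0 := fun w ↦ by
    change (_ ∧ θ₂ p w + 0 * B p w = 0) ↔ _
    rw [zero_mul, add_zero]
  have hκ := h.ne_zero
  have hd1 : θ₁ p d = 0 := by
    have := h.form₁_field p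
    rwa [← hud, map_add, ((hT u).1 hu).1, zero_add] at this
  have hd2 : θ₂ p d = κ := by
    have := h.form₂_field p
    rwa [← hud, map_add, ((hT u).1 hu).2, zero_add] at this
  have hdT : (h.foliation 0).normalProj p d = (h.foliation 0).normalProj p (T p) := by
    rw [← hud, map_add, ((h.foliation 0).normalProj_eq_zero_iff p u).2 hu, zero_add]
  let k : ℝ → ℝ := fun t ↦ -t / (κ + t * B p d)
  refine ⟨fun t ↦ (k t • ((B p : TangentSpace I p →ₗ[ℝ] ℝ) ∘ₗ
    ((h.foliation 0).tangent p).subtype)).smulRight d, fun t v ↦ C.smul_mem _ hd, ?_, fun v ↦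
      ⟨(-κ⁻¹ * B p v) • d, ?_, ?_⟩⟩
  · have hc : ContinuousAt (fun t : ℝ ↦ κ + t * B p d) 0 := by fun_prop
    filter_upwards [hc.eventually_ne (by simpa using hκ)] with t ht
    ext w
    change (θ₁ p w = 0 ∧ θ₂ p w + t * B p w = 0) ↔ ∃ v : (h.foliation 0).tangent p,
      (v : TangentSpace I p) + (k t * B p v) • d = w
    constructor
    · rintro ⟨hw1, hw2⟩
      obtain ⟨v, hv, y, hy, rfl⟩ := Submodule.mem_sup.1
        (hC.sup_eq_top ▸ Submodule.mem_top (x := w) : w ∈ (h.foliation 0).tangent p ⊔ C)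
      have hv' := (hT v).1 hv
      rw [map_add, hv'.1, zero_add] at hw1
      rw [map_add, map_add, hv'.2, zero_add] at hw2
      have hy' : y - (θ₂ p y / κ) • d = 0 := by
        refine (Submodule.disjoint_def.1 hC.disjoint) _ ((hT _).2 ⟨?_, ?_⟩)
          (C.sub_mem hy (C.smul_mem _ hd))
        · rw [map_sub, map_smul, hw1, hd1, smul_zero, sub_zero]
        · rw [map_sub, map_smul, hd2, smul_eq_mul, div_mul_cancel₀ _ hκ, sub_self]
      refine ⟨⟨v, hv⟩, ?_⟩
      rw [sub_eq_zero] at hy'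
      have e1 : B p y = θ₂ p y / κ * B p d := by
        conv_lhs => rw [hy']
        rw [map_smul, smul_eq_mul]
      have e2 : k t * B p v = θ₂ p y / κ := by
        simp only [k]
        rw [e1] at hw2
        field_simp at hw2 ⊢
        linarith
      change v + (k t * B p v) • d = v + y
      rw [e2, ← hy']
    · rintro ⟨v, rfl⟩
      have hv := (hT v).1 v.2
      simp only [map_add, map_smul, hv.1, hv.2, hd1, hd2, smul_eq_mul, k]
      refine ⟨by ring, ?_⟩
      field_simp
      ring
  · have h1 : HasDerivAt k (-κ⁻¹) 0 := by
      have h2 : HasDerivAt (fun t : ℝ ↦ κ + t * B p d) (1 * B p d) 0 :=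
        ((hasDerivAt_id (0 : ℝ)).mul_const _).const_add _
      have h3 := ((hasDerivAt_id (0 : ℝ)).neg).div h2 (by simpa using hκ)
      refine h3.congr_deriv ?_
      simp only [id_eq, Pi.neg_apply, neg_zero, zero_mul, sub_zero, add_zero]
      field_simp
    have h2 : ∀ d : E, HasDerivAt (fun t ↦ (k t * B p v) • d) ((-κ⁻¹ * B p v) • d) 0 := fun d ↦
      (h1.mul_const (B p v)).smul_const d
    exact h2 d
  · rw [map_smul, hdT, normalForm_apply]

lemma normalForm_mem_normalCocycles (h : DefiningForms θ₁ θ₂ B κ T) :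
    h.normalForm ∈ (h.foliation 0).normalCocycles := by
  intro V W
  have : CompleteSpace E := FiniteDimensional.complete ℝ E
  rw [applyField_normalForm, applyField_normalForm, applyField_normalForm,
    Foliation.bott_toNormal, Foliation.bott_toNormal]
  suffices hQ : V.1.bracket (h.bumpField W.1) - W.1.bracket (h.bumpField V.1) -
      h.bumpField (V.1.bracket W.1) ∈ (h.foliation 0).tangentFields by
    rw [Foliation.mem_tangentFields_iff, map_sub, map_sub] at hQ
    exact Subtype.ext hQ
  intro x
  obtain ⟨f, τ, g, c, r, hr, hf, hτ, hg, hloc⟩ := h.exists_local x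
  have hκ := h.ne_zero
  have hZ : ∀ Z : (h.foliation 0).tangentFields, ∀ᶠ y in 𝓝 x,
      mvfderiv I f y (Z.1 y) = 0 ∧ mvfderiv I τ y (Z.1 y) = 0 := by
    intro Z
    filter_upwards [hloc] with y ⟨hc, h1, h2, h3⟩
    have := mem_distribution.1 (Z.2 y)
    rw [h1, h2, zero_mul, add_zero] at this
    exact ⟨(mul_eq_zero.1 this.1).resolve_left hc, (mul_eq_zero.1 this.2).resolve_left hκ⟩
  have hT : ∀ᶠ y in 𝓝 x, mvfderiv I f y (T y) = 0 ∧ mvfderiv I τ y (T y) = 1 := by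
    filter_upwards [hloc] with y ⟨hc, h1, h2, h3⟩
    have e1 := h.form₁_field y
    have e2 := h.form₂_field y
    rw [h1] at e1
    rw [h2] at e2
    exact ⟨(mul_eq_zero.1 e1).resolve_left hc, mul_left_cancel₀ hκ (e2.trans (mul_one κ).symm)⟩
  have hb : ∀ Z : SmoothVectorField I M, ∀ᶠ y in 𝓝 x,
      mvfderiv I f y (h.bumpField Z y) = 0 ∧
      mvfderiv I τ y (h.bumpField Z y) = -κ⁻¹ * (r (τ y) * mvfderiv I g y (Z y)) := by
    intro Z
    filter_upwards [hT, hloc] with y ⟨h4, h5⟩ ⟨hc, h1, h2, h3⟩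
    have e : h.bumpField Z y = (-κ⁻¹ * (r (τ y) * mvfderiv I g y (Z y))) • T y := by
      change (-κ⁻¹ * B y (Z y)) • T y = _
      rw [h3]
      rfl
    rw [e, map_smul, map_smul, h4, h5]
    simp
  have hconst : ∀ {u : M → ℝ}, (∀ᶠ y in 𝓝 x, u y = 0) → mvfderiv I u x = 0 := fun hu ↦ by
    rw [mvfderiv_congr (g := fun _ ↦ (0 : ℝ)) hu, mvfderiv_const]
  have hbf : ∀ Z : (h.foliation 0).tangentFields, ∀ Y : SmoothVectorField I M,
      mvfderiv I f x (VectorField.mlieBracket I Z.1 (h.bumpField Y) x) = 0 := by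
    intro Z Y
    rw [mvfderiv_mlieBracket hf.self_of_nhds, hconst ((hb Y).mono fun _ h ↦ h.1),
      hconst ((hZ Z).mono fun _ h ↦ h.1)]
    simp
  have hbτ : ∀ Z : (h.foliation 0).tangentFields, ∀ Y : SmoothVectorField I M,
      mvfderiv I τ x (VectorField.mlieBracket I Z.1 (h.bumpField Y) x) =
        -κ⁻¹ * (r (τ x) * mvfderiv I (fun y ↦ mvfderiv I g y (Y y)) x (Z.1 x)) := by
    intro Z Y
    have e : mvfderiv I (fun y ↦ r (τ y) * mvfderiv I g y (Y y)) x = _ :=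
      mvfderiv_mul (hτ.comp hr).mdifferentiableAt (hg.apply Y).mdifferentiableAt
    rw [mvfderiv_mlieBracket hτ.self_of_nhds, mvfderiv_congr ((hb Y).mono fun _ h ↦ h.2),
      mvfderiv_const_mul _ ((hτ.comp hr).mul (hg.apply Y)).mdifferentiableAt,
      hconst ((hZ Z).mono fun _ h ↦ h.2), e, mvfderiv_comp_real hr hτ.mdifferentiableAt]
    change -κ⁻¹ * (r (τ x) * mvfderiv I (fun y ↦ mvfderiv I g y (Y y)) x (Z.1 x) + mvfderiv I g x (Y x) *
      (deriv r (τ x) * mvfderiv I τ x (Z.1 x))) - 0 = _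
    rw [(hZ Z).self_of_nhds.2]
    ring
  have h0 : c x ≠ 0 ∧ _ := hloc.self_of_nhds
  obtain ⟨hc, h1, h2, h3⟩ := h0
  change VectorField.mlieBracket I V.1 (h.bumpField W.1) x -
    VectorField.mlieBracket I W.1 (h.bumpField V.1) x - h.bumpField (V.1.bracket W.1) x ∈
    distribution θ₁ θ₂ B 0 x
  rw [mem_distribution, zero_mul, add_zero, h1, h2]
  constructor
  · have e : mvfderiv I f x (VectorField.mlieBracket I V.1 (h.bumpField W.1) x -
        VectorField.mlieBracket I W.1 (h.bumpField V.1) x -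
        h.bumpField (V.1.bracket W.1) x) = 0 := by
      rw [map_sub, map_sub, hbf, hbf, (hb _).self_of_nhds.1, sub_zero, sub_zero]
    exact mul_eq_zero.2 (Or.inr e)
  · have e : mvfderiv I τ x (VectorField.mlieBracket I V.1 (h.bumpField W.1) x -
        VectorField.mlieBracket I W.1 (h.bumpField V.1) x -
        h.bumpField (V.1.bracket W.1) x) = 0 := by
      have e : mvfderiv I g x (V.1.bracket W.1 x) = _ :=
        mvfderiv_mlieBracket hg.self_of_nhds V.1 W.1
      rw [map_sub, map_sub, hbτ, hbτ, (hb _).self_of_nhds.2, e]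
      ring
    exact mul_eq_zero.2 (Or.inr e)

/-- If the infinitesimal deformation is a coboundary then `-κ⁻¹ B` has a leafwise primitive. -/
lemma exists_leafwise_primitive_of_mem_normalCoboundaries (h : DefiningForms θ₁ θ₂ B κ T)
    (hη : (⟨h.normalForm, h.normalForm_mem_normalCocycles⟩ : (h.foliation 0).normalCocycles) ∈
      (h.foliation 0).normalCoboundaries) :
    ∃ b : M → ℝ, (∀ x, SmoothNear I b x) ∧ ∀ p v, θ₁ p v = 0 → θ₂ p v = 0 →
      mvfderiv I b p v = -κ⁻¹ * B p v := by
  have : CompleteSpace E := FiniteDimensional.complete ℝ E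
  obtain ⟨⟨_, Y, rfl⟩, hs⟩ := hη
  have hκ := h.ne_zero
  have hb : ∀ {τ : M → ℝ} {x}, (∀ᶠ p in 𝓝 x, θ₂ p = κ • mvfderiv I τ p) →
      (fun p ↦ κ⁻¹ * θ₂ p (Y p)) =ᶠ[𝓝 x] fun p ↦ mvfderiv I τ p (Y p) := by
    intro τ x hx
    filter_upwards [hx] with y hy
    rw [hy]
    exact inv_mul_cancel_left₀ hκ _
  refine ⟨fun p ↦ κ⁻¹ * θ₂ p (Y p), fun x ↦ ?_, fun p v hv1 hv2 ↦ ?_⟩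
  · obtain ⟨f, τ, g, c, r, hr, hf, hτ, hg, hloc⟩ := h.exists_local x
    exact (hτ.apply Y).congr (hb (hloc.mono fun p hp ↦ hp.2.2.1))
  · obtain ⟨f, τ, g, c, r, hr, hf, hτ, hg, hloc⟩ := h.exists_local p
    obtain ⟨V, rfl⟩ := (h.foliation 0).exists_tangentField_apply_eq (p := p) (v := v)
      ⟨hv1, by rw [hv2, zero_mul, add_zero]⟩
    have h1 := hs V
    rw [applyField_normalForm, Foliation.bott_toNormal] at h1
    have h2 : (h.foliation 0).normalProj p (h.bumpField V.1 p) =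
      (h.foliation 0).normalProj p (V.1.bracket Y p) := congrFun (congrArg Subtype.val h1) p
    rw [← sub_eq_zero, ← map_sub, Foliation.normalProj_eq_zero_iff] at h2
    have h3 := (mem_distribution.1 h2).2
    have h4 : θ₂ p (h.bumpField V.1 p) = -B p (V.1 p) := by
      change θ₂ p ((-κ⁻¹ * B p (V.1 p)) • T p) = _
      rw [map_smul, h.form₂_field, smul_eq_mul]
      field_simp
    have h5 : mvfderiv I τ p (V.1.bracket Y p) = _ :=
      mvfderiv_mlieBracket hτ.self_of_nhds V.1 Y
    have h6 : mvfderiv I (fun y ↦ mvfderiv I τ y (V.1 y)) p = 0 := by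
      rw [mvfderiv_congr (g := fun _ ↦ (0 : ℝ)), mvfderiv_const]
      filter_upwards [hloc] with y ⟨_, _, h2, _⟩
      have := (mem_distribution.1 (V.2 y)).2
      rw [h2, zero_mul, add_zero] at this
      exact (mul_eq_zero.1 this).resolve_left hκ
    have h7 : θ₂ p (V.1.bracket Y p) = κ * mvfderiv I τ p (V.1.bracket Y p) := by
      rw [hloc.self_of_nhds.2.2.1]
      rfl
    rw [zero_mul, add_zero, map_sub, h4, h7, h5, h6] at h3
    rw [mvfderiv_congr (hb (hloc.mono fun p hp ↦ hp.2.2.1))]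
    change -B p (V.1 p) -
      κ * (mvfderiv I (fun y ↦ mvfderiv I τ y (Y y)) p (V.1 p) - 0) = 0 at h3
    field_simp
    linarith

lemma exists_cocycle (h : DefiningForms θ₁ θ₂ B κ T) {μ : ℝ} (hμ : μ = -κ⁻¹)
    {D : ∀ p : M, TangentSpace I p} (hD : ∀ p, D p = T p)
    (hprim : ∀ b : M → ℝ, (∀ x, SmoothNear I b x) →
      ¬ ∀ p v, θ₁ p v = 0 → θ₂ p v = 0 → mvfderiv I b p v = -κ⁻¹ * B p v) :
    ∃ η : (h.foliation 0).normalCocycles,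
      (∀ p (v : (h.foliation 0).tangent p), η.1.1 p v =
        (μ * B p v) • (h.foliation 0).normalProj p (D p)) ∧
      (h.foliation 0).IsInfinitesimalDeformation h.foliation η.1 ∧
      (Submodule.Quotient.mk η : (h.foliation 0).NormalH1) ≠ 0 := by
  refine ⟨⟨h.normalForm, h.normalForm_mem_normalCocycles⟩,
    fun p v ↦ by rw [hD, hμ, normalForm_apply],
    h.isInfinitesimalDeformation, fun hzero ↦ ?_⟩
  obtain ⟨b, hb, hbB⟩ := h.exists_leafwise_primitive_of_mem_normalCoboundaries
    ((Submodule.Quotient.mk_eq_zero _).1 hzero)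
  exact hprim b hb hbB

end DefiningForms
end InfinitesimalDeformation

section Isotopies

lemma contDiffAt_fderiv_prodMk_left {E : Type*} [NormedAddCommGroup E] [NormedSpace ℝ E]
    {U : ℝ × E → ℝ} {s : ℝ} {y : E} (hU : ContDiffAt ℝ ∞ U (s, y)) (w : ℝ × E) :
    ContDiffAt ℝ ∞ (fun y ↦ fderiv ℝ U (s, y) w) y := by
  have h1 : ContDiffAt ℝ ∞ (fderiv ℝ U) (s, y) := hU.fderiv_right (by simp)
  have h2 : ContDiffAt ℝ ∞ (fun y : E ↦ (s, y)) y := contDiffAt_const.prodMk contDiffAt_id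
  exact (ContDiffAt.comp y h1 h2).clm_apply contDiffAt_const

/-- Mixed second derivatives commute. -/
lemma hasDerivAt_fderiv_prodMk {E : Type*} [NormedAddCommGroup E] [NormedSpace ℝ E]
    {U : ℝ × E → ℝ} {s : ℝ} {y : E} (hU : ContDiffAt ℝ ∞ U (s, y)) (v : E) :
    HasDerivAt (fun t ↦ fderiv ℝ U (t, y) (0, v))
      (fderiv ℝ (fun y ↦ fderiv ℝ U (s, y) (1, 0)) y v) s := by
  have h1 : HasFDerivAt (fderiv ℝ U) (fderiv ℝ (fderiv ℝ U) (s, y)) (s, y) :=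
    ((hU.fderiv_right (m := 1) (by norm_cast)).differentiableAt (by simp)).hasFDerivAt
  have hsymm : IsSymmSndFDerivAt ℝ U (s, y) :=
    hU.isSymmSndFDerivAt (by
      rw [minSmoothness_of_isRCLikeNormedField]
      exact WithTop.coe_le_coe.2 (le_top : (2 : ℕ∞) ≤ ⊤))
  have h2 : HasDerivAt (fun t ↦ fderiv ℝ U (t, y)) (fderiv ℝ (fderiv ℝ U) (s, y) (1, 0)) s :=
    h1.comp_hasDerivAt s ((hasDerivAt_id s).prodMk (hasDerivAt_const s y))
  have h3 : HasFDerivAt (fun y ↦ fderiv ℝ U (s, y))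
      ((fderiv ℝ (fderiv ℝ U) (s, y)).comp (ContinuousLinearMap.inr ℝ ℝ E)) y :=
    h1.comp y (hasFDerivAt_prodMk_right s y)
  have h4 := (h3.clm_apply (hasFDerivAt_const (1, 0) y)).fderiv
  rw [h4]
  have h5 := h2.clm_apply (hasDerivAt_const s (0, v))
  refine h5.congr_deriv ?_
  simp [hsymm.eq (1, 0) (0, v)]

variable {E : Type*} [NormedAddCommGroup E] [NormedSpace ℝ E] [FiniteDimensional ℝ E]
  {H : Type*} [TopologicalSpace H] {I : ModelWithCorners ℝ E H} [I.Boundaryless]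
  {M : Type*} [TopologicalSpace M] [ChartedSpace H M] [IsManifold I ∞ M] [T2Space M]

lemma eventually_contDiffAt_comp_isotopy {Φ : ℝ → M → M} {ε : ℝ} (hε : 0 < ε)
    (h0 : ∀ x, Φ 0 x = x) (hΦ : ContMDiffOn (𝓘(ℝ, ℝ).prod I) I ∞ (fun p : ℝ × M ↦ Φ p.1 p.2)
      (Ioo (-ε) ε ×ˢ univ)) {h : M → ℝ} {x₀ : M} (hh : SmoothNear I h x₀) :
    ∀ᶠ q in 𝓝 ((0 : ℝ), extChartAt I x₀ x₀),
      ContDiffAt ℝ ∞ (fun q : ℝ × E ↦ h (Φ q.1 ((extChartAt I x₀).symm q.2))) q := by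
  have hsm : ∀ q : ℝ × E, q.1 ∈ Ioo (-ε) ε → q.2 ∈ (extChartAt I x₀).target →
      ContMDiffAt 𝓘(ℝ, ℝ × E) I ∞ (fun q : ℝ × E ↦ Φ q.1 ((extChartAt I x₀).symm q.2)) q := by
    intro q h1 h2
    have e1 : ContMDiffAt (𝓘(ℝ, ℝ).prod I) I ∞ (fun p : ℝ × M ↦ Φ p.1 p.2)
        (q.1, (extChartAt I x₀).symm q.2) :=
      hΦ.contMDiffAt ((isOpen_Ioo.prod isOpen_univ).mem_nhds ⟨h1, mem_univ _⟩)
    have e2 : ContMDiffAt 𝓘(ℝ, ℝ × E) I ∞ (fun q : ℝ × E ↦ (extChartAt I x₀).symm q.2) q := by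
      have e3 : ContMDiffAt 𝓘(ℝ, E) I ∞ (extChartAt I x₀).symm q.2 :=
        (contMDiffOn_extChartAt_symm x₀).contMDiffAt ((isOpen_extChartAt_target x₀).mem_nhds h2)
      exact e3.comp q contDiff_snd.contMDiff.contMDiffAt
    have e4 : ContMDiffAt 𝓘(ℝ, ℝ × E) 𝓘(ℝ, ℝ) ∞ (fun q : ℝ × E ↦ q.1) q :=
      contDiff_fst.contMDiff.contMDiffAt
    exact ContMDiffAt.comp q e1 (e4.prodMk e2)
  have hx0 : (extChartAt I x₀).symm (extChartAt I x₀ x₀) = x₀ := extChartAt_to_inv x₀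
  have hc : Tendsto (fun q : ℝ × E ↦ Φ q.1 ((extChartAt I x₀).symm q.2))
      (𝓝 ((0 : ℝ), extChartAt I x₀ x₀)) (𝓝 x₀) := by
    have := (hsm (0, extChartAt I x₀ x₀) ⟨by simpa using hε, by simpa using hε⟩
      (mem_extChartAt_target x₀)).continuousAt
    rw [ContinuousAt, hx0, h0] at this
    exact this
  filter_upwards [hc.eventually hh,
    (isOpen_Ioo.preimage continuous_fst).mem_nhds
      (show ((0 : ℝ), extChartAt I x₀ x₀) ∈ Prod.fst ⁻¹' Ioo (-ε) ε from
        ⟨by simpa using hε, by simpa using hε⟩),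
    ((isOpen_extChartAt_target (I := I) x₀).preimage continuous_snd).mem_nhds
      (show ((0 : ℝ), extChartAt I x₀ x₀) ∈ Prod.snd ⁻¹' (extChartAt I x₀).target from
        mem_extChartAt_target x₀)] with q h1 h2 h3
  exact contMDiffAt_iff_contDiffAt.1 (ContMDiffAt.comp q h1 (hsm q h2 h3))

lemma eventually_mvfderiv_isotopy {Φ : ℝ → M → M} {ε : ℝ} (hε : 0 < ε)
    (h0 : ∀ x, Φ 0 x = x) (hΦ : ContMDiffOn (𝓘(ℝ, ℝ).prod I) I ∞ (fun p : ℝ × M ↦ Φ p.1 p.2)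
      (Ioo (-ε) ε ×ˢ univ)) {h : M → ℝ} {x₀ : M} (hh : SmoothNear I h x₀)
    (v : TangentSpace I x₀) :
    ∀ᶠ s in 𝓝 (0 : ℝ), mvfderiv I h (Φ s x₀) (mfderiv I I (Φ s) x₀ v) =
      fderiv ℝ (fun q : ℝ × E ↦ h (Φ q.1 ((extChartAt I x₀).symm q.2)))
        (s, extChartAt I x₀ x₀) (0, mfderiv I 𝓘(ℝ, E) (extChartAt I x₀) x₀ v) := by
  have h1 := eventually_contDiffAt_comp_isotopy hε h0 hΦ hh
  have hc : Tendsto (fun s : ℝ ↦ (s, extChartAt I x₀ x₀)) (𝓝 0)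
      (𝓝 ((0 : ℝ), extChartAt I x₀ x₀)) := by
    have : Continuous fun s : ℝ ↦ (s, extChartAt I x₀ x₀) := by fun_prop
    exact this.tendsto 0
  have hsm : ∀ s ∈ Ioo (-ε) ε, ContMDiffAt (𝓘(ℝ, ℝ).prod I) I ∞ (fun p : ℝ × M ↦ Φ p.1 p.2)
      (s, x₀) := fun s hs ↦
    hΦ.contMDiffAt ((isOpen_Ioo.prod isOpen_univ).mem_nhds ⟨hs, mem_univ _⟩)
  have hε0 : (0 : ℝ) ∈ Ioo (-ε) ε := ⟨by simpa using hε, hε⟩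
  have hc2 : Tendsto (fun s : ℝ ↦ Φ s x₀) (𝓝 0) (𝓝 x₀) := by
    have e1 : Continuous fun s : ℝ ↦ (s, x₀) := by fun_prop
    have e2 : ContinuousAt (fun s : ℝ ↦ Φ s x₀) 0 :=
      ContinuousAt.comp (g := fun p : ℝ × M ↦ Φ p.1 p.2) (f := fun s : ℝ ↦ (s, x₀))
        (hsm 0 hε0).continuousAt e1.continuousAt
    rw [ContinuousAt, h0] at e2
    exact e2
  filter_upwards [hc.eventually h1, hc2.eventually hh, isOpen_Ioo.mem_nhds hε0] with s h1 h2 hs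
  have h3 : MDifferentiableAt I I (Φ s) x₀ := by
    have e1 : ContMDiffAt I (𝓘(ℝ, ℝ).prod I) ∞ (fun x : M ↦ (s, x)) x₀ :=
      contMDiffAt_const.prodMk contMDiffAt_id
    exact (ContMDiffAt.comp x₀ (hsm s hs) e1).mdifferentiableAt (by simp)
  have h4 := h2.mdifferentiableAt (by simp)
  have h5 : mvfderiv I (h ∘ Φ s) x₀ v = mvfderiv I h (Φ s x₀) (mfderiv I I (Φ s) x₀ v) :=
    congrArg (fun L ↦ L v) (mvfderiv_comp x₀ h4 h3)
  rw [← h5, mvfderiv_eq_fderiv_extChartAt (mem_extChartAt_source x₀) (h4.comp x₀ h3)]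
  have h6 := (h1.differentiableAt (by simp)).hasFDerivAt.comp (extChartAt I x₀ x₀)
    (hasFDerivAt_prodMk_right s (extChartAt I x₀ x₀))
  have h7 : fderiv ℝ ((h ∘ Φ s) ∘ (extChartAt I x₀).symm) (extChartAt I x₀ x₀) = _ := h6.fderiv
  rw [h7]
  rfl

/-- If the path of foliations is generated by an isotopy then `-κ⁻¹ B` has a leafwise
primitive. -/
lemma DefiningForms.exists_leafwise_primitive_of_isGeneratedByIsotopy
    {θ₁ θ₂ B : ∀ p : M, TangentSpace I p →L[ℝ] ℝ} {κ : ℝ} {T : SmoothVectorField I M}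
    (h : DefiningForms θ₁ θ₂ B κ T)
    (hiso : (h.foliation 0).IsGeneratedByIsotopy h.foliation) :
    ∃ b : M → ℝ, (∀ x, SmoothNear I b x) ∧ ∀ p v, θ₁ p v = 0 → θ₂ p v = 0 →
      mvfderiv I b p v = -κ⁻¹ * B p v := by
  obtain ⟨ε, hε, Ψ, h0, hΨ, hT⟩ := hiso
  have hκ := h.ne_zero
  let Φ : ℝ → M → M := fun s ↦ Ψ s
  have h0 : ∀ x, Φ 0 x = x := h0
  have hΦ : ContMDiffOn (𝓘(ℝ, ℝ).prod I) I ∞ (fun p : ℝ × M ↦ Φ p.1 p.2)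
    (Ioo (-ε) ε ×ˢ univ) := hΨ
  have hε0 : (0 : ℝ) ∈ Ioo (-ε) ε := ⟨by simpa using hε, hε⟩
  have hsm : ∀ x, ContMDiffAt 𝓘(ℝ, ℝ) I ∞ (fun s ↦ Φ s x) 0 := by
    intro x
    have e1 : ContMDiffAt (𝓘(ℝ, ℝ).prod I) I ∞ (fun p : ℝ × M ↦ Φ p.1 p.2) (0, x) :=
      hΦ.contMDiffAt ((isOpen_Ioo.prod isOpen_univ).mem_nhds ⟨hε0, mem_univ _⟩)
    have e2 : ContMDiffAt 𝓘(ℝ, ℝ) (𝓘(ℝ, ℝ).prod I) ∞ (fun s : ℝ ↦ (s, x)) 0 :=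
      contMDiffAt_id.prodMk contMDiffAt_const
    exact ContMDiffAt.comp 0 e1 e2
  let b : M → ℝ := fun x ↦
    κ⁻¹ * θ₂ (Φ 0 x) (mfderiv 𝓘(ℝ, ℝ) I (fun s ↦ Φ s x) 0 (1 : ℝ))
  have hb : ∀ x₀ (τ : M → ℝ), SmoothNear I τ x₀ →
      (∀ᶠ p in 𝓝 x₀, θ₂ p = κ • mvfderiv I τ p) →
      ∀ᶠ x in 𝓝 x₀, b x = fderiv ℝ
        (fun q : ℝ × E ↦ τ (Φ q.1 ((extChartAt I x₀).symm q.2))) (0, extChartAt I x₀ x) (1, 0) := by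
    intro x₀ τ hτ hθ
    have hc : Tendsto (fun x ↦ ((0 : ℝ), extChartAt I x₀ x)) (𝓝 x₀)
        (𝓝 ((0 : ℝ), extChartAt I x₀ x₀)) :=
      tendsto_const_nhds.prodMk_nhds (continuousAt_extChartAt x₀)
    filter_upwards [hτ, hθ, hc.eventually (eventually_contDiffAt_comp_isotopy hε h0 hΦ hτ),
      extChartAt_source_mem_nhds (I := I) x₀] with x h1 h2 h3 hx
    have e1 := mvfderiv_comp (I' := 𝓘(ℝ, ℝ)) (I := I) (g := τ) (f := fun s ↦ Φ s x) (0 : ℝ)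
      (by rw [h0]; exact h1.mdifferentiableAt (by simp)) ((hsm x).mdifferentiableAt (by simp))
    have e2 : HasDerivAt (fun s : ℝ ↦ (s, extChartAt I x₀ x)) (1, 0) 0 :=
      (hasDerivAt_id (0 : ℝ)).prodMk (hasDerivAt_const _ _)
    have e3 := (h3.differentiableAt (by simp)).hasFDerivAt.comp_hasDerivAt 0 e2
    have e4 : (fun q : ℝ × E ↦ τ (Φ q.1 ((extChartAt I x₀).symm q.2))) ∘
        (fun s : ℝ ↦ (s, extChartAt I x₀ x)) = τ ∘ fun s ↦ Φ s x := by
      funext s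
      exact congrArg (fun z ↦ τ (Φ s z)) ((extChartAt I x₀).left_inv hx)
    rw [e4] at e3
    have e5 : b x = κ⁻¹ * (κ * mvfderiv I τ (Φ 0 x)
        (mfderiv 𝓘(ℝ, ℝ) I (fun s ↦ Φ s x) 0 (1 : ℝ))) := by
      have : θ₂ (Φ 0 x) = κ • mvfderiv I τ (Φ 0 x) := by rw [h0]; exact h2
      simp only [b, this]
      rfl
    rw [e5, inv_mul_cancel_left₀ hκ, ← e3.deriv]
    have e6 : mvfderiv 𝓘(ℝ, ℝ) (τ ∘ fun s ↦ Φ s x) 0 (1 : ℝ) = _ := congrArg (fun L ↦ L (1 : ℝ)) e1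
    refine Eq.trans e6.symm ?_
    change mfderiv 𝓘(ℝ, ℝ) 𝓘(ℝ, ℝ) (τ ∘ fun s ↦ Φ s x) 0 (1 : ℝ) = _
    rw [mfderiv_eq_fderiv]
    exact fderiv_apply_one_eq_deriv
  refine ⟨b, fun x ↦ ?_, fun p v hv1 hv2 ↦ ?_⟩
  · obtain ⟨f, τ, g, c, r, hr, hf, hτ, hg, hloc⟩ := h.exists_local x
    have hc : Tendsto (fun z ↦ ((0 : ℝ), extChartAt I x z)) (𝓝 x)
        (𝓝 ((0 : ℝ), extChartAt I x x)) :=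
      tendsto_const_nhds.prodMk_nhds (continuousAt_extChartAt x)
    filter_upwards [(hb x τ hτ (hloc.mono fun _ h ↦ h.2.2.1)).eventually_nhds,
      hc.eventually (eventually_contDiffAt_comp_isotopy hε h0 hΦ hτ),
      extChartAt_source_mem_nhds (I := I) x] with z h1 h2 h3
    have e1 := (contDiffAt_fderiv_prodMk_left h2 (1, 0)).contMDiffAt.comp z
      (contMDiffAt_extChartAt' (I := I) (n := ∞) (by rwa [extChartAt_source] at h3))
    exact e1.congr_of_eventuallyEq h1
  · obtain ⟨f, τ, g, c, r, hr, hf, hτ, hg, hloc⟩ := h.exists_local p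
    set y₀ := extChartAt I p p with hy₀
    set Uτ : ℝ × E → ℝ := fun q ↦ τ (Φ q.1 ((extChartAt I p).symm q.2)) with hUτ
    set Ug : ℝ × E → ℝ := fun q ↦ g (Φ q.1 ((extChartAt I p).symm q.2)) with hUg
    set v' : E := mfderiv I 𝓘(ℝ, E) (extChartAt I p) p v with hv'
    have h1 : ContDiffAt ℝ ∞ Uτ (0, y₀) :=
      (eventually_contDiffAt_comp_isotopy hε h0 hΦ hτ).self_of_nhds
    have h2 : ContDiffAt ℝ ∞ Ug (0, y₀) :=
      (eventually_contDiffAt_comp_isotopy hε h0 hΦ hg).self_of_nhds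
    have h3 : mvfderiv I b p v = fderiv ℝ (fun y ↦ fderiv ℝ Uτ (0, y) (1, 0)) y₀ v' := by
      have e1 := (hb p τ hτ (hloc.mono fun _ h ↦ h.2.2.1))
      have e2 : DifferentiableAt ℝ (fun y ↦ fderiv ℝ Uτ (0, y) (1, 0)) y₀ :=
        (contDiffAt_fderiv_prodMk_left h1 (1, 0)).differentiableAt (by simp)
      rw [mvfderiv_congr e1]
      have e3 : mvfderiv I ((fun y ↦ fderiv ℝ Uτ (0, y) (1, 0)) ∘ extChartAt I p) p v = _ :=
        congrArg (fun L ↦ L v) (mvfderiv_comp (I' := I) (I := 𝓘(ℝ, E)) (f := extChartAt I p) p e2.mdifferentiableAt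
          (mdifferentiableAt_extChartAt (mem_chart_source H p)))
      refine e3.trans ?_
      change mfderiv 𝓘(ℝ, E) 𝓘(ℝ, ℝ) _ _ _ = _
      rw [mfderiv_eq_fderiv]
      rfl
    have h4 := hasDerivAt_fderiv_prodMk h1 v'
    have h5 := hasDerivAt_fderiv_prodMk h2 v'
    have hcτ : ContinuousAt (fun s ↦ r (Uτ (s, y₀))) 0 := by
      have e1 : ContinuousAt (fun s : ℝ ↦ (s, y₀)) 0 := by fun_prop
      exact hr.continuous.continuousAt.comp (ContinuousAt.comp (g := Uτ) h1.continuousAt e1)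
    have hG : HasDerivAt (fun s ↦ s * (r (Uτ (s, y₀)) * fderiv ℝ Ug (s, y₀) (0, v')))
        (r (Uτ (0, y₀)) * fderiv ℝ Ug (0, y₀) (0, v')) 0 := by
      rw [hasDerivAt_iff_tendsto_slope]
      have e1 := (hcτ.mul h5.continuousAt).tendsto
      refine (e1.mono_left nhdsWithin_le_nhds).congr' ?_
      filter_upwards [self_mem_nhdsWithin] with s hs
      have hs : s ≠ 0 := hs
      simp only [slope_def_field, zero_mul, sub_zero]
      field_simp
      rfl
    have h6 : (fun s ↦ κ * fderiv ℝ Uτ (s, y₀) (0, v') +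
        s * (r (Uτ (s, y₀)) * fderiv ℝ Ug (s, y₀) (0, v'))) =ᶠ[𝓝 0] fun _ ↦ 0 := by
      have hc2 : Tendsto (fun s : ℝ ↦ Φ s p) (𝓝 0) (𝓝 p) := by
        have := (hsm p).continuousAt
        rw [ContinuousAt, h0] at this
        exact this
      filter_upwards [eventually_mvfderiv_isotopy hε h0 hΦ hτ v,
        eventually_mvfderiv_isotopy hε h0 hΦ hg v, hc2.eventually hloc,
        isOpen_Ioo.mem_nhds hε0] with s e1 e2 e3 hs
      have e4 : mfderiv I I (Φ s) p v ∈ (h.foliation s).tangent (Φ s p) := by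
        have e5 := hT s hs p
        change (h.foliation s).tangent (Φ s p) = _ at e5
        rw [e5]
        exact Submodule.mem_map_of_mem ⟨hv1, by rw [hv2, zero_mul, add_zero]⟩
      have e5 := e4.2
      rw [e3.2.2.1, e3.2.2.2] at e5
      have e6 : κ * mvfderiv I τ (Φ s p) (mfderiv I I (Φ s) p v) + s * (r (τ (Φ s p)) *
        mvfderiv I g (Φ s p) (mfderiv I I (Φ s) p v)) = 0 := e5
      rw [e1, e2] at e6
      have e7 : Uτ (s, y₀) = τ (Φ s p) :=
        congrArg (fun z ↦ τ (Φ s z)) ((extChartAt I p).left_inv (mem_extChartAt_source p))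
      rw [e7]
      exact e6
    have h7 := ((h4.const_mul κ).add hG).unique ((hasDerivAt_const (0 : ℝ) (0 : ℝ)).congr_of_eventuallyEq h6)
    have h8 : Uτ (0, y₀) = τ p := by
      have e7 : Uτ (0, y₀) = τ (Φ 0 p) :=
        congrArg (fun z ↦ τ (Φ 0 z)) ((extChartAt I p).left_inv (mem_extChartAt_source p))
      rw [e7, h0]
    have h9 : fderiv ℝ Ug (0, y₀) (0, v') = mvfderiv I g p v := by
      have e1 : Φ 0 = id := funext h0
      have e2 := (eventually_mvfderiv_isotopy hε h0 hΦ hg v).self_of_nhds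
      rw [← e2, e1, mfderiv_id]
      rfl
    have h10 : B p v = r (τ p) * mvfderiv I g p v := by
      rw [hloc.self_of_nhds.2.2.2]
      rfl
    rw [h3, h10]
    rw [h8, h9] at h7
    field_simp
    linarith

end Isotopies

section ModelForms

lemma covectorPullback_congr {E : Type*} [NormedAddCommGroup E] [NormedSpace ℝ E]
    {H : Type*} [TopologicalSpace H] {I : ModelWithCorners ℝ E H}
    {M : Type*} [TopologicalSpace M] [ChartedSpace H M]
    {E' H' M' : Type*} [NormedAddCommGroup E'] [NormedSpace ℝ E']
    [TopologicalSpace H'] [TopologicalSpace M'] [ChartedSpace H' M']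
    {I' : ModelWithCorners ℝ E' H'} {f g : M → M'} {x : M} (h : f =ᶠ[𝓝 x] g)
    (θ : ∀ y : M', TangentSpace I' y →L[ℝ] ℝ) :
    covectorPullback I I' f θ x = covectorPullback I I' g θ x := by
  have h1 : ∀ (y y' : M') (_ : y = y') (v : E'),
      (θ y : E' →L[ℝ] ℝ) v = (θ y' : E' →L[ℝ] ℝ) v := by
    rintro y _ rfl v
    rfl
  ext v
  refine (h1 _ _ h.self_of_nhds _).trans ?_
  exact congrArg (fun L : E →L[ℝ] E' ↦ (θ (g x) : E' →L[ℝ] ℝ) (L v)) h.mfderiv_eq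

namespace MappingTorus

variable {E : Type*} [NormedAddCommGroup E] [NormedSpace ℝ E] [FiniteDimensional ℝ E]
  {H : Type*} [TopologicalSpace H] {I : ModelWithCorners ℝ E H} [I.Boundaryless]
  {L : Type*} [TopologicalSpace L] [ChartedSpace H L] [IsManifold I ∞ L] [T2Space L]
  [CompactSpace L]

lemma localInverseAt_mdifferentiableAt (φ : L ≃ₘ⟮I, I⟯ L) (z : L × ℝ) {p : MappingTorus φ}
    (hp : p ∈ ((isLocalHomeomorph_proj φ).localInverseAt z).source) :
    MDifferentiableAt (I.prod 𝓘(ℝ, ℝ)) (I.prod 𝓘(ℝ, ℝ))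
      ((isLocalHomeomorph_proj φ).localInverseAt z) p :=
  ((contMDiffOn_localInverseAt φ z).contMDiffAt
    (((isLocalHomeomorph_proj φ).localInverseAt z).open_source.mem_nhds hp)).mdifferentiableAt
    (by simp)

/-- A one-form on the mapping torus, recovered from its pullback to `L × ℝ`. -/
lemma eq_covectorPullback_localInverseAt (φ : L ≃ₘ⟮I, I⟯ L) (z : L × ℝ) {p : MappingTorus φ}
    (hp : p ∈ ((isLocalHomeomorph_proj φ).localInverseAt z).source)
    (θ : ∀ p : MappingTorus φ, TangentSpace (I.prod 𝓘(ℝ, ℝ)) p →L[ℝ] ℝ) :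
    θ p = covectorPullback (I.prod 𝓘(ℝ, ℝ)) (I.prod 𝓘(ℝ, ℝ))
      ((isLocalHomeomorph_proj φ).localInverseAt z)
      (covectorPullback (I.prod 𝓘(ℝ, ℝ)) (I.prod 𝓘(ℝ, ℝ)) (proj φ) θ) p := by
  set S := (isLocalHomeomorph_proj φ).localInverseAt z with hS
  have h1 : proj φ ∘ S =ᶠ[𝓝 p] id := by
    filter_upwards [S.open_source.mem_nhds hp] with q hq
    exact (isLocalHomeomorph_proj φ).apply_localInverseAt_of_mem hq
  have h2 := mfderiv_comp p ((contMDiff_proj φ (S p)).mdifferentiableAt (by simp))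
    (localInverseAt_mdifferentiableAt φ z hp)
  have h3 := covectorPullback_congr (I := I.prod 𝓘(ℝ, ℝ)) (I' := I.prod 𝓘(ℝ, ℝ)) h1 θ
  have h4 : covectorPullback (I.prod 𝓘(ℝ, ℝ)) (I.prod 𝓘(ℝ, ℝ)) id θ p = θ p := by
    simp only [covectorPullback, mfderiv_id]
    rfl
  rw [← h4, ← h3, covectorPullback, h2]
  rfl

lemma mvfderiv_comp_localInverseAt (φ : L ≃ₘ⟮I, I⟯ L) (z : L × ℝ) {p : MappingTorus φ}
    (hp : p ∈ ((isLocalHomeomorph_proj φ).localInverseAt z).source) {k : L × ℝ → ℝ}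
    (hk : MDifferentiableAt (I.prod 𝓘(ℝ, ℝ)) 𝓘(ℝ, ℝ) k
      ((isLocalHomeomorph_proj φ).localInverseAt z p)) :
    mvfderiv (I.prod 𝓘(ℝ, ℝ)) (k ∘ (isLocalHomeomorph_proj φ).localInverseAt z) p =
      covectorPullback (I.prod 𝓘(ℝ, ℝ)) (I.prod 𝓘(ℝ, ℝ))
        ((isLocalHomeomorph_proj φ).localInverseAt z)
        (fun w ↦ mvfderiv (I.prod 𝓘(ℝ, ℝ)) k w) p :=
  mvfderiv_comp p hk (localInverseAt_mdifferentiableAt φ z hp)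

/-- `descend φ θ` pulls back to `θ` on the fundamental domain. -/
lemma pullback_descend_of_mem (φ : L ≃ₘ⟮I, I⟯ L)
    (θ : ∀ z : L × ℝ, TangentSpace (I.prod 𝓘(ℝ, ℝ)) z →L[ℝ] ℝ) {z : L × ℝ}
    (hz : z.2 ∈ Ico (0 : ℝ) 1) :
    covectorPullback (I.prod 𝓘(ℝ, ℝ)) (I.prod 𝓘(ℝ, ℝ)) (proj φ) (descend φ θ) z = θ z := by
  have hr : rep φ (proj φ z) = z :=
    (existsUnique_rep φ (proj φ z)).unique (existsUnique_rep φ (proj φ z)).choose_spec.1 ⟨rfl, hz⟩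
  have hinv : (mfderiv (I.prod 𝓘(ℝ, ℝ)) (I.prod 𝓘(ℝ, ℝ)) (proj φ) z).IsInvertible :=
    ⟨(isLocalDiffeomorph_proj φ z).mfderivToContinuousLinearEquiv (by simp),
      IsLocalDiffeomorphAt.mfderivToContinuousLinearEquiv_coe _ _⟩
  ext v
  simp only [covectorPullback, descend, ContinuousLinearMap.comp_apply]
  rw [hr]
  exact congrArg (θ z) (hinv.inverse_apply_eq.2 rfl)

lemma descend_eq_zero (φ : L ≃ₘ⟮I, I⟯ L)
    (θ : ∀ z : L × ℝ, TangentSpace (I.prod 𝓘(ℝ, ℝ)) z →L[ℝ] ℝ) {p : MappingTorus φ}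
    (h : θ (rep φ p) = 0) : descend φ θ p = 0 := by
  ext v
  simp only [descend, h]
  rfl

lemma descend_ddt (φ : L ≃ₘ⟮I, I⟯ L)
    (θ : ∀ z : L × ℝ, TangentSpace (I.prod 𝓘(ℝ, ℝ)) z →L[ℝ] ℝ) (p : MappingTorus φ) :
    descend φ θ p (ddt φ p) = θ (rep φ p) ((0, 1) : E × ℝ) := by
  have hinv : (mfderiv (I.prod 𝓘(ℝ, ℝ)) (I.prod 𝓘(ℝ, ℝ)) (proj φ) (rep φ p)).IsInvertible :=
    ⟨(isLocalDiffeomorph_proj φ _).mfderivToContinuousLinearEquiv (by simp),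
      IsLocalDiffeomorphAt.mfderivToContinuousLinearEquiv_coe _ _⟩
  have h1 := mfderiv_comp (I := 𝓘(ℝ, ℝ)) (f := fun τ : ℝ ↦ ((rep φ p).1, τ)) (rep φ p).2
    ((contMDiff_proj φ _).mdifferentiableAt (by simp))
    (mdifferentiableAt_const.prodMk mdifferentiableAt_id)
  rw [mfderiv_prod_right] at h1
  have h2 : ddt φ p = mfderiv (I.prod 𝓘(ℝ, ℝ)) (I.prod 𝓘(ℝ, ℝ)) (proj φ) (rep φ p)
      ((0, 1) : E × ℝ) := congrArg (fun A : ℝ →L[ℝ] E × ℝ ↦ A 1) h1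
  exact congrArg (θ (rep φ p)) (hinv.inverse_apply_eq.2 h2)

lemma mfderiv_prod_snd_apply (z : L × ℝ) (v : E × ℝ) :
    (mvfderiv (I.prod 𝓘(ℝ, ℝ)) (Prod.snd : L × ℝ → ℝ) z : E × ℝ →L[ℝ] ℝ) v = v.2 := by
  rw [mvfderiv, mfderiv_snd]
  rfl

lemma mfderiv_prod_fst_apply (z : L × ℝ) (v : E × ℝ) :
    (mfderiv (I.prod 𝓘(ℝ, ℝ)) I (Prod.fst : L × ℝ → L) z : E × ℝ →L[ℝ] E) v = v.1 := by
  rw [mfderiv_fst]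
  rfl

lemma ddt_proj (φ : L ≃ₘ⟮I, I⟯ L) (z : L × ℝ) :
    ddt φ (proj φ z) = mfderiv (I.prod 𝓘(ℝ, ℝ)) (I.prod 𝓘(ℝ, ℝ)) (proj φ) z
      ((0, 1) : E × ℝ) := by
  obtain ⟨n, hn⟩ := (proj_eq_iff φ).1 (proj_rep φ (proj φ z))
  have hd : ∀ w : L × ℝ, MDifferentiableAt 𝓘(ℝ, ℝ) (I.prod 𝓘(ℝ, ℝ))
      (fun τ : ℝ ↦ (w.1, τ)) w.2 := fun w ↦ mdifferentiableAt_const.prodMk mdifferentiableAt_id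
  have h1 : (fun τ : ℝ ↦ proj φ ((rep φ (proj φ z)).1, τ)) =
      (fun τ : ℝ ↦ proj φ (z.1, τ)) ∘ fun τ ↦ τ - n := by
    funext τ
    refine (proj_eq_iff φ).2 ⟨n, ?_⟩
    rw [← hn]
    exact Prod.ext rfl (sub_add_cancel τ (n : ℝ))
  have h2 : (rep φ (proj φ z)).2 - n = z.2 := by
    rw [← hn]
    exact add_sub_cancel_right z.2 (n : ℝ)
  have h3 : mfderiv 𝓘(ℝ, ℝ) 𝓘(ℝ, ℝ) (fun τ : ℝ ↦ τ - n) (rep φ (proj φ z)).2 =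
      ContinuousLinearMap.id ℝ ℝ := by
    rw [mfderiv_eq_fderiv]
    exact (hasFDerivAt_id _).sub_const (n : ℝ) |>.fderiv
  have h4 := mfderiv_comp_of_eq (I := 𝓘(ℝ, ℝ)) (x := (rep φ (proj φ z)).2) (y := z.2)
    (f := fun τ : ℝ ↦ τ - n) (g := fun τ : ℝ ↦ proj φ (z.1, τ))
    (((contMDiff_proj φ _).mdifferentiableAt (by simp)).comp z.2 (hd z))
    ((differentiableAt_id.sub_const (n : ℝ)).mdifferentiableAt) h2
  have h5 := mfderiv_comp (I := 𝓘(ℝ, ℝ)) (f := fun τ : ℝ ↦ (z.1, τ)) z.2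
    ((contMDiff_proj φ _).mdifferentiableAt (by simp)) (hd z)
  rw [mfderiv_prod_right] at h5
  rw [h3, ← h1] at h4
  have h7 : ∀ t t' : ℝ, t = t' →
      (mfderiv 𝓘(ℝ, ℝ) (I.prod 𝓘(ℝ, ℝ)) (fun τ : ℝ ↦ proj φ (z.1, τ)) t : ℝ →L[ℝ] E × ℝ) 1 =
      (mfderiv 𝓘(ℝ, ℝ) (I.prod 𝓘(ℝ, ℝ)) (fun τ : ℝ ↦ proj φ (z.1, τ)) t' : ℝ →L[ℝ] E × ℝ) 1 := by
    rintro t _ rfl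
    rfl
  have h6 : ddt φ (proj φ z) = mfderiv 𝓘(ℝ, ℝ) (I.prod 𝓘(ℝ, ℝ))
      (fun τ : ℝ ↦ proj φ (z.1, τ)) z.2 (1 : ℝ) :=
    (congrArg (fun A : ℝ →L[ℝ] E × ℝ ↦ A 1) h4).trans (h7 _ _ h2)
  rw [h6]
  exact congrArg (fun A : ℝ →L[ℝ] E × ℝ ↦ A 1) h5

lemma contMDiff_unit_field : ContMDiff (I.prod 𝓘(ℝ, ℝ)) (I.prod 𝓘(ℝ, ℝ)).tangent ∞
    (fun z : L × ℝ ↦ (⟨z, ((0, 1) : E × ℝ)⟩ : TangentBundle (I.prod 𝓘(ℝ, ℝ)) (L × ℝ))) := by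
  have : IsManifold I 1 L := IsManifold.of_le (n := ∞) (WithTop.coe_le_coe.2 le_top)
  have : IsManifold I (∞ + 1) L := by simpa
  have h1 : ContMDiff I I.tangent ∞ (fun x : L ↦ (⟨x, (0 : E)⟩ : TangentBundle I L)) :=
    contMDiff_zeroSection ℝ (TangentSpace I : L → Type _)
  have h2 : ContMDiff 𝓘(ℝ, ℝ) 𝓘(ℝ, ℝ).tangent ∞
      (fun x : ℝ ↦ (⟨x, (1 : ℝ)⟩ : TangentBundle 𝓘(ℝ, ℝ) ℝ)) :=
    fun x ↦ contMDiffAt_vectorSpace_iff_contDiffAt.2 contDiffAt_const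
  exact (contMDiff_equivTangentBundleProd_symm (n := ∞) (I := I) (I' := 𝓘(ℝ, ℝ)) (M := L)
    (M' := ℝ)).comp ((h1.comp contMDiff_fst).prodMk (h2.comp contMDiff_snd))

/-- The vector field `∂_t` is smooth. -/
def ddtField (φ : L ≃ₘ⟮I, I⟯ L) : SmoothVectorField (I.prod 𝓘(ℝ, ℝ)) (MappingTorus φ) where
  toFun := ddt φ
  contMDiff_toFun p := by
    obtain ⟨z, rfl⟩ := proj_surjective φ p
    have : IsManifold I 1 L := IsManifold.of_le (n := ∞) (WithTop.coe_le_coe.2 le_top)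
    have : IsManifold (I.prod 𝓘(ℝ, ℝ)) 1 (MappingTorus φ) :=
      IsManifold.of_le (n := ∞) (WithTop.coe_le_coe.2 le_top)
    set S := (isLocalHomeomorph_proj φ).localInverseAt z with hS
    have hp : proj φ z ∈ S.source :=
      (isLocalHomeomorph_proj φ).apply_self_mem_localInverseAt_source
    have h1 : ContMDiffAt (I.prod 𝓘(ℝ, ℝ)) (I.prod 𝓘(ℝ, ℝ)) ∞ S (proj φ z) :=
      (contMDiffOn_localInverseAt φ z).contMDiffAt (S.open_source.mem_nhds hp)
    have h2 : ContMDiff (I.prod 𝓘(ℝ, ℝ)).tangent (I.prod 𝓘(ℝ, ℝ)).tangent ∞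
        (tangentMap (I.prod 𝓘(ℝ, ℝ)) (I.prod 𝓘(ℝ, ℝ)) (proj φ)) :=
      (contMDiff_proj φ).contMDiff_tangentMap (m := ∞) (n := ∞) (by simp)
    refine ((h2.comp contMDiff_unit_field).contMDiffAt.comp _ h1).congr_of_eventuallyEq ?_
    filter_upwards [S.open_source.mem_nhds hp] with q hq
    have h3 : proj φ (S q) = q := (isLocalHomeomorph_proj φ).apply_localInverseAt_of_mem hq
    have h4 : (⟨q, ddt φ q⟩ : TangentBundle (I.prod 𝓘(ℝ, ℝ)) (MappingTorus φ)) =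
      ⟨proj φ (S q), ddt φ (proj φ (S q))⟩ := by rw [h3]
    refine h4.trans ?_
    rw [ddt_proj]
    rfl

end MappingTorus
end ModelForms

section ModelFoliation

namespace MappingTorus

variable {E : Type*} [NormedAddCommGroup E] [NormedSpace ℝ E] [FiniteDimensional ℝ E]
  {H : Type*} [TopologicalSpace H] {I : ModelWithCorners ℝ E H} [I.Boundaryless]
  {L : Type*} [TopologicalSpace L] [ChartedSpace H L] [IsManifold I ∞ L] [T2Space L]
  [CompactSpace L]

lemma covectorPullback_fst_apply (α : OneForm I L) (z : L × ℝ) (v : E × ℝ) :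
    (covectorPullback (I.prod 𝓘(ℝ, ℝ)) I Prod.fst α z : E × ℝ →L[ℝ] ℝ) v =
      (α z.1 : E →L[ℝ] ℝ) v.1 :=
  congrArg (α z.1 : E →L[ℝ] ℝ) (mfderiv_prod_fst_apply z v)

lemma modelForm₁_ne_zero (φ : L ≃ₘ⟮I, I⟯ L) (α : OneForm I L) (hα : ∀ x, α x ≠ 0) (lam : ℝ)
    (hφ : ∀ x, covectorPullback I I φ α x = Real.exp lam • α x) (p : MappingTorus φ) :
    modelForm₁ φ α lam p ≠ 0 := by
  obtain ⟨z, rfl⟩ := proj_surjective φ p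
  intro h0
  have h1 := pullback_modelForm₁ φ α lam hφ z
  refine hα z.1 (ContinuousLinearMap.ext fun v ↦ ?_)
  have h2 : Real.exp (-lam * z.2) * (covectorPullback (I.prod 𝓘(ℝ, ℝ)) I Prod.fst α z :
      E × ℝ →L[ℝ] ℝ) (v, 0) = 0 := by
    refine Eq.trans (congrArg (fun A : E × ℝ →L[ℝ] ℝ ↦ A (v, 0)) h1).symm ?_
    simp only [covectorPullback, h0]
    rfl
  rw [covectorPullback_fst_apply] at h2
  exact (mul_eq_zero.1 h2).resolve_left (Real.exp_pos _).ne'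

lemma modelForm₁_ddt (φ : L ≃ₘ⟮I, I⟯ L) (α : OneForm I L) (lam : ℝ) (p : MappingTorus φ) :
    modelForm₁ φ α lam p (ddt φ p) = 0 := by
  refine (descend_ddt φ _ p).trans (mul_eq_zero.2 (Or.inr ?_))
  refine (covectorPullback_fst_apply α (rep φ p) (0, 1)).trans ?_
  exact map_zero _

lemma modelForm₂_ddt (φ : L ≃ₘ⟮I, I⟯ L) (lam : ℝ) (p : MappingTorus φ) :
    modelForm₂ φ lam p (ddt φ p) = -lam := by
  refine (descend_ddt φ _ p).trans ?_
  change -lam * (mvfderiv (I.prod 𝓘(ℝ, ℝ)) (Prod.snd : L × ℝ → ℝ) (rep φ p) : E × ℝ →L[ℝ] ℝ)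
    (0, 1) = _
  rw [mfderiv_prod_snd_apply, mul_one]

lemma bumpForm_ddt (φ : L ≃ₘ⟮I, I⟯ L) (ρ : ℝ → ℝ) (β : OneForm I L) (p : MappingTorus φ) :
    bumpForm φ ρ β p (ddt φ p) = 0 := by
  refine (descend_ddt φ _ p).trans (mul_eq_zero.2 (Or.inr ?_))
  refine (covectorPullback_fst_apply β (rep φ p) (0, 1)).trans ?_
  exact map_zero _

lemma exists_smoothNear_comp_localInverseAt (φ : L ≃ₘ⟮I, I⟯ L) (α : closedOneForms I L)
    (z : L × ℝ) : ∃ f : MappingTorus φ → ℝ, SmoothNear (I.prod 𝓘(ℝ, ℝ)) f (proj φ z) ∧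
      ∀ᶠ p in 𝓝 (proj φ z), mvfderiv (I.prod 𝓘(ℝ, ℝ)) f p =
        covectorPullback (I.prod 𝓘(ℝ, ℝ)) (I.prod 𝓘(ℝ, ℝ))
          ((isLocalHomeomorph_proj φ).localInverseAt z)
          (covectorPullback (I.prod 𝓘(ℝ, ℝ)) I Prod.fst α.1) p := by
  set S := (isLocalHomeomorph_proj φ).localInverseAt z with hS
  have hz : proj φ z ∈ S.source :=
    (isLocalHomeomorph_proj φ).apply_self_mem_localInverseAt_source
  have hSz : S (proj φ z) = z := (isLocalHomeomorph_proj φ).localInverseAt_apply_self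
  obtain ⟨U, f, -, hU, hxU, -, -, hf, hfα, -⟩ := exists_local_primitive α z.1
  have hSt : Tendsto S (𝓝 (proj φ z)) (𝓝 z) := by
    have := S.continuousAt hz
    rwa [ContinuousAt, hSz] at this
  have hev : ∀ᶠ p in 𝓝 (proj φ z), p ∈ S.source ∧ (S p).1 ∈ U :=
    Eventually.and (S.open_source.mem_nhds hz)
      (hSt.eventually (continuous_fst.continuousAt.preimage_mem_nhds (hU.mem_nhds hxU)))
  have hfs : ∀ x ∈ U, ContMDiffAt I 𝓘(ℝ, ℝ) ∞ f x := fun x hx ↦ hf.contMDiffAt (hU.mem_nhds hx)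
  refine ⟨(f ∘ Prod.fst) ∘ S, ?_, ?_⟩
  · filter_upwards [hev] with p ⟨h1, h2⟩
    exact ((hfs _ h2).comp (S p) contMDiffAt_fst).comp p
      ((contMDiffOn_localInverseAt φ z).contMDiffAt (S.open_source.mem_nhds h1))
  · filter_upwards [hev] with p ⟨h1, h2⟩
    have h3 : MDifferentiableAt I 𝓘(ℝ, ℝ) f (S p).1 := (hfs _ h2).mdifferentiableAt (by simp)
    rw [mvfderiv_comp_localInverseAt φ z h1 (h3.comp (S p) mdifferentiableAt_fst)]
    have h4 : mvfderiv (I.prod 𝓘(ℝ, ℝ)) (f ∘ Prod.fst) (S p) =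
        covectorPullback (I.prod 𝓘(ℝ, ℝ)) I Prod.fst α.1 (S p) := by
      rw [mvfderiv_comp (I := I) (I' := I.prod 𝓘(ℝ, ℝ)) (S p) h3 mdifferentiableAt_fst,
        covectorPullback, hfα _ h2]
    simp only [covectorPullback] at h4 ⊢
    rw [h4]

/-- The local structure of the forms `e^{-λt} α`, `-λ dt` and `ρ(t) β`. -/
lemma definingForms (φ : L ≃ₘ⟮I, I⟯ L) (α β : closedOneForms I L) (hα : ∀ x, α.1 x ≠ 0)
    {lam : ℝ} (hlam : lam ≠ 0) (hφ : ∀ x, covectorPullback I I φ α.1 x = Real.exp lam • α.1 x)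
    {ρ : ℝ → ℝ} (hρ : ContDiff ℝ ∞ ρ) (hsupp : tsupport ρ ⊆ Ioo 0 1) :
    DefiningForms (modelForm₁ φ α.1 lam) (modelForm₂ φ lam) (bumpForm φ ρ β.1) (-lam)
      (ddtField φ) where
  ne_zero := neg_ne_zero.2 hlam
  form_ne_zero := modelForm₁_ne_zero φ α.1 hα lam hφ
  form₁_field := modelForm₁_ddt φ α.1 lam
  form₂_field := modelForm₂_ddt φ lam
  bump_field := bumpForm_ddt φ ρ β.1
  exists_local p₀ := by
    obtain ⟨z, ⟨rfl, hz01⟩, -⟩ := existsUnique_rep φ p₀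
    set S := (isLocalHomeomorph_proj φ).localInverseAt z with hS
    have hz : proj φ z ∈ S.source :=
      (isLocalHomeomorph_proj φ).apply_self_mem_localInverseAt_source
    have hSz : S (proj φ z) = z := (isLocalHomeomorph_proj φ).localInverseAt_apply_self
    have hSt : Tendsto S (𝓝 (proj φ z)) (𝓝 z) := by
      have := S.continuousAt hz
      rwa [ContinuousAt, hSz] at this
    have hSt2 : Tendsto (fun p ↦ (S p).2) (𝓝 (proj φ z)) (𝓝 z.2) :=
      (continuous_snd.tendsto z).comp hSt
    obtain ⟨f, hf, hfα⟩ := exists_smoothNear_comp_localInverseAt φ α z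
    obtain ⟨g, hg, hgβ⟩ := exists_smoothNear_comp_localInverseAt φ β z
    have hsource : ∀ᶠ p in 𝓝 (proj φ z), p ∈ S.source := S.open_source.mem_nhds hz
    have hτ : SmoothNear (I.prod 𝓘(ℝ, ℝ)) (Prod.snd ∘ S) (proj φ z) := by
      filter_upwards [hsource] with p h1
      exact contMDiffAt_snd.comp p
        ((contMDiffOn_localInverseAt φ z).contMDiffAt (S.open_source.mem_nhds h1))
    obtain ⟨r, hr, hbump⟩ : ∃ r : ℝ → ℝ, ContDiff ℝ ∞ r ∧ ∀ᶠ p in 𝓝 (proj φ z),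
        bumpForm φ ρ β.1 p = r (S p).2 • mvfderiv (I.prod 𝓘(ℝ, ℝ)) g p := by
      rcases hz01.1.eq_or_lt with h0 | h0
      · refine ⟨0, contDiff_const, ?_⟩
        have e0 : ∀ᶠ t in 𝓝 z.2, ρ t = 0 := by
          rw [← h0]
          exact notMem_tsupport_iff_eventuallyEq.1 fun h ↦ (hsupp h).1.false
        have e1 : ∀ᶠ t in 𝓝 z.2, ρ (t + 1) = 0 := by
          have : Tendsto (fun t : ℝ ↦ t + 1) (𝓝 z.2) (𝓝 1) := by
            rw [← h0]
            exact Continuous.tendsto' (by fun_prop) _ _ (zero_add 1)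
          exact this.eventually
            (notMem_tsupport_iff_eventuallyEq.1 fun h ↦ (hsupp h).2.false)
        have e2 : ∀ᶠ t in 𝓝 z.2, t ∈ Ioo (-1 : ℝ) 1 :=
          isOpen_Ioo.mem_nhds (by rw [← h0]; norm_num)
        filter_upwards [hsource, hSt2.eventually e0, hSt2.eventually e1, hSt2.eventually e2]
          with p h1 h2 h3 h4
        have hp : proj φ (S p) = p := (isLocalHomeomorph_proj φ).apply_localInverseAt_of_mem h1
        have hu : ∀ {w}, proj φ w = p ∧ w.2 ∈ Ico (0 : ℝ) 1 → rep φ p = w := fun hw ↦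
          (existsUnique_rep φ p).unique (existsUnique_rep φ p).choose_spec.1 hw
        have h5 : ρ (rep φ p).2 = 0 := by
          rcases le_or_gt 0 (S p).2 with h | h
          · have : rep φ p = S p := hu ⟨hp, h, h4.2⟩
            rw [this, h2]
          · have : rep φ p = deckMap φ 1 (S p) := hu
              ⟨((proj_eq_iff φ).2 ⟨1, rfl⟩).trans hp, by
                change (S p).2 + ((1 : ℤ) : ℝ) ∈ _
                push_cast
                exact ⟨by linarith [h4.1], by linarith⟩⟩
            rw [this]
            change ρ ((S p).2 + ((1 : ℤ) : ℝ)) = 0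
            rw [Int.cast_one, h3]
        have h6 : bumpForm φ ρ β.1 p = 0 := descend_eq_zero φ _ (by rw [h5]; exact zero_smul _ _)
        rw [h6]
        exact (zero_smul ℝ _).symm
      · refine ⟨ρ, hρ, ?_⟩
        have e2 : ∀ᶠ t in 𝓝 z.2, t ∈ Ioo (0 : ℝ) 1 := isOpen_Ioo.mem_nhds ⟨h0, hz01.2⟩
        filter_upwards [hsource, hSt2.eventually e2, hgβ] with p h1 h2 h3
        rw [h3, eq_covectorPullback_localInverseAt φ z h1 (bumpForm φ ρ β.1)]
        have h4 := pullback_descend_of_mem φ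
          (fun z ↦ ρ z.2 • covectorPullback (I.prod 𝓘(ℝ, ℝ)) I Prod.fst β.1 z) (z := S p)
          ⟨h2.1.le, h2.2⟩
        exact congrArg (fun A : E × ℝ →L[ℝ] ℝ ↦
          A.comp (mfderiv (I.prod 𝓘(ℝ, ℝ)) (I.prod 𝓘(ℝ, ℝ)) S p : E × ℝ →L[ℝ] E × ℝ)) h4
    refine ⟨f, Prod.snd ∘ S, g, fun p ↦ Real.exp (-lam * (S p).2), r, hr, hf, hτ, hg, ?_⟩
    filter_upwards [hsource, hfα, hbump] with p h1 h2 h3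
    refine ⟨(Real.exp_pos _).ne', ?_, ?_, h3⟩
    · rw [h2, eq_covectorPullback_localInverseAt φ z h1 (modelForm₁ φ α.1 lam)]
      exact congrArg (fun A : E × ℝ →L[ℝ] ℝ ↦
        A.comp (mfderiv (I.prod 𝓘(ℝ, ℝ)) (I.prod 𝓘(ℝ, ℝ)) S p : E × ℝ →L[ℝ] E × ℝ))
        (pullback_modelForm₁ φ α.1 lam hφ (S p))
    · rw [eq_covectorPullback_localInverseAt φ z h1 (modelForm₂ φ lam),
        mvfderiv_comp_localInverseAt φ z h1 mdifferentiableAt_snd]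
      exact congrArg (fun A : E × ℝ →L[ℝ] ℝ ↦
        A.comp (mfderiv (I.prod 𝓘(ℝ, ℝ)) (I.prod 𝓘(ℝ, ℝ)) S p : E × ℝ →L[ℝ] E × ℝ))
        (pullback_modelForm₂ φ lam (S p))

/-- The form `ρ(t) β` has no leafwise primitive. -/
lemma false_of_leafwise_primitive [ConnectedSpace L] (φ : L ≃ₘ⟮I, I⟯ L) (α β : closedOneForms I L)
    (hα : ∀ x, α.1 x ≠ 0) {lam : ℝ} (hlam : lam ≠ 0)
    (hφ : ∀ x, covectorPullback I I φ α.1 x = Real.exp lam • α.1 x)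
    (hli : LinearIndependent ℝ
      ![(Submodule.Quotient.mk α : DeRhamH1 I L), Submodule.Quotient.mk β])
    {ρ : ℝ → ℝ} (hsupp : tsupport ρ ⊆ Ioo 0 1) (hne : ρ ≠ 0) {b : MappingTorus φ → ℝ}
    (hb : ∀ p, SmoothNear (I.prod 𝓘(ℝ, ℝ)) b p)
    (hbB : ∀ p v, modelForm₁ φ α.1 lam p v = 0 → modelForm₂ φ lam p v = 0 →
      mvfderiv (I.prod 𝓘(ℝ, ℝ)) b p v = -(-lam)⁻¹ * bumpForm φ ρ β.1 p v) : False := by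
  obtain ⟨t, ht⟩ : ∃ t, ρ t ≠ 0 := by
    by_contra! h
    exact hne (funext h)
  have ht01 : t ∈ Ioo (0 : ℝ) 1 := hsupp (subset_tsupport ρ ht)
  have hslice : ContMDiff I (I.prod 𝓘(ℝ, ℝ)) ∞ fun x : L ↦ (x, t) :=
    contMDiff_id.prodMk contMDiff_const
  have hbs : ∀ x, ContMDiffAt I 𝓘(ℝ, ℝ) ∞ (fun x ↦ b (proj φ (x, t))) x := fun x ↦
    ContMDiffAt.comp x (hb _).self_of_nhds (((contMDiff_proj φ).comp hslice) x)
  have hbn : ∀ x, SmoothNear I (fun x ↦ b (proj φ (x, t))) x := fun x ↦ Eventually.of_forall hbs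
  obtain ⟨c, hc⟩ := exists_eq_smul_add_mvfderiv φ α β hα hlam hφ
    (b := fun x ↦ lam / ρ t * b (proj φ (x, t)))
    (fun x ↦ (smoothNear_const _ x).mul (hbn x)) fun x (v : E) hv ↦ by
      have h1 : mvfderiv I ((b ∘ proj φ) ∘ fun x : L ↦ (x, t)) x = _ :=
        mvfderiv_comp (I := I.prod 𝓘(ℝ, ℝ)) (I' := I) x
          (((hb _).mdifferentiableAt).comp (x, t) ((contMDiff_proj φ _).mdifferentiableAt (by simp)))
          ((hslice x).mdifferentiableAt (by simp))
      rw [mfderiv_prod_left, mvfderiv_comp (I := I.prod 𝓘(ℝ, ℝ)) (I' := I.prod 𝓘(ℝ, ℝ)) (x, t)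
        (hb _).mdifferentiableAt ((contMDiff_proj φ _).mdifferentiableAt (by simp))] at h1
      have h2 : mvfderiv I (fun x ↦ b (proj φ (x, t))) x v =
          mvfderiv (I.prod 𝓘(ℝ, ℝ)) b (proj φ (x, t))
            (mfderiv (I.prod 𝓘(ℝ, ℝ)) (I.prod 𝓘(ℝ, ℝ)) (proj φ) (x, t) ((v, 0) : E × ℝ)) :=
        congrArg (fun A : E →L[ℝ] ℝ ↦ A v) h1
      have h3 := congrArg (fun A : E × ℝ →L[ℝ] ℝ ↦ A (v, 0))
        (pullback_modelForm₁ φ α.1 lam hφ (x, t))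
      have h4 := congrArg (fun A : E × ℝ →L[ℝ] ℝ ↦ A (v, 0)) (pullback_modelForm₂ φ lam (x, t))
      have h5 := congrArg (fun A : E × ℝ →L[ℝ] ℝ ↦ A (v, 0)) (pullback_descend_of_mem φ
        (fun z ↦ ρ z.2 • covectorPullback (I.prod 𝓘(ℝ, ℝ)) I Prod.fst β.1 z) (z := (x, t))
        ⟨ht01.1.le, ht01.2⟩)
      have h6 := hbB (proj φ (x, t))
        (mfderiv (I.prod 𝓘(ℝ, ℝ)) (I.prod 𝓘(ℝ, ℝ)) (proj φ) (x, t) ((v, 0) : E × ℝ))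
        (h3.trans (mul_eq_zero.2 (Or.inr ((covectorPullback_fst_apply α.1 (x, t) (v, 0)).trans hv))))
        (h4.trans (mul_eq_zero.2 (Or.inr (mfderiv_prod_snd_apply (x, t) (v, 0)))))
      have h7 : bumpForm φ ρ β.1 (proj φ (x, t))
          (mfderiv (I.prod 𝓘(ℝ, ℝ)) (I.prod 𝓘(ℝ, ℝ)) (proj φ) (x, t) ((v, 0) : E × ℝ)) =
          ρ t * β.1 x v :=
        h5.trans (congrArg (ρ t * ·) (covectorPullback_fst_apply β.1 (x, t) (v, 0)))
      rw [mvfderiv_const_mul _ (hbn x).mdifferentiableAt]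
      change β.1 x v = lam / ρ t * mvfderiv I (fun x ↦ b (proj φ (x, t))) x v
      rw [h2, h6, h7]
      field_simp
  exact not_linearIndependent_of_eq_smul_add α β
    (fun x ↦ (smoothNear_const _ x).mul (hbn x)) hc hli

lemma exists_model_cocycle [ConnectedSpace L] (φ : L ≃ₘ⟮I, I⟯ L) (α β : closedOneForms I L)
    (hα : ∀ x, α.1 x ≠ 0) {lam : ℝ} (hlam : lam ≠ 0)
    (hφ : ∀ x, covectorPullback I I φ α.1 x = Real.exp lam • α.1 x)
    (hli : LinearIndependent ℝ
      ![(Submodule.Quotient.mk α : DeRhamH1 I L), Submodule.Quotient.mk β])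
    {ρ : ℝ → ℝ} (hρ : ContDiff ℝ ∞ ρ) (hsupp : tsupport ρ ⊆ Ioo 0 1) (hne : ρ ≠ 0) :
    ∃ η : ((definingForms φ α β hα hlam hφ hρ hsupp).foliation 0).normalCocycles,
      (∀ p (v : ((definingForms φ α β hα hlam hφ hρ hsupp).foliation 0).tangent p),
        η.1.1 p v = (lam⁻¹ * bumpForm φ ρ β.1 p v) •
          ((definingForms φ α β hα hlam hφ hρ hsupp).foliation 0).normalProj p (ddt φ p)) ∧
      ((definingForms φ α β hα hlam hφ hρ hsupp).foliation 0).IsInfinitesimalDeformation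
        (definingForms φ α β hα hlam hφ hρ hsupp).foliation η.1 ∧
      (Submodule.Quotient.mk η :
        ((definingForms φ α β hα hlam hφ hρ hsupp).foliation 0).NormalH1) ≠ 0 := by
  exact DefiningForms.exists_cocycle _ (by rw [inv_neg, neg_neg]) (fun p ↦ rfl) fun b hb hbB ↦
    false_of_leafwise_primitive φ α β hα hlam hφ hli hsupp hne hb hbB

end MappingTorus

lemma exists_bump_Ioo : ∃ ρ : ℝ → ℝ, ContDiff ℝ ∞ ρ ∧ tsupport ρ ⊆ Ioo 0 1 ∧ ρ ≠ 0 := by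
  let f : ContDiffBump (1 / 2 : ℝ) := ⟨1 / 8, 1 / 4, by norm_num, by norm_num⟩
  refine ⟨f, f.contDiff, ?_, fun h ↦ ?_⟩
  · rw [f.tsupport_eq, Real.closedBall_eq_Icc]
    exact Icc_subset_Ioo (by norm_num) (by norm_num)
  · have h1 := f.one_of_mem_closedBall (x := 1 / 2) (by simp [f])
    rw [h] at h1
    exact zero_ne_one h1

end ModelFoliation

end

theorem mainTheorem10 {n : ℕ} {L : Type*} [TopologicalSpace L]
    [ChartedSpace (EuclideanSpace ℝ (Fin n)) L] [IsManifold (𝓡 n) ∞ L] [T2Space L]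
    [CompactSpace L] [ConnectedSpace L] (φ : L ≃ₘ⟮𝓡 n, 𝓡 n⟯ L)
    (α : closedOneForms (𝓡 n) L) (hα : ∀ x, α.1 x ≠ 0) (lam : ℝ) (hlam : lam ≠ 0)
    (hφ : ∀ x, covectorPullback (𝓡 n) (𝓡 n) φ α.1 x = Real.exp lam • α.1 x) :
    ∃ G : Foliation ((𝓡 n).prod 𝓘(ℝ, ℝ)) (MappingTorus φ),
      (∀ p v, v ∈ G.tangent p ↔
        MappingTorus.modelForm₁ φ α.1 lam p v = 0 ∧ MappingTorus.modelForm₂ φ lam p v = 0) ∧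
      ¬ G.IsRigid ∧
      (∃ β : closedOneForms (𝓡 n) L, LinearIndependent ℝ
        ![(Submodule.Quotient.mk α : DeRhamH1 (𝓡 n) L), Submodule.Quotient.mk β]) ∧
      ∀ β : closedOneForms (𝓡 n) L, LinearIndependent ℝ
          ![(Submodule.Quotient.mk α : DeRhamH1 (𝓡 n) L), Submodule.Quotient.mk β] →
        ∀ ρ : ℝ → ℝ, ContDiff ℝ ∞ ρ → tsupport ρ ⊆ Ioo 0 1 → ρ ≠ 0 →
          ∃ Gs : ℝ → Foliation ((𝓡 n).prod 𝓘(ℝ, ℝ)) (MappingTorus φ),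
            (∀ s p v, v ∈ (Gs s).tangent p ↔
              MappingTorus.modelForm₁ φ α.1 lam p v = 0 ∧
              MappingTorus.modelForm₂ φ lam p v + s * MappingTorus.bumpForm φ ρ β.1 p v = 0) ∧
            (∀ δ > 0, G.IsDeformation δ Gs) ∧
            (∃ η : G.normalCocycles,
              (∀ p (v : G.tangent p), η.1.1 p v =
                (lam⁻¹ * MappingTorus.bumpForm φ ρ β.1 p v) •
                  G.normalProj p (MappingTorus.ddt φ p)) ∧
              G.IsInfinitesimalDeformation Gs η.1 ∧
              (Submodule.Quotient.mk η : G.NormalH1) ≠ 0) ∧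
            ¬ G.IsGeneratedByIsotopy Gs := by
  have hρ0 : ContDiff ℝ ∞ (0 : ℝ → ℝ) := contDiff_const
  have h0 := MappingTorus.definingForms φ α α hα hlam hφ hρ0 (by simp)
  have htangent : ∀ (β : closedOneForms (𝓡 n) L) (ρ : ℝ → ℝ) (hρ : ContDiff ℝ ∞ ρ)
      (hsupp : tsupport ρ ⊆ Ioo 0 1),
      ((MappingTorus.definingForms φ α β hα hlam hφ hρ hsupp).foliation 0) =
        h0.foliation 0 := by
    intro β ρ hρ hsupp
    have : DefiningForms.distribution (MappingTorus.modelForm₁ φ α.1 lam)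
        (MappingTorus.modelForm₂ φ lam) (MappingTorus.bumpForm φ ρ β.1) 0 =
        DefiningForms.distribution (MappingTorus.modelForm₁ φ α.1 lam)
        (MappingTorus.modelForm₂ φ lam) (MappingTorus.bumpForm φ 0 α.1) 0 := by
      funext p
      ext v
      simp only [DefiningForms.mem_distribution, zero_mul]
    simp only [DefiningForms.foliation, this]
  have hiso : ∀ β : closedOneForms (𝓡 n) L, LinearIndependent ℝ
        ![(Submodule.Quotient.mk α : DeRhamH1 (𝓡 n) L), Submodule.Quotient.mk β] →
      ∀ (ρ : ℝ → ℝ) (hρ : ContDiff ℝ ∞ ρ) (hsupp : tsupport ρ ⊆ Ioo 0 1), ρ ≠ 0 →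
        ¬ (h0.foliation 0).IsGeneratedByIsotopy
          (MappingTorus.definingForms φ α β hα hlam hφ hρ hsupp).foliation := by
    intro β hβ ρ hρ hsupp hne hcon
    rw [← htangent β ρ hρ hsupp] at hcon
    obtain ⟨b, hb, hbB⟩ := DefiningForms.exists_leafwise_primitive_of_isGeneratedByIsotopy _ hcon
    exact MappingTorus.false_of_leafwise_primitive φ α β hα hlam hφ hβ hsupp hne hb hbB
  refine ⟨h0.foliation 0, fun p v ↦ ?_, fun hrigid ↦ ?_,
    exists_linearIndependent_mk φ α hα hlam hφ, fun β hβ ρ hρ hsupp hne ↦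
      ⟨(MappingTorus.definingForms φ α β hα hlam hφ hρ hsupp).foliation, fun s p v ↦ Iff.rfl,
        fun δ _ ↦ ?_, ?_, hiso β hβ ρ hρ hsupp hne⟩⟩
  · refine DefiningForms.mem_distribution.trans ?_
    rw [zero_mul, add_zero]
  · obtain ⟨β, hβ⟩ := exists_linearIndependent_mk φ α hα hlam hφ
    obtain ⟨ρ, hρ, hsupp, hne⟩ := exists_bump_Ioo
    refine hiso β hβ ρ hρ hsupp hne (hrigid 1 one_pos _ ?_)
    rw [← htangent β ρ hρ hsupp]
    exact DefiningForms.isDeformation _ 1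
  · rw [← htangent β ρ hρ hsupp]
    exact DefiningForms.isDeformation _ δ
  · rw [← htangent β ρ hρ hsupp]
    exact MappingTorus.exists_model_cocycle φ α β hα hlam hφ hβ hρ hsupp hne
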